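/- **Setting.** Let $M$ be a smooth (Hausdorff) $n$-manifold and $(E,[\cdot,\cdot]_E,\sigma)$ a Lie algebroid over $M$: $\pi:E\to M$ is a smooth vector bundle of rank $m$, $[\cdot,\cdot]_E$ a Lie bracket on $\Gamma(E)$, and $\sigma:E\to TM$ a smooth bundle map inducing a Lie algebra homomorphism $\Gamma(E)\to\mathfrak X(M)$ with $[s,ft]_E=f[s,t]_E+(\sigma(s)f)\,t$. Its prolongation $\mathcal TE\to E$ has the fibres $\mathcal T_wE=\{(u,v)\in E_{\pi(w)}\times T_wE:\sigma(u)=T_w\pi(v)\}$, the anchor $\sigma^1(u,v)=v$, and the bracket $[\cdot,\cdot]$ that extends $[(s\circ\pi,X),(t\circ\pi,Y)]=([s,t]_E\circ\pi,[X,Y])$ by the Leibniz rule; $d$ is its exterior derivative, and $\rho(f):=\sigma^1(\rho)f$ for a section $\rho$ of $\mathcal TE$. The vertical bundle $V\mathcal TE$ consists of the pairs $(0,v)$. For $a\in E_{\pi(w)}$ let $a^v_w\in T_wE$ be the velocity of $t\mapsto w+ta$ at $t=0$; put $J(u,v)=(0,u^v_w)$ and $C(w)=(0,w^v_w)$. Let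 $W\subseteq E$ be open (for instance $W=E\setminus\{0\}$ or $W=E$) and let $L$ be a smooth function on $W$ that is a regular Lagrangian there, i.e. its Hessian $g=\big(\partial^2L/\partial y^\alpha\partial y^\beta\big)$ along the fibres of $E$ has rank $m$ at each point of $W$; $g$ is regarded as a pseudo-Riemannian metric on $V\mathcal TE|_W$. Put $\theta_L(\rho)=dL(J\rho)$, $\omega_L=d\theta_L$, $E_L=C(L)-L$. All sections below are smooth sections of $\mathcal TE$ over $W$. A *nonlinear connection* (over $W$) is a smooth bundle endomorphism $\mathcal N$ of $\mathcal TE|_W$ with $\mathcal N^2=\mathrm{Id}$ and $\ker(\mathrm{Id}+\mathcal N)=V\mathcal TE$; put $h=\frac12(\mathrm{Id}+\mathcal N)$ and $v=\frac12(\mathrm{Id}-\mathcal N)$. Given a section $\mathcal S$, its dynamical covariant derivative is $\nabla\rho=h[\mathcal S,h\rho]+v[\mathcal S,v\rho]$. $\mathcal N$ is *metric* if $\nabla g=0$, i.e. $\mathcal S(g(\rho,\nu))=g(\nabla\rho,\nu)+g(\rho,\nabla\nu)$ for all vertical sections $\rho,\nu$, and *compatible with* $\omega_L$ if $\omega_L(h\rho,h\nu)=0$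 for all sections $\rho,\nu$. In a local frame $(s_\alpha)$ of $E$ over an open $U\subseteq M$, with coordinates $x^i$ on $M$ and fibre coordinates $y^\alpha$, write $\sigma(s_\alpha)=\sigma^i_\alpha\,\partial/\partial x^i$, $[s_\alpha,s_\beta]_E=L^\gamma_{\alpha\beta}s_\gamma$, $\mathcal X_\alpha=(s_\alpha\circ\pi,\sigma^i_\alpha\,\partial/\partial x^i)$, $\mathcal V_\alpha=(0,\partial/\partial y^\alpha)$, $h(\mathcal X_\beta)=\mathcal X_\beta-\mathcal N^\alpha_\beta\mathcal V_\alpha$ and $\mathcal N_{\alpha\beta}=g_{\alpha\gamma}\mathcal N^\gamma_\beta$. **Theorem.** There is a unique section $\mathcal S$ of $\mathcal TE$ over $W$ with $i_{\mathcal S}\omega_L=-dE_L$, and it is a semispray: $J\mathcal S=C$. The formula $\mathcal N(\rho)=-[\mathcal S,J\rho]+J[\mathcal S,\rho]$ defines a nonlinear connection over $W$ (the canonical one), whose coefficients in every local frame are $$\mathcal N^\alpha_\beta=\tfrac12g^{\alpha\varepsilon}\Big[\mathcal S(g_{\varepsilon\beta})+\sigma^i_\beta\frac{\partial^2L}{\partial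 x^i\partial y^\varepsilon}-\sigma^i_\varepsilon\frac{\partial^2L}{\partial x^i\partial y^\beta}-L^\gamma_{\beta\varepsilon}\frac{\partial L}{\partial y^\gamma}+\big(g_{\gamma\varepsilon}L^\gamma_{\beta\theta}+g_{\gamma\beta}L^\gamma_{\varepsilon\theta}\big)y^\theta\Big].$$ With $\nabla$ induced by $\mathcal S$, the canonical connection is metric and compatible with $\omega_L$, and it is the only nonlinear connection over $W$ with these two properties. Moreover, an arbitrary nonlinear connection over $W$ is metric if and only if in every local frame $$\tfrac12(\mathcal N_{\alpha\beta}+\mathcal N_{\beta\alpha})=\tfrac12\Big(\mathcal S(g_{\alpha\beta})+\big(g_{\gamma\beta}L^\gamma_{\alpha\varepsilon}+g_{\gamma\alpha}L^\gamma_{\beta\varepsilon}\big)y^\varepsilon\Big),$$ and it is compatible with $\omega_L$ if and only if in every local frame $$\tfrac12(\mathcal N_{\alpha\beta}-\mathcal N_{\beta\alpha})=\tfrac12\Big(\sigma^i_\beta\frac{\partial^2L}{\partial x^i\partial y^\alpha}-\sigma^i_\alpha\frac{\partial^2L}{\partial x^i\partial y^\beta}+L^\gamma_{\alpha\beta}\frac{\partial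 L}{\partial y^\gamma}\Big).$$ -/

import Mathlib

open Bundle Set Filter Topology
open scoped Manifold ContDiff

noncomputable section

/-- The model fibre `ℝ^m` of a vector bundle of rank `m`. -/
abbrev Fib (m : ℕ) := EuclideanSpace ℝ (Fin m)

/-- The model with corners of the total space of a rank `m` bundle over an `n`-manifold. -/
abbrev IE (n m : ℕ) := (𝓡 n).prod 𝓘(ℝ, Fib m)

section LieAlgebroid

variable (n m : ℕ) {M : Type*} [TopologicalSpace M] [ChartedSpace (EuclideanSpace ℝ (Fin n)) M]
  (E : M → Type*) [TopologicalSpace (TotalSpace (Fib m) E)]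
  [∀ x, AddCommGroup (E x)] [∀ x, Module ℝ (E x)] [∀ x, TopologicalSpace (E x)]
  [FiberBundle (Fib m) E] [VectorBundle ℝ (Fib m) E]
  [IsManifold (𝓡 n) ∞ M] [ContMDiffVectorBundle ∞ (Fib m) E (𝓡 n)]

/-- A Lie algebroid structure on the smooth vector bundle `E → M`: a Lie bracket on the smooth
sections and a smooth bundle map `σ : E → TM` (the anchor), which is a Lie algebra homomorphism
on sections and satisfies the Leibniz rule. -/
structure LieAlgebroid where
  bracket : Cₛ^∞⟮𝓡 n; Fib m, E⟯ → Cₛ^∞⟮𝓡 n; Fib m, E⟯ → Cₛ^∞⟮𝓡 n; Fib m, E⟯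
  add_bracket : ∀ s s' t, bracket (s + s') t = bracket s t + bracket s' t
  smul_bracket : ∀ (c : ℝ) s t, bracket (c • s) t = c • bracket s t
  skew : ∀ s t, bracket s t = -bracket t s
  jacobi : ∀ s₁ s₂ s₃, bracket s₁ (bracket s₂ s₃) + bracket s₂ (bracket s₃ s₁)
    + bracket s₃ (bracket s₁ s₂) = 0
  anchor : ∀ x : M, E x →ₗ[ℝ] TangentSpace (𝓡 n) x
  anchor_smooth : ContMDiff (IE n m) (𝓡 n).tangent ∞
    (fun u : TotalSpace (Fib m) E =>
      (⟨u.proj, anchor u.proj u.2⟩ : TangentBundle (𝓡 n) M))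
  anchor_bracket : ∀ s t (x : M), anchor x (bracket s t x) =
    VectorField.mlieBracket (𝓡 n) (fun y => anchor y (s y)) (fun y => anchor y (t y)) x
  leibniz : ∀ (f : M → ℝ), ContMDiff (𝓡 n) 𝓘(ℝ, ℝ) ∞ f →
    ∀ s t t' : Cₛ^∞⟮𝓡 n; Fib m, E⟯, (∀ x, t' x = f x • t x) →
    ∀ x, bracket s t' x =
      f x • bracket s t x + (mvfderiv (𝓡 n) f x (anchor x (s x))) • t x

end LieAlgebroid

section Vertical

variable {n m : ℕ} {M : Type*} [TopologicalSpace M] [ChartedSpace (EuclideanSpace ℝ (Fin n)) M]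
  {E : M → Type*} [TopologicalSpace (TotalSpace (Fib m) E)]
  [∀ x, AddCommGroup (E x)] [∀ x, Module ℝ (E x)] [∀ x, TopologicalSpace (E x)]
  [FiberBundle (Fib m) E] [VectorBundle ℝ (Fib m) E]

/-- The straight line `t ↦ w + t a` in the fibre through `w`. -/
def fiberLine (w : TotalSpace (Fib m) E) (a : E w.proj) (t : ℝ) : TotalSpace (Fib m) E :=
  ⟨w.proj, w.2 + t • a⟩

variable (n) in
/-- The vertical lift of `a ∈ E_{π(w)}` to `w`: the velocity of `t ↦ w + t a` at `t = 0`. -/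
def vlift (w : TotalSpace (Fib m) E) (a : E w.proj) : TangentSpace (IE n m) w :=
  mfderiv 𝓘(ℝ, ℝ) (IE n m) (fiberLine w a) 0 (1 : ℝ)

variable (n) in
/-- The inverse of `vlift` on vertical tangent vectors, computed in a trivialization (only used for
vertical vectors, on which it does not depend on the trivialization). -/
def fiberPart (w : TotalSpace (Fib m) E) (v : TangentSpace (IE n m) w) : E w.proj :=
  (trivializationAt (Fib m) E w.proj).symm w.proj
    (mvfderiv (IE n m) (fun w' => (trivializationAt (Fib m) E w.proj w').2) w v)

/-- The Hessian `(∂²L/∂y^α∂y^β) a^α b^β` of `L` along the fibre, at `w`. -/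
def fiberHess (L : TotalSpace (Fib m) E → ℝ) (w : TotalSpace (Fib m) E) (a b : E w.proj) : ℝ :=
  deriv (fun s : ℝ => deriv (fun t : ℝ => L ⟨w.proj, w.2 + s • a + t • b⟩) 0) 0

/-- `L` is a regular Lagrangian on `W`: its fibre Hessian has full rank at every point of `W`. -/
def IsRegularOn (L : TotalSpace (Fib m) E → ℝ) (W : Set (TotalSpace (Fib m) E)) : Prop :=
  ∀ w ∈ W, ∀ a : E w.proj, (∀ b, fiberHess L w a b = 0) → a = 0

lemma mfderiv_proj_vlift [IsManifold (𝓡 n) ∞ M] [ContMDiffVectorBundle ∞ (Fib m) E (𝓡 n)]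
    (w : TotalSpace (Fib m) E) (a : E w.proj) :
    mfderiv (IE n m) (𝓡 n) (TotalSpace.proj : TotalSpace (Fib m) E → M) w (vlift n w a) = 0 := by
  by_cases h : MDifferentiableAt 𝓘(ℝ, ℝ) (IE n m) (fiberLine w a) 0
  · have h0 : fiberLine w a 0 = w := by simp [fiberLine]
    have hp : MDifferentiableAt (IE n m) (𝓡 n)
        (TotalSpace.proj : TotalSpace (Fib m) E → M) (fiberLine w a 0) :=
      (contMDiff_proj (n := ∞) E).mdifferentiable (by simp) _
    have hc := mfderiv_comp (0 : ℝ) hp h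
    have hk : (TotalSpace.proj : TotalSpace (Fib m) E → M) ∘ fiberLine w a
        = fun _ => w.proj := rfl
    rw [hk, mfderiv_const] at hc
    have := congrArg (fun T => T (1 : ℝ)) hc
    rw [h0] at this
    exact this.symm
  · simp only [vlift, mfderiv_zero_of_not_mdifferentiableAt h]
    exact map_zero _

end Vertical

namespace LieAlgebroid

variable {n m : ℕ} {M : Type*} [TopologicalSpace M] [ChartedSpace (EuclideanSpace ℝ (Fin n)) M]
  {E : M → Type*} [TopologicalSpace (TotalSpace (Fib m) E)]
  [∀ x, AddCommGroup (E x)] [∀ x, Module ℝ (E x)] [∀ x, TopologicalSpace (E x)]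
  [FiberBundle (Fib m) E] [VectorBundle ℝ (Fib m) E]
  [IsManifold (𝓡 n) ∞ M] [ContMDiffVectorBundle ∞ (Fib m) E (𝓡 n)]
  (A : LieAlgebroid n m E)

open Classical in
/-- The bracket of sections that are only defined and smooth near `x`, evaluated at `x`: the bracket
of any global smooth sections with the same germs at `x`. -/
def localBracket (s t : ∀ x, E x) (x : M) : E x :=
  if h : ∃ p : Cₛ^∞⟮𝓡 n; Fib m, E⟯ × Cₛ^∞⟮𝓡 n; Fib m, E⟯,
      (∀ᶠ y in 𝓝 x, p.1 y = s y) ∧ (∀ᶠ y in 𝓝 x, p.2 y = t y)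
  then A.bracket h.choose.1 h.choose.2 x
  else 0

/-- The fibre at `w` of the prolongation `𝒯E`: pairs `(u, v) ∈ E_{π(w)} × T_w E` with
`σ(u) = T_w π (v)`. -/
def prolong (w : TotalSpace (Fib m) E) :
    Submodule ℝ (E w.proj × TangentSpace (IE n m) w) :=
  LinearMap.eqLocus ((A.anchor w.proj).comp (LinearMap.fst ℝ _ _))
    ((mfderiv (IE n m) (𝓡 n) (TotalSpace.proj : TotalSpace (Fib m) E → M) w).toLinearMap.comp
      (LinearMap.snd ℝ _ _))

/-- (Not necessarily smooth) sections of `𝒯E → E`. -/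
abbrev Sec := ∀ w : TotalSpace (Fib m) E, A.prolong w

variable {A}

/-- The section `ρ` of `𝒯E` is smooth on `W`: both of its components, the map `π₁ ∘ ρ : E → E` and
the vector field `σ¹(ρ)` on `E`, are smooth on `W`. -/
def SmoothOn (ρ : A.Sec) (W : Set (TotalSpace (Fib m) E)) : Prop :=
  ContMDiffOn (IE n m) (IE n m) ∞
      (fun w => (⟨w.proj, (ρ w).1.1⟩ : TotalSpace (Fib m) E)) W ∧
    ContMDiffOn (IE n m) (IE n m).tangent ∞
      (fun w => (⟨w, (ρ w).1.2⟩ : TangentBundle (IE n m) (TotalSpace (Fib m) E))) W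

/-- `z ∈ 𝒯_w E` is vertical if `π₁ z = 0`. -/
def IsVertical {w : TotalSpace (Fib m) E} (z : A.prolong w) : Prop := z.1.1 = 0

/-- `σ¹(ρ)(f)`: the derivative of the function `f` along the section `ρ` of `𝒯E`; also
`(d^E f)(ρ)`. -/
def D (ρ : A.Sec) (f : TotalSpace (Fib m) E → ℝ) (w : TotalSpace (Fib m) E) : ℝ :=
  mvfderiv (IE n m) f w (ρ w).1.2

/-- The `E`-component of the section `ρ`, read in the trivialization of `E` around `x`. -/
def trivComp (ρ : A.Sec) (x : M) (w : TotalSpace (Fib m) E) : Fib m :=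
  (trivializationAt (Fib m) E x (⟨w.proj, (ρ w).1.1⟩ : TotalSpace (Fib m) E)).2

/-- The `E`-component of the bracket of `𝒯E`. In the frame `s_α` of constant sections of a
trivialization around `π(w)`, the bracket of `u₁^α s_α ∘ π` and `u₂^α s_α ∘ π` has the components
`σ¹(ρ₁)(u₂^γ) - σ¹(ρ₂)(u₁^γ) + u₁^α u₂^β L^γ_{αβ}`. -/
def bracketFst (ρ ν : A.Sec) (w : TotalSpace (Fib m) E) : E w.proj :=
  (trivializationAt (Fib m) E w.proj).symm w.proj
      (mvfderiv (IE n m) (trivComp ν w.proj) w (ρ w).1.2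
        - mvfderiv (IE n m) (trivComp ρ w.proj) w (ν w).1.2)
    + A.localBracket
      (fun x => (trivializationAt (Fib m) E w.proj).symm x (trivComp ρ w.proj w))
      (fun x => (trivializationAt (Fib m) E w.proj).symm x (trivComp ν w.proj w)) w.proj

/-- The `TE`-component of the bracket of `𝒯E`: the Lie bracket of the vector fields `σ¹(ρ)` and
`σ¹(ν)` on `E`. -/
def bracketSnd (ρ ν : A.Sec) (w : TotalSpace (Fib m) E) : TangentSpace (IE n m) w :=
  VectorField.mlieBracket (IE n m) (fun w' => (ρ w').1.2) (fun w' => (ν w').1.2) w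

open Classical in
/-- The Lie algebroid bracket `[ρ, ν]` of the prolongation `𝒯E`: the extension by the Leibniz rule
(for the anchor `σ¹`) of `[(s ∘ π, X), (t ∘ π, Y)] = ([s, t] ∘ π, [X, Y])`. (The pair of components
lies in `𝒯_w E` whenever `ρ` and `ν` are smooth around `w`.) -/
def br (ρ ν : A.Sec) : A.Sec := fun w =>
  if h : (bracketFst ρ ν w, bracketSnd ρ ν w) ∈ A.prolong w then ⟨_, h⟩ else 0

variable (A) in
/-- The vertical element `(0, a_w^v)` of `𝒯_w E`. -/
def vert (w : TotalSpace (Fib m) E) (a : E w.proj) : A.prolong w :=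
  ⟨(0, vlift n w a), by
    simp only [prolong, LinearMap.mem_eqLocus, LinearMap.comp_apply, LinearMap.fst_apply,
      LinearMap.snd_apply, map_zero]
    exact (mfderiv_proj_vlift w a).symm⟩

/-- The vertical endomorphism `J(u, v) = (0, u^v)`. -/
def J (ρ : A.Sec) : A.Sec := fun w => A.vert w (ρ w).1.1

variable (A) in
/-- The Euler section `C(w) = (0, w_w^v)`. -/
def euler : A.Sec := fun w => A.vert w w.2

/-- `S` is a semispray on `W`: `J S = C`. -/
def IsSemispray (S : A.Sec) (W : Set (TotalSpace (Fib m) E)) : Prop :=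
  ∀ w ∈ W, J S w = A.euler w

/-- The Cartan 1-section `θ_L = J(d^E L)`, i.e. `θ_L(ρ) = d^E L (J ρ)`. -/
def theta (L : TotalSpace (Fib m) E → ℝ) (ρ : A.Sec) : TotalSpace (Fib m) E → ℝ :=
  D (J ρ) L

/-- The Cartan 2-section `ω_L = d^E θ_L`. -/
def omega (L : TotalSpace (Fib m) E → ℝ) (ρ ν : A.Sec) (w : TotalSpace (Fib m) E) : ℝ :=
  D ρ (theta L ν) w - D ν (theta L ρ) w - theta L (br ρ ν) w

variable (A) in
/-- The energy `E_L = C(L) - L`. -/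
def energy (L : TotalSpace (Fib m) E → ℝ) (w : TotalSpace (Fib m) E) : ℝ :=
  D A.euler L w - L w

/-- `S` is a smooth solution on `W` of the symplectic equation `i_S ω_L = - d^E E_L`. -/
structure IsEulerLagrange (L : TotalSpace (Fib m) E → ℝ) (S : A.Sec)
    (W : Set (TotalSpace (Fib m) E)) : Prop where
  smooth : SmoothOn S W
  eq : ∀ ν : A.Sec, SmoothOn ν W → ∀ w ∈ W, omega L S ν w = -D ν (A.energy L) w

variable (A) in
/-- A nonlinear connection on `𝒯E` over `W ⊆ E`: a bundle endomorphism `N` of `𝒯E`, smooth over `W`,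
with `N² = Id` and `ker (Id + N) = V𝒯E`. (The values off `W` are irrelevant.) -/
structure NonlinearConnection (W : Set (TotalSpace (Fib m) E)) where
  toFun : ∀ w : TotalSpace (Fib m) E, A.prolong w →ₗ[ℝ] A.prolong w
  sq : ∀ w ∈ W, ∀ z, toFun w (toFun w z) = z
  ker : ∀ w ∈ W, ∀ z, z + toFun w z = 0 ↔ IsVertical z
  smooth : ∀ ρ : A.Sec, SmoothOn ρ W → SmoothOn (fun w => toFun w (ρ w)) W

namespace NonlinearConnection

variable {W : Set (TotalSpace (Fib m) E)}

/-- The horizontal projector `h = (Id + N) / 2`. -/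
def h (N : A.NonlinearConnection W) (ρ : A.Sec) : A.Sec :=
  fun w => (1 / 2 : ℝ) • (ρ w + N.toFun w (ρ w))

/-- The vertical projector `v = (Id - N) / 2`. -/
def v (N : A.NonlinearConnection W) (ρ : A.Sec) : A.Sec :=
  fun w => (1 / 2 : ℝ) • (ρ w - N.toFun w (ρ w))

/-- The dynamical covariant derivative `∇ρ = h[S, hρ] + v[S, vρ]` induced by `S` and `N`. -/
def nabla (N : A.NonlinearConnection W) (S ρ : A.Sec) : A.Sec :=
  N.h (br S (N.h ρ)) + N.v (br S (N.v ρ))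

end NonlinearConnection

/-- The metric `g = (∂²L/∂y^α∂y^β) 𝒱^α ⊗ 𝒱^β` on the vertical bundle `V𝒯E`. -/
def metric (L : TotalSpace (Fib m) E → ℝ) (ρ ν : A.Sec) (w : TotalSpace (Fib m) E) : ℝ :=
  fiberHess L w (fiberPart n w (ρ w).1.2) (fiberPart n w (ν w).1.2)

namespace NonlinearConnection

variable {W : Set (TotalSpace (Fib m) E)}

/-- `∇g = 0`: for vertical sections, `S(g(ρ, ν)) = g(∇ρ, ν) + g(ρ, ∇ν)`. -/
def IsMetric (N : A.NonlinearConnection W) (L : TotalSpace (Fib m) E → ℝ) (S : A.Sec) : Prop :=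
  ∀ ρ ν : A.Sec, SmoothOn ρ W → SmoothOn ν W →
    (∀ w ∈ W, IsVertical (ρ w)) → (∀ w ∈ W, IsVertical (ν w)) →
    ∀ w ∈ W, D S (metric L ρ ν) w = metric L (N.nabla S ρ) ν w + metric L ρ (N.nabla S ν) w

/-- Compatibility with the Cartan 2-section: `ω_L(hρ, hν) = 0`. -/
def IsSymplectic (N : A.NonlinearConnection W) (L : TotalSpace (Fib m) E → ℝ) : Prop :=
  ∀ ρ ν : A.Sec, SmoothOn ρ W → SmoothOn ν W → ∀ w ∈ W, omega L (N.h ρ) (N.h ν) w = 0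

/-- `N = - ℒ_S J`, i.e. `N(ρ) = -[S, Jρ] + J[S, ρ]`. -/
def IsInducedBy (N : A.NonlinearConnection W) (S : A.Sec) : Prop :=
  ∀ ρ : A.Sec, SmoothOn ρ W → ∀ w ∈ W,
    N.toFun w (ρ w) = -br S (J ρ) w + J (br S ρ) w

end NonlinearConnection

/-! ### Local expressions

`s` is a local frame of `E` over `U ⊆ M` and `y^α` are the fibre coordinates it defines. -/

section Local

variable {s : Fin m → ∀ x, E x} {U : Set M} (hs : IsLocalFrameOn (𝓡 n) (Fib m) ∞ s U)

/-- The fibre coordinate `y^α`. -/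
def fibCoord (α : Fin m) (w : TotalSpace (Fib m) E) : ℝ := hs.coeff α w.proj w.2

/-- The local section `x ↦ y^β(w) s_β(x)` through `w`, with constant fibre coordinates. -/
def constSec (w : TotalSpace (Fib m) E) (x : M) : TotalSpace (Fib m) E :=
  ⟨x, ∑ β, fibCoord hs β w • s β x⟩

/-- The structure functions `L^γ_{αβ}`: `[s_α, s_β] = L^γ_{αβ} s_γ`. -/
def structFun (A : LieAlgebroid n m E) (γ α β : Fin m) (x : M) : ℝ :=
  hs.coeff γ x (A.localBracket (s α) (s β) x)

/-- `σ_α^i ∂f/∂x^i`: the derivative of `f` in the direction `σ(s_α)` at constant `y`. -/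
def dX (A : LieAlgebroid n m E) (α : Fin m) (f : TotalSpace (Fib m) E → ℝ)
    (w : TotalSpace (Fib m) E) : ℝ :=
  mvfderiv (𝓡 n) (f ∘ constSec hs w) w.proj (A.anchor w.proj (s α w.proj))

variable (s) in
/-- `∂f/∂y^α`. -/
def dY (α : Fin m) (f : TotalSpace (Fib m) E → ℝ) (w : TotalSpace (Fib m) E) : ℝ :=
  deriv (fun t : ℝ => f ⟨w.proj, w.2 + t • s α w.proj⟩) 0

variable (s) in
/-- The matrix `g_{αβ} = ∂²L/∂y^α∂y^β`. -/
def gMat (L : TotalSpace (Fib m) E → ℝ) (w : TotalSpace (Fib m) E) :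
    Matrix (Fin m) (Fin m) ℝ :=
  Matrix.of fun α β => fiberHess L w (s α w.proj) (s β w.proj)

open Classical in
variable (A) in
/-- The local section `𝒳_α(w) = (s_α(π(w)), σ_α^i ∂/∂x^i|_w)` of `𝒯E` (over `π⁻¹(U)`, where the
pair does lie in `𝒯_w E`). -/
def frameX (α : Fin m) : A.Sec := fun w =>
  if h : ((s α w.proj, mfderiv (𝓡 n) (IE n m) (constSec hs w) w.proj
      (A.anchor w.proj (s α w.proj))) : E w.proj × TangentSpace (IE n m) w) ∈ A.prolong w
  then ⟨_, h⟩ else 0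

namespace NonlinearConnection

variable {W : Set (TotalSpace (Fib m) E)} (N : A.NonlinearConnection W)

/-- The local coefficient `N^α_β` (upper index first), given by
`h(𝒳_β) = 𝒳_β - N^α_β 𝒱_α`, that is `N^α_β = - dy^α(h(𝒳_β))`. -/
def coeff (α β : Fin m) (w : TotalSpace (Fib m) E) : ℝ :=
  -D (N.h (frameX A hs β)) (fibCoord hs α) w

/-- `N_{αβ} = g_{αγ} N^γ_β`. -/
def low (L : TotalSpace (Fib m) E → ℝ) (α β : Fin m) (w : TotalSpace (Fib m) E) : ℝ :=
  ∑ γ, gMat s L w α γ * N.coeff hs γ β w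

end NonlinearConnection

/-- `S(g_{αβ}) + (g_{γβ} L^γ_{αε} + g_{γα} L^γ_{βε}) y^ε`. -/
def symPart (L : TotalSpace (Fib m) E → ℝ) (S : A.Sec) (α β : Fin m)
    (w : TotalSpace (Fib m) E) : ℝ :=
  D S (fun w' => gMat s L w' α β) w
    + ∑ ε, ∑ γ, (gMat s L w γ β * structFun hs A γ α ε w.proj
        + gMat s L w γ α * structFun hs A γ β ε w.proj) * fibCoord hs ε w

/-- `σ_β^i ∂²L/∂x^i∂y^α - σ_α^i ∂²L/∂x^i∂y^β + L^γ_{αβ} ∂L/∂y^γ`. -/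
def skewPart (A : LieAlgebroid n m E) (L : TotalSpace (Fib m) E → ℝ) (α β : Fin m)
    (w : TotalSpace (Fib m) E) : ℝ :=
  dX hs A β (dY s α L) w - dX hs A α (dY s β L) w
    + ∑ γ, structFun hs A γ α β w.proj * dY s γ L w

end Local

end LieAlgebroid

end

/-!
In a local frame the equation `i_S ω_L = -dE_L` says that `S` is a semispray and satisfies the
Euler–Lagrange equations, whose coefficient matrix is the fibre Hessian `g`; regularity of `L` makes
them uniquely solvable. Differentiating them along the fibres expresses the coefficients of the
connection induced by `S`, lowered by `g`, as half the sum of a symmetric and a skew-symmetric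
matrix. For an arbitrary connection, evaluating `∇g` on the vertical frame shows that being metric
prescribes the symmetric part of the lowered coefficients `N_{αβ}`, and evaluating `ω_L` on the
horizontal frame that compatibility with `ω_L` prescribes the skew-symmetric part, with exactly
these two matrices. So the induced connection has both properties, and since `g` is invertible they
determine it.
-/

section Derivative

variable {𝔼 : Type*} [NormedAddCommGroup 𝔼] [NormedSpace ℝ 𝔼]
  {H : Type*} [TopologicalSpace H] {I : ModelWithCorners ℝ 𝔼 H}
  {N : Type*} [TopologicalSpace N] [ChartedSpace H N] {x : N}

lemma mvfderiv_congr_of_eventuallyEq {F : Type*} [NormedAddCommGroup F] [NormedSpace ℝ F]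
    {f g : N → F} (h : f =ᶠ[𝓝 x] g) (v : TangentSpace I x) :
    mvfderiv I f x v = mvfderiv I g x v :=
  congrArg (fun T : 𝔼 →L[ℝ] F => T v) (h.mfderiv_eq (I := I) (I' := 𝓘(ℝ, F)))

section Rules

variable {f g : N → ℝ}

lemma mvfderiv_mul_apply (hf : MDifferentiableAt I 𝓘(ℝ, ℝ) f x)
    (hg : MDifferentiableAt I 𝓘(ℝ, ℝ) g x) (v : TangentSpace I x) :
    mvfderiv I (fun y => f y * g y) x v = f x * mvfderiv I g x v + mvfderiv I f x v * g x :=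
  (congrArg (fun T => T v) (mvfderiv_mul hf hg)).trans (by simp [mul_comm])

lemma mvfderiv_add_apply (hf : MDifferentiableAt I 𝓘(ℝ, ℝ) f x)
    (hg : MDifferentiableAt I 𝓘(ℝ, ℝ) g x) (v : TangentSpace I x) :
    mvfderiv I (fun y => f y + g y) x v = mvfderiv I f x v + mvfderiv I g x v :=
  congrArg (fun T => T v) (mvfderiv_add hf hg)

lemma mvfderiv_sub_apply (hf : MDifferentiableAt I 𝓘(ℝ, ℝ) f x)
    (hg : MDifferentiableAt I 𝓘(ℝ, ℝ) g x) (v : TangentSpace I x) :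
    mvfderiv I (fun y => f y - g y) x v = mvfderiv I f x v - mvfderiv I g x v :=
  congrArg (fun T => T v) (mvfderiv_sub hf hg)

lemma mvfderiv_const_apply (c : ℝ) (v : TangentSpace I x) :
    mvfderiv I (fun _ : N => c) x v = 0 :=
  congrArg (fun T => T v) (mvfderiv_const c)

lemma mdifferentiableAt_finset_sum {ι : Type*} (t : Finset ι) {f : ι → N → ℝ}
    (hf : ∀ i, MDifferentiableAt I 𝓘(ℝ, ℝ) (f i) x) :
    MDifferentiableAt I 𝓘(ℝ, ℝ) (fun y => ∑ i ∈ t, f i y) x := by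
  classical
  induction t using Finset.induction_on with
  | empty => simpa only [Finset.sum_empty] using mdifferentiableAt_const
  | insert a t ha ih =>
    simp only [Finset.sum_insert ha]
    exact (hf a).add ih

lemma mvfderiv_finset_sum_apply {ι : Type*} (t : Finset ι) {f : ι → N → ℝ}
    (hf : ∀ i, MDifferentiableAt I 𝓘(ℝ, ℝ) (f i) x) (v : TangentSpace I x) :
    mvfderiv I (fun y => ∑ i ∈ t, f i y) x v = ∑ i ∈ t, mvfderiv I (f i) x v := by
  classical
  induction t using Finset.induction_on with
  | empty => simpa only [Finset.sum_empty] using mvfderiv_const_apply 0 v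
  | insert a t ha ih =>
    simp only [Finset.sum_insert ha]
    rw [mvfderiv_add_apply (hf a) (mdifferentiableAt_finset_sum t hf), ih]

lemma mvfderiv_clm_comp {F : Type*} [NormedAddCommGroup F] [NormedSpace ℝ F] (l : F →L[ℝ] ℝ)
    {G : N → F} (hG : MDifferentiableAt I 𝓘(ℝ, F) G x) (v : TangentSpace I x) :
    mvfderiv I (fun y => l (G y)) x v = l (mvfderiv I G x v) := by
  refine (mfderiv_comp_apply (I' := 𝓘(ℝ, F)) (I'' := 𝓘(ℝ, ℝ)) x
    l.differentiableAt.mdifferentiableAt hG v).trans ?_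
  rw [mfderiv_eq_fderiv, l.fderiv]
  rfl

end Rules

section Smooth

lemma eventually_mdifferentiableAt_of_contMDiffAt [IsManifold I ∞ N] {f : N → ℝ}
    (hf : ContMDiffAt I 𝓘(ℝ, ℝ) ∞ f x) : ∀ᶠ y in 𝓝 x, MDifferentiableAt I 𝓘(ℝ, ℝ) f y := by
  have : IsManifold I 1 N := IsManifold.of_le (n := ∞) (by simp)
  have hnear := (contMDiffAt_iff_contMDiffAt_nhds (n := 1) (by simp)).1 (hf.of_le (by simp))
  exact hnear.mono fun y hy => hy.mdifferentiableAt one_ne_zero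

lemma contMDiffAt_mvfderiv_comp_apply {𝔼' : Type*} [NormedAddCommGroup 𝔼'] [NormedSpace ℝ 𝔼']
    {H' : Type*} [TopologicalSpace H'] {I' : ModelWithCorners ℝ 𝔼' H'}
    {N' : Type*} [TopologicalSpace N'] [ChartedSpace H' N'] [IsManifold I ∞ N] [IsManifold I' ∞ N']
    {f : N' → ℝ} {p : N → N'} {Z : ∀ y : N, TangentSpace I' (p y)}
    (hf : ContMDiffAt I' 𝓘(ℝ, ℝ) ∞ f (p x))
    (hZ : ContMDiffAt I I'.tangent ∞ (fun y => (⟨p y, Z y⟩ : TangentBundle I' N')) x) :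
    ContMDiffAt I 𝓘(ℝ, ℝ) ∞ (fun y => mvfderiv I' f (p y) (Z y)) x := by
  have : IsManifold I' (∞ + 1) N' := by simpa
  have : IsManifold I' 1 N' := IsManifold.of_le (n := ∞) (by simp)
  have hp : ContMDiffAt I I' ∞ p x := (contMDiffAt_totalSpace.1 hZ).1
  have hdf := ContMDiffAt.mfderiv (x₀ := x) (fun _ : N => f) p
    (ContMDiffAt.comp (x, p x) hf contMDiffAt_snd) hp (m := ∞) (by simp)
  have hdfZ : ContMDiffAt I 𝓘(ℝ, ℝ).tangent ∞
      (fun y => (⟨f (p y), mfderiv I' 𝓘(ℝ, ℝ) f (p y) (Z y)⟩ : TangentBundle 𝓘(ℝ, ℝ) ℝ)) x :=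
    ContMDiffAt.clm_apply_of_inCoordinates (b₁ := p) (b₂ := f ∘ p) hdf hZ (hf.comp x hp)
  exact (contMDiff_snd_tangentBundle_modelSpace ℝ 𝓘(ℝ, ℝ)).contMDiffAt.comp x hdfZ

variable [IsManifold I ∞ N] {f : N → ℝ} {X Y Z : ∀ y : N, TangentSpace I y}

lemma contMDiffAt_mvfderiv_apply (hf : ContMDiffAt I 𝓘(ℝ, ℝ) ∞ f x)
    (hY : ContMDiffAt I I.tangent ∞ (fun y => (⟨y, Y y⟩ : TangentBundle I N)) x) :
    ContMDiffAt I 𝓘(ℝ, ℝ) ∞ (fun y => mvfderiv I f y (Y y)) x :=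
  contMDiffAt_mvfderiv_comp_apply (p := id) hf hY

open VectorField

lemma contMDiffAt_mlieBracket [CompleteSpace 𝔼]
    (hX : ContMDiffAt I I.tangent ∞ (fun y => (⟨y, X y⟩ : TangentBundle I N)) x)
    (hY : ContMDiffAt I I.tangent ∞ (fun y => (⟨y, Y y⟩ : TangentBundle I N)) x) :
    ContMDiffAt I I.tangent ∞ (fun y => (⟨y, mlieBracket I X Y y⟩ : TangentBundle I N)) x := by
  have : IsManifold I ((⊤ : ℕ∞) + 1) N := by simpa
  have : IsManifold I (minSmoothness ℝ 2) N := by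
    rw [minSmoothness_of_isRCLikeNormedField]
    exact IsManifold.of_le (n := ∞) (by norm_cast)
  exact ContMDiffAt.mlieBracket_vectorField (m := ⊤) (n := ⊤) hX hY (by simp)

lemma mlieBracket_mlieBracket_smul_right [CompleteSpace 𝔼]
    (hf : ContMDiffAt I 𝓘(ℝ, ℝ) ∞ f x)
    (hY : ContMDiffAt I I.tangent ∞ (fun y => (⟨y, Y y⟩ : TangentBundle I N)) x)
    (hZ : ContMDiffAt I I.tangent ∞ (fun y => (⟨y, Z y⟩ : TangentBundle I N)) x) :
    mlieBracket I X (mlieBracket I Y (f • Z)) x =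
      mvfderiv I (fun y => mvfderiv I f y (Y y)) x (X x) • Z x
        + mvfderiv I f x (Y x) • mlieBracket I X Z x
        + (mvfderiv I f x (X x) • mlieBracket I Y Z x
          + f x • mlieBracket I X (mlieBracket I Y Z) x) := by
  have : IsManifold I 2 N := IsManifold.of_le (n := ∞) (by norm_cast)
  have : IsManifold I 1 N := IsManifold.of_le (n := ∞) (by simp)
  have hYf := contMDiffAt_mvfderiv_apply hf hY
  have hYZ := contMDiffAt_mlieBracket hY hZ
  have hZ_near := (contMDiffAt_iff_contMDiffAt_nhds (n := 1) (by simp)).1 (hZ.of_le (by simp))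
  have inner : mlieBracket I Y (f • Z) =ᶠ[𝓝 x]
      (fun y => mvfderiv I f y (Y y)) • Z + f • mlieBracket I Y Z := by
    filter_upwards [eventually_mdifferentiableAt_of_contMDiffAt hf, hZ_near] with y hfy hZy
    exact mlieBracket_smul_right hfy (hZy.mdifferentiableAt one_ne_zero)
  rw [(EventuallyEq.refl _ X).mlieBracket_vectorField_eq inner, mlieBracket_add_right,
    mlieBracket_smul_right, mlieBracket_smul_right]
  · exact hf.mdifferentiableAt (by simp)
  · exact hYZ.mdifferentiableAt (by simp)
  · exact hYf.mdifferentiableAt (by simp)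
  · exact hZ.mdifferentiableAt (by simp)
  · exact (hYf.smul_section hZ).mdifferentiableAt (by simp)
  · exact (hf.smul_section hYZ).mdifferentiableAt (by simp)

-- Jacobi's identity for `X`, `Y` and `f • Z`: all terms but those in `Z x` cancel.
lemma mvfderiv_mlieBracket [CompleteSpace 𝔼]
    (hf : ContMDiffAt I 𝓘(ℝ, ℝ) ∞ f x)
    (hX : ContMDiffAt I I.tangent ∞ (fun y => (⟨y, X y⟩ : TangentBundle I N)) x)
    (hY : ContMDiffAt I I.tangent ∞ (fun y => (⟨y, Y y⟩ : TangentBundle I N)) x) :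
    mvfderiv I f x (mlieBracket I X Y x) =
      mvfderiv I (fun y => mvfderiv I f y (Y y)) x (X x)
        - mvfderiv I (fun y => mvfderiv I f y (X y)) x (Y x) := by
  have : IsManifold I 2 N := IsManifold.of_le (n := ∞) (by norm_cast)
  have : IsManifold I 1 N := IsManifold.of_le (n := ∞) (by simp)
  have : IsManifold I (minSmoothness ℝ 3) N := by
    rw [minSmoothness_of_isRCLikeNormedField]
    exact IsManifold.of_le (n := ∞) (by norm_cast)
  rcases subsingleton_or_nontrivial 𝔼 with h𝔼 | h𝔼
  · have hzero (g : N → ℝ) (v : TangentSpace I x) : mvfderiv I g x v = 0 :=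
      (congrArg (mvfderiv I g x) (h𝔼.elim v 0)).trans (map_zero _)
    simp only [hzero, sub_zero]
  obtain ⟨z, hz⟩ := exists_ne (0 : 𝔼)
  let Z : ∀ y : N, TangentSpace I y := FiberBundle.extend 𝔼 (x := x) z
  have hZ : ContMDiffAt I I.tangent ∞ (fun y => (⟨y, Z y⟩ : TangentBundle I N)) x :=
    FiberBundle.contMDiffAt_extend (V := TangentSpace I) I 𝔼 z
  have hZx : Z x ≠ 0 := by
    rw [show Z x = z from FiberBundle.extend_apply_self (E := TangentSpace I) 𝔼 z]
    exact hz
  have le_top : minSmoothness ℝ 2 ≤ ∞ := by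
    rw [minSmoothness_of_isRCLikeNormedField]
    norm_cast
  have jacobi_smul := leibniz_identity_mlieBracket_apply (hX.of_le le_top) (hY.of_le le_top)
    ((hf.smul_section hZ).of_le le_top)
  have jacobi := leibniz_identity_mlieBracket_apply (hX.of_le le_top) (hY.of_le le_top)
    (hZ.of_le le_top)
  rw [mlieBracket_mlieBracket_smul_right hf hY hZ, mlieBracket_mlieBracket_smul_right hf hX hZ,
    mlieBracket_smul_right (hf.mdifferentiableAt (by simp)) (hZ.mdifferentiableAt (by simp)),
    jacobi] at jacobi_smul
  refine (sub_eq_zero.1 <| (smul_eq_zero.1 ?_).resolve_right hZx)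
  linear_combination (norm := module) -jacobi_smul

end Smooth

lemma mvfderiv_clm_extChartAt [IsManifold I 1 N] (l : 𝔼 →L[ℝ] ℝ) (v : TangentSpace I x) :
    mvfderiv I (fun y => l (extChartAt I x y)) x v = l v :=
  (mvfderiv_clm_comp l ((contMDiffAt_extChartAt (n := 1)).mdifferentiableAt one_ne_zero) v).trans
    (congrArg (fun T : 𝔼 →L[ℝ] 𝔼 => l (T v)) mfderiv_extChartAt_self)

lemma tangent_ext_of_mvfderiv [IsManifold I 1 N] {v v' : TangentSpace I x}
    (h : ∀ l : 𝔼 →L[ℝ] ℝ, mvfderiv I (fun y => l (extChartAt I x y)) x v =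
      mvfderiv I (fun y => l (extChartAt I x y)) x v') :
    v = v' :=
  (SeparatingDual.eq_iff_forall_dual_eq (R := ℝ) (V := 𝔼)).2 fun l =>
    (mvfderiv_clm_extChartAt l v).symm.trans ((h l).trans (mvfderiv_clm_extChartAt l v'))

lemma trivializationAt_tangent_apply_snd [IsManifold I 1 N] {z : N}
    (hz : z ∈ (chartAt H x).source) (v : TangentSpace I z) :
    (trivializationAt 𝔼 (TangentSpace I) x ⟨z, v⟩).2 = mvfderiv I (extChartAt I x) z v :=
  (Trivialization.continuousLinearMapAt_apply_of_mem (R := ℝ)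
      (trivializationAt 𝔼 (TangentSpace I) x) (by simpa using hz) v).symm.trans
    (congrArg (fun T : 𝔼 →L[ℝ] 𝔼 => T v)
      (TangentBundle.continuousLinearMapAt_trivializationAt (I := I) hz))

lemma contMDiffAt_vectorField_of_mvfderiv [IsManifold I ∞ N] [FiniteDimensional ℝ 𝔼]
    {Y : ∀ y : N, TangentSpace I y}
    (h : ∀ l : 𝔼 →L[ℝ] ℝ, ContMDiffAt I 𝓘(ℝ, ℝ) ∞
      (fun z => mvfderiv I (fun y => l (extChartAt I x y)) z (Y z)) x) :
    ContMDiffAt I I.tangent ∞ (fun y => (⟨y, Y y⟩ : TangentBundle I N)) x := by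
  have : IsManifold I 1 N := IsManifold.of_le (n := ∞) (by simp)
  refine (Bundle.contMDiffAt_section x).2 ?_
  let b := Module.finBasis ℝ 𝔼
  have hsum : ContMDiffAt I 𝓘(ℝ, 𝔼) ∞ (fun z => ∑ i,
      mvfderiv I (fun y => (b.coord i).toContinuousLinearMap (extChartAt I x y)) z (Y z) • b i) x :=
    ContMDiffAt.sum fun i _ => (h _).smul contMDiffAt_const
  refine hsum.congr_of_eventuallyEq ?_
  filter_upwards [(chartAt H x).open_source.mem_nhds (mem_chart_source H x)] with z hz
  have hd : MDifferentiableAt I 𝓘(ℝ, 𝔼) (extChartAt I x) z :=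
    (contMDiffAt_extChartAt' (n := 1) hz).mdifferentiableAt one_ne_zero
  rw [trivializationAt_tangent_apply_snd hz]
  refine (b.sum_repr _).symm.trans (Finset.sum_congr rfl fun i _ => ?_)
  rw [mvfderiv_clm_comp _ hd]
  rfl

end Derivative

section Matrix

variable {ι : Type*} [Fintype ι] [DecidableEq ι]

lemma contDiff_matrix_det {V : Type*} [NormedAddCommGroup V] [NormedSpace ℝ V]
    {k : WithTop ℕ∞} {B : V → Matrix ι ι ℝ} (hB : ∀ i j, ContDiff ℝ k fun x => B x i j) :
    ContDiff ℝ k fun x => (B x).det := by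
  simp only [Matrix.det_apply]
  exact ContDiff.sum fun τ _ => ContDiff.const_smul _ (contDiff_prod fun i _ => hB _ _)

lemma contDiff_matrix_adjugate_apply (k : WithTop ℕ∞) (i j : ι) :
    ContDiff ℝ k fun C : ι → ι → ℝ => (Matrix.of C).adjugate i j := by
  simp only [Matrix.adjugate_apply]
  refine contDiff_matrix_det fun p q => ?_
  by_cases hp : p = j
  · subst hp
    simp only [Matrix.updateRow_self]
    fun_prop
  · simp only [Matrix.updateRow_ne hp, Matrix.of_apply]
    fun_prop

lemma contMDiffAt_matrix_inv_apply {𝔼 : Type*} [NormedAddCommGroup 𝔼] [NormedSpace ℝ 𝔼]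
    {H : Type*} [TopologicalSpace H] {I : ModelWithCorners ℝ 𝔼 H}
    {N : Type*} [TopologicalSpace N] [ChartedSpace H N] {x : N} {k : WithTop ℕ∞}
    {B : N → Matrix ι ι ℝ} (hB : ∀ i j, ContMDiffAt I 𝓘(ℝ, ℝ) k (fun y => B y i j) x)
    (hdet : (B x).det ≠ 0) (i j : ι) :
    ContMDiffAt I 𝓘(ℝ, ℝ) k (fun y => (B y)⁻¹ i j) x := by
  have hB' : ContMDiffAt I 𝓘(ℝ, ι → ι → ℝ) k (fun y i j => B y i j) x :=
    contMDiffAt_pi_space.2 fun i => contMDiffAt_pi_space.2 fun j => hB i j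
  have det_smooth : ContDiff ℝ k (fun C : ι → ι → ℝ => (Matrix.of C).det) :=
    contDiff_matrix_det fun i j => by
      simp only [Matrix.of_apply]
      fun_prop
  have inv_smooth : ContDiffAt ℝ k (fun C : ι → ι → ℝ => (Matrix.of C)⁻¹ i j) (B x) := by
    simp only [Matrix.inv_def, Ring.inverse_eq_inv', Matrix.smul_apply, smul_eq_mul]
    exact (det_smooth.contDiffAt.inv hdet).mul (contDiff_matrix_adjugate_apply k i j).contDiffAt
  exact ContMDiffAt.comp (I' := 𝓘(ℝ, ι → ι → ℝ)) (f := fun y i j => B y i j) x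
    inv_smooth.contMDiffAt hB'

end Matrix

section Germ

variable {𝔼 : Type*} [NormedAddCommGroup 𝔼] [NormedSpace ℝ 𝔼]
  {H : Type*} [TopologicalSpace H] {I : ModelWithCorners ℝ 𝔼 H}
  {N : Type*} [TopologicalSpace N] [ChartedSpace H N] {x : N}

variable (I) in
/-- The germ of the function `f` at `x` is the germ of a global smooth function. -/
def HasSmoothFunGerm (f : N → ℝ) (x : N) : Prop :=
  ∃ g : N → ℝ, ContMDiff I 𝓘(ℝ, ℝ) ∞ g ∧ g =ᶠ[𝓝 x] f

variable [IsManifold I ∞ N] [FiniteDimensional ℝ 𝔼] [T2Space N]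

lemma exists_contMDiff_tsupport_subset_eventuallyEq_one {U : Set N} (hU : U ∈ 𝓝 x) :
    ∃ χ : N → ℝ, ContMDiff I 𝓘(ℝ, ℝ) ∞ χ ∧ tsupport χ ⊆ U ∧ χ =ᶠ[𝓝 x] 1 := by
  obtain ⟨χ, -, hχ⟩ := (SmoothBumpFunction.nhds_basis_tsupport (I := I) x).mem_iff.1 hU
  exact ⟨χ, χ.contMDiff, hχ, χ.eventuallyEq_one⟩

lemma hasSmoothFunGerm_of_eventually_contMDiffAt {f : N → ℝ}
    (hf : ∀ᶠ y in 𝓝 x, ContMDiffAt I 𝓘(ℝ, ℝ) ∞ f y) : HasSmoothFunGerm I f x := by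
  obtain ⟨χ, hχ, hsupp, hone⟩ := exists_contMDiff_tsupport_subset_eventuallyEq_one (I := I) hf
  refine ⟨fun y => χ y * f y, contMDiff_of_tsupport fun y hy => ?_, ?_⟩
  · exact hχ.contMDiffAt.mul (hsupp (tsupport_mul_subset_left hy))
  · filter_upwards [hone] with y hy
    simp only [hy, Pi.one_apply, one_mul]

end Germ

lemma sum_sum_sum_mul {ι : Type*} [Fintype ι] (c : ι → ι → ℝ) (L : ι → ι → ι → ℝ) (f : ι → ℝ) :
    ∑ γ, (∑ α, ∑ β, c α β * L γ α β) * f γ = ∑ α, ∑ β, c α β * ∑ γ, L γ α β * f γ := by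
  simp only [Finset.mul_sum, Finset.sum_mul, mul_assoc]
  rw [Finset.sum_comm]
  exact Finset.sum_congr rfl fun α _ => Finset.sum_comm

noncomputable section

namespace LieAlgebroid

variable {n m : ℕ} {M : Type*} [TopologicalSpace M] [ChartedSpace (EuclideanSpace ℝ (Fin n)) M]
  {E : M → Type*} [TopologicalSpace (TotalSpace (Fib m) E)] [∀ x, TopologicalSpace (E x)]
  [FiberBundle (Fib m) E]

section Projection

variable {w : TotalSpace (Fib m) E}

lemma eventually_proj_nhds {p : M → Prop} (h : ∀ᶠ x in 𝓝 w.proj, p x) :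
    ∀ᶠ w' in 𝓝 w, p w'.proj :=
  (FiberBundle.continuous_proj (Fib m) E).continuousAt.eventually h

variable (n) in
/-- Smoothness at `w` of a real function on the total space. -/
abbrev SmoothFunAt (f : TotalSpace (Fib m) E → ℝ) (w : TotalSpace (Fib m) E) : Prop :=
  ContMDiffAt (IE n m) 𝓘(ℝ, ℝ) ∞ f w

variable (n) in
/-- Functions on `E` that are smooth in a neighbourhood of `w`, such as a Lagrangian near a point
of its domain. -/
abbrev SmoothFunNear (f : TotalSpace (Fib m) E → ℝ) (w : TotalSpace (Fib m) E) : Prop :=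
  ∀ᶠ w' in 𝓝 w, SmoothFunAt n f w'

lemma smoothFunNear_of_contMDiffOn {f : TotalSpace (Fib m) E → ℝ} {W : Set (TotalSpace (Fib m) E)}
    (hW : IsOpen W) (hf : ContMDiffOn (IE n m) 𝓘(ℝ, ℝ) ∞ f W) (hw : w ∈ W) :
    SmoothFunNear n f w :=
  (hW.eventually_mem hw).mono fun _ hw' => hf.contMDiffAt (hW.mem_nhds hw')

lemma mdifferentiableAt_proj (w : TotalSpace (Fib m) E) :
    MDifferentiableAt (IE n m) (𝓡 n) (TotalSpace.proj : TotalSpace (Fib m) E → M) w :=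
  (contMDiffAt_proj (n := ∞) E).mdifferentiableAt (by simp)

variable (n) in
/-- The differential of the projection `E → M`. -/
abbrev tangentProj (w : TotalSpace (Fib m) E) (v : TangentSpace (IE n m) w) :
    TangentSpace (𝓡 n) w.proj :=
  mfderiv (IE n m) (𝓡 n) (TotalSpace.proj : TotalSpace (Fib m) E → M) w v

lemma mvfderiv_comp_proj {f : M → ℝ} (hf : MDifferentiableAt (𝓡 n) 𝓘(ℝ, ℝ) f w.proj)
    (v : TangentSpace (IE n m) w) :
    mvfderiv (IE n m) (fun w => f w.proj) w v = mvfderiv (𝓡 n) f w.proj (tangentProj n w v) :=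
  mfderiv_comp_apply w hf (mdifferentiableAt_proj w) v

lemma smoothFunAt_comp_proj {f : M → ℝ} (hf : ContMDiffAt (𝓡 n) 𝓘(ℝ, ℝ) ∞ f w.proj) :
    SmoothFunAt n (fun w : TotalSpace (Fib m) E => f w.proj) w :=
  hf.comp w (contMDiffAt_proj E)

lemma extChartAt_totalSpace_eq (w : TotalSpace (Fib m) E) {w' : TotalSpace (Fib m) E}
    (hw' : w'.proj ∈ (trivializationAt (Fib m) E w.proj).baseSet) :
    extChartAt (IE n m) w w' =
      (extChartAt (𝓡 n) w.proj w'.proj, (trivializationAt (Fib m) E w.proj w').2) := by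
  rw [FiberBundle.extChartAt]
  simp only [PartialEquiv.trans_apply, PartialEquiv.prod_coe, PartialEquiv.refl_coe, id]
  exact Prod.ext (congrArg (extChartAt (𝓡 n) w.proj) (Trivialization.coe_fst' _ hw')) rfl

end Projection

variable [∀ x, AddCommGroup (E x)] [∀ x, Module ℝ (E x)]

section FrameCoefficients

variable {s : Fin m → ∀ x, E x} {U : Set M} (hs : IsLocalFrameOn (𝓡 n) (Fib m) ∞ s U) {x : M}

lemma frame_coeff_self (hx : x ∈ U) (α β : Fin m) :
    hs.coeff α x (s β x) = if α = β then 1 else 0 := by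
  rw [hs.coeff_apply_of_mem hx (s β) α, ← hs.toBasisAt_coe hx β, Module.Basis.repr_self,
    Finsupp.single_apply]
  simp only [eq_comm]

lemma frame_sum_coeff (hx : x ∈ U) (u : E x) : ∑ α, hs.coeff α x u • s α x = u := by
  simpa [IsLocalFrameOn.coeff, hx] using (hs.toBasisAt hx).sum_repr u

lemma frame_coeff_sum (hx : x ∈ U) (c : Fin m → ℝ) (α : Fin m) :
    hs.coeff α x (∑ β, c β • s β x) = c α := by
  simp [map_sum, frame_coeff_self hs hx]

lemma frame_ext (hx : x ∈ U) {u u' : E x} (h : ∀ α, hs.coeff α x u = hs.coeff α x u') :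
    u = u' := by
  rw [← frame_sum_coeff hs hx u, ← frame_sum_coeff hs hx u']
  simp only [h]

lemma constSec_self (hw : w.proj ∈ U) : constSec hs w w.proj = w := by
  unfold constSec fibCoord
  rw [frame_sum_coeff hs hw]

lemma fibCoord_constSec (w : TotalSpace (Fib m) E) {x : M} (hx : x ∈ U) (α : Fin m) :
    fibCoord hs α (constSec hs w x) = fibCoord hs α w :=
  frame_coeff_sum hs hx _ α

end FrameCoefficients

variable [VectorBundle ℝ (Fib m) E]

section SmoothGerm

variable (n m) in
/-- The germ of the section `s` at `x` is the germ of a global smooth section. -/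
def HasSmoothGerm (s : ∀ x, E x) (x : M) : Prop :=
  ∃ p : Cₛ^∞⟮𝓡 n; Fib m, E⟯, ∀ᶠ y in 𝓝 x, p y = s y

lemma contMDiffSection_sum_apply {ι : Type*} (t : Finset ι) (p : ι → Cₛ^∞⟮𝓡 n; Fib m, E⟯) (x : M) :
    (∑ i ∈ t, p i) x = ∑ i ∈ t, p i x :=
  map_sum (AddMonoidHom.mk' (fun q : Cₛ^∞⟮𝓡 n; Fib m, E⟯ => q x) fun _ _ => rfl) p t

variable [IsManifold (𝓡 n) ∞ M]

lemma hasSmoothGerm_of_eventually_contMDiffAt [T2Space M] {s : ∀ x, E x} {x : M}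
    (hs : ∀ᶠ y in 𝓝 x,
      ContMDiffAt (𝓡 n) (IE n m) ∞ (fun x => (⟨x, s x⟩ : TotalSpace (Fib m) E)) y) :
    HasSmoothGerm n m s x := by
  obtain ⟨V, hVs, hV, hxV⟩ := eventually_nhds_iff.1 hs
  obtain ⟨χ, hχ, hsupp, hone⟩ :=
    exists_contMDiff_tsupport_subset_eventuallyEq_one (I := 𝓡 n) (hV.mem_nhds hxV)
  refine ⟨⟨χ • s, ContMDiffOn.smul_section_of_tsupport hχ.contMDiffOn hV hsupp
    fun y hy => (hVs y hy).contMDiffWithinAt⟩, ?_⟩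
  filter_upwards [hone] with y hy
  change χ y • s y = s y
  rw [hy, Pi.one_apply, one_smul]

end SmoothGerm

section Bracket

variable [IsManifold (𝓡 n) ∞ M] (A : LieAlgebroid n m E) {s t u : ∀ x, E x} {x : M}

lemma bracket_add (p q r : Cₛ^∞⟮𝓡 n; Fib m, E⟯) :
    A.bracket p (q + r) = A.bracket p q + A.bracket p r := by
  rw [A.skew, A.add_bracket, A.skew q, A.skew r, neg_add, neg_neg, neg_neg]

lemma bracket_sum {ι : Type*} (t : Finset ι) (p : Cₛ^∞⟮𝓡 n; Fib m, E⟯)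
    (q : ι → Cₛ^∞⟮𝓡 n; Fib m, E⟯) :
    A.bracket p (∑ i ∈ t, q i) = ∑ i ∈ t, A.bracket p (q i) :=
  map_sum (AddMonoidHom.mk' (A.bracket p) (A.bracket_add p)) q t

variable [T2Space M]

-- Where `q` vanishes, `q = (1 - χ) q` for a bump function `χ`; apply the Leibniz rule.
lemma bracket_eq_zero_of_eventually_eq_zero (p q : Cₛ^∞⟮𝓡 n; Fib m, E⟯)
    (hq : ∀ᶠ y in 𝓝 x, q y = 0) : A.bracket p q x = 0 := by
  obtain ⟨χ, hχ, hsupp, hone⟩ := exists_contMDiff_tsupport_subset_eventuallyEq_one (I := 𝓡 n) hq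
  have hq_smul (y : M) : q y = (1 - χ y) • q y := by
    by_cases hy : y ∈ tsupport χ
    · rw [show q y = 0 from hsupp hy, smul_zero]
    · rw [image_eq_zero_of_notMem_tsupport hy, sub_zero, one_smul]
  rw [A.leibniz (fun y => 1 - χ y) (contMDiff_const.sub hχ) p q q hq_smul x, hone.eq_of_nhds,
    hq.self_of_nhds, Pi.one_apply, sub_self, zero_smul, smul_zero, add_zero]

lemma bracket_congr_right (p : Cₛ^∞⟮𝓡 n; Fib m, E⟯) {q q' : Cₛ^∞⟮𝓡 n; Fib m, E⟯}
    (h : ∀ᶠ y in 𝓝 x, q y = q' y) : A.bracket p q x = A.bracket p q' x := by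
  have hsub : A.bracket p (q - q') x = 0 :=
    A.bracket_eq_zero_of_eventually_eq_zero p _ (h.mono fun y hy => sub_eq_zero.2 hy)
  have hadd := congrArg (fun r => r x) (A.bracket_add p (q - q') q')
  rw [sub_add_cancel] at hadd
  refine hadd.trans ?_
  change A.bracket p (q - q') x + A.bracket p q' x = _
  rw [hsub, zero_add]

lemma bracket_congr {p p' q q' : Cₛ^∞⟮𝓡 n; Fib m, E⟯}
    (hp : ∀ᶠ y in 𝓝 x, p y = p' y) (hq : ∀ᶠ y in 𝓝 x, q y = q' y) :
    A.bracket p q x = A.bracket p' q' x := by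
  rw [A.bracket_congr_right p hq, A.skew p, A.skew p']
  exact congrArg Neg.neg (A.bracket_congr_right q' hp)

lemma localBracket_eq_bracket {p q : Cₛ^∞⟮𝓡 n; Fib m, E⟯}
    (hp : ∀ᶠ y in 𝓝 x, p y = s y) (hq : ∀ᶠ y in 𝓝 x, q y = t y) :
    A.localBracket s t x = A.bracket p q x := by
  have h : ∃ p : Cₛ^∞⟮𝓡 n; Fib m, E⟯ × Cₛ^∞⟮𝓡 n; Fib m, E⟯,
      (∀ᶠ y in 𝓝 x, p.1 y = s y) ∧ (∀ᶠ y in 𝓝 x, p.2 y = t y) := ⟨(p, q), hp, hq⟩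
  rw [localBracket, dif_pos h]
  refine A.bracket_congr ?_ ?_
  · filter_upwards [h.choose_spec.1, hp] with y h₁ h₂ using h₁.trans h₂.symm
  · filter_upwards [h.choose_spec.2, hq] with y h₁ h₂ using h₁.trans h₂.symm

lemma localBracket_skew (hs : HasSmoothGerm n m s x) (ht : HasSmoothGerm n m t x) :
    A.localBracket s t x = -A.localBracket t s x := by
  obtain ⟨p, hp⟩ := hs
  obtain ⟨q, hq⟩ := ht
  rw [A.localBracket_eq_bracket hp hq, A.localBracket_eq_bracket hq hp, A.skew]
  rfl

lemma localBracket_sum_smul_right {ι : Type*} [Fintype ι] {t : ι → ∀ x, E x} {c : ι → M → ℝ}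
    (hs : HasSmoothGerm n m s x) (ht : ∀ i, HasSmoothGerm n m (t i) x)
    (hc : ∀ i, HasSmoothFunGerm (𝓡 n) (c i) x) (hu : ∀ᶠ y in 𝓝 x, u y = ∑ i, c i y • t i y) :
    A.localBracket s u x = ∑ i, (c i x • A.localBracket s (t i) x
      + mvfderiv (𝓡 n) (c i) x (A.anchor x (s x)) • t i x) := by
  obtain ⟨p, hp⟩ := hs
  choose q hq using ht
  choose g hg hgc using hc
  let r : ι → Cₛ^∞⟮𝓡 n; Fib m, E⟯ := fun i => ⟨g i • q i, (hg i).smul_section (q i).contMDiff⟩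
  have hr (i : ι) (y : M) : r i y = g i y • q i y := rfl
  have hsum : ∀ᶠ y in 𝓝 x, (∑ i, r i) y = u y := by
    filter_upwards [hu, eventually_all.2 hq, eventually_all.2 hgc] with y hy hqy hgy
    rw [hy, contMDiffSection_sum_apply]
    exact Finset.sum_congr rfl fun i _ => by rw [hr, hqy, hgy]
  rw [A.localBracket_eq_bracket hp hsum, A.bracket_sum, contMDiffSection_sum_apply]
  refine Finset.sum_congr rfl fun i _ => ?_
  rw [A.leibniz (g i) (hg i) p (q i) (r i) (hr i) x, A.localBracket_eq_bracket hp (hq i),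
    (hgc i).eq_of_nhds, (hq i).self_of_nhds, hp.self_of_nhds,
    mvfderiv_congr_of_eventuallyEq (hgc i)]

lemma localBracket_sum_smul_left {ι : Type*} [Fintype ι] {t : ι → ∀ x, E x} {c : ι → M → ℝ}
    (hs : HasSmoothGerm n m s x) (ht : ∀ i, HasSmoothGerm n m (t i) x)
    (hc : ∀ i, HasSmoothFunGerm (𝓡 n) (c i) x) (hu_germ : HasSmoothGerm n m u x)
    (hu : ∀ᶠ y in 𝓝 x, u y = ∑ i, c i y • t i y) :
    A.localBracket u s x = ∑ i, (c i x • A.localBracket (t i) s x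
      - mvfderiv (𝓡 n) (c i) x (A.anchor x (s x)) • t i x) := by
  rw [A.localBracket_skew hu_germ hs, A.localBracket_sum_smul_right hs ht hc hu,
    ← Finset.sum_neg_distrib]
  refine Finset.sum_congr rfl fun i _ => ?_
  rw [A.localBracket_skew (ht i) hs, smul_neg, neg_add, sub_eq_add_neg]

lemma anchor_localBracket (hs : HasSmoothGerm n m s x) (ht : HasSmoothGerm n m t x) :
    A.anchor x (A.localBracket s t x) =
      VectorField.mlieBracket (𝓡 n) (fun y => A.anchor y (s y)) (fun y => A.anchor y (t y)) x := by
  obtain ⟨p, hp⟩ := hs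
  obtain ⟨q, hq⟩ := ht
  rw [A.localBracket_eq_bracket hp hq, A.anchor_bracket]
  exact EventuallyEq.mlieBracket_vectorField_eq (hp.mono fun y hy => congrArg (A.anchor y) hy)
    (hq.mono fun y hy => congrArg (A.anchor y) hy)

lemma contMDiffAt_localBracket (hs : HasSmoothGerm n m s x) (ht : HasSmoothGerm n m t x) :
    ContMDiffAt (𝓡 n) (IE n m) ∞
      (fun x => (⟨x, A.localBracket s t x⟩ : TotalSpace (Fib m) E)) x := by
  obtain ⟨p, hp⟩ := hs
  obtain ⟨q, hq⟩ := ht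
  refine (A.bracket p q).contMDiff.contMDiffAt.congr_of_eventuallyEq ?_
  filter_upwards [hp.eventually_nhds, hq.eventually_nhds] with y hpy hqy
  rw [A.localBracket_eq_bracket hpy hqy]

end Bracket

section Frames

variable {s : Fin m → ∀ x, E x} {U : Set M} (hs : IsLocalFrameOn (𝓡 n) (Fib m) ∞ s U)

section Pointwise

variable {x : M}

variable (e : Trivialization (Fib m) (TotalSpace.proj : TotalSpace (Fib m) E → M))
  [MemTrivializationAtlas e]

lemma trivialization_sum_smul (hx : x ∈ e.baseSet) {ι : Type*} [Fintype ι] (c : ι → ℝ)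
    (t : ι → E x) :
    (e (⟨x, ∑ i, c i • t i⟩ : TotalSpace (Fib m) E)).2 =
      ∑ i, c i • (e (⟨x, t i⟩ : TotalSpace (Fib m) E)).2 := by
  simp only [← e.continuousLinearMapAt_apply_of_mem (R := ℝ) hx, map_sum, map_smul]

variable (s x) in
/-- The matrix of the frame `s` at `x` in the trivialization `e`. Inverting it is how smoothness of
the coefficients with respect to `s` is obtained. -/
def frameMatrix : Matrix (Fin m) (Fin m) ℝ :=
  Matrix.of fun a α => (e (⟨x, s α x⟩ : TotalSpace (Fib m) E)).2 a

lemma frameMatrix_mulVec (hx : x ∈ e.baseSet) (c : Fin m → ℝ) :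
    (frameMatrix s x e).mulVec c =
      (e (⟨x, ∑ α, c α • s α x⟩ : TotalSpace (Fib m) E)).2 := by
  ext a
  simp [trivialization_sum_smul e hx, frameMatrix, Matrix.mulVec, dotProduct, mul_comm]

include hs in
lemma frameMatrix_det_ne_zero (hx : x ∈ e.baseSet) (hxU : x ∈ U) :
    (frameMatrix s x e).det ≠ 0 := by
  intro hdet
  obtain ⟨c, hc, hc_ker⟩ := Matrix.exists_mulVec_eq_zero_iff.2 hdet
  refine hc (funext fun α => ?_)
  have hsum : ∑ α, c α • s α x = 0 := by
    rw [frameMatrix_mulVec e hx] at hc_ker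
    refine (e.continuousLinearEquivAt ℝ x hx).map_eq_zero_iff.1 (PiLp.ext fun a => ?_)
    exact congrFun hc_ker a
  rw [← frame_coeff_sum hs hxU c α, hsum, map_zero, Pi.zero_apply]

lemma frameMatrix_inv_mulVec (hx : x ∈ e.baseSet) (hxU : x ∈ U) (u : E x) :
    (frameMatrix s x e)⁻¹.mulVec (e (⟨x, u⟩ : TotalSpace (Fib m) E)).2 =
      fun α => hs.coeff α x u := by
  have hdet : IsUnit (frameMatrix s x e).det :=
    isUnit_iff_ne_zero.2 (frameMatrix_det_ne_zero hs e hx hxU)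
  conv_lhs => rw [← frame_sum_coeff hs hxU u, ← frameMatrix_mulVec e hx]
  rw [Matrix.mulVec_mulVec, Matrix.nonsing_inv_mul _ hdet, Matrix.one_mulVec]

variable [ContMDiffVectorBundle ∞ (Fib m) E (𝓡 n)]

include hs in
lemma contMDiffAt_trivialization_frame (hx : x ∈ e.baseSet) (hU : U ∈ 𝓝 x) (α : Fin m) :
    ContMDiffAt (𝓡 n) 𝓘(ℝ, Fib m) ∞ (fun x => (e (⟨x, s α x⟩ : TotalSpace (Fib m) E)).2) x :=
  (e.contMDiffAt_section_iff hx).1 ((hs.contMDiffOn α).contMDiffAt hU)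

end Pointwise

section Maps

variable [ContMDiffVectorBundle ∞ (Fib m) E (𝓡 n)]
  {𝔼 : Type*} [NormedAddCommGroup 𝔼] [NormedSpace ℝ 𝔼]
  {H : Type*} [TopologicalSpace H] {I : ModelWithCorners ℝ 𝔼 H}
  {N : Type*} [TopologicalSpace N] [ChartedSpace H N] {f : N → TotalSpace (Fib m) E} {y : N}

lemma contMDiffAt_frame_coeff (hf : ContMDiffAt I (IE n m) ∞ f y) (hU : U ∈ 𝓝 (f y).proj)
    (α : Fin m) : ContMDiffAt I 𝓘(ℝ, ℝ) ∞ (fun z => hs.coeff α (f z).proj (f z).2) y := by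
  let e := trivializationAt (Fib m) E (f y).proj
  have hye : (f y).proj ∈ e.baseSet := FiberBundle.mem_baseSet_trivializationAt' _
  obtain ⟨hproj, hfib⟩ := contMDiffAt_totalSpace.1 hf
  have hcoord (a : Fin m) : ContMDiffAt 𝓘(ℝ, Fib m) 𝓘(ℝ, ℝ) ∞ (fun u : Fib m => u a) (e (f y)).2 :=
    (EuclideanSpace.proj (𝕜 := ℝ) a).contDiff.contMDiff.contMDiffAt
  have hmatrix (a β) : ContMDiffAt I 𝓘(ℝ, ℝ) ∞ (fun z => frameMatrix s (f z).proj e a β) y :=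
    ((EuclideanSpace.proj (𝕜 := ℝ) a).contDiff.contMDiff.contMDiffAt.comp (f y).proj
      (contMDiffAt_trivialization_frame hs e hye hU β)).comp y hproj
  have hdet := frameMatrix_det_ne_zero hs e hye (mem_of_mem_nhds hU)
  refine (ContMDiffAt.sum (t := .univ) fun a _ =>
    (contMDiffAt_matrix_inv_apply hmatrix hdet α a).mul
      ((hcoord a).comp y hfib)).congr_of_eventuallyEq ?_
  filter_upwards [hproj.continuousAt.eventually
    (inter_mem hU (e.open_baseSet.mem_nhds hye))] with z hz
  exact (congrFun (frameMatrix_inv_mulVec hs e hz.2 hz.1 (f z).2) α).symm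

lemma contMDiffAt_of_frame_coeff (hproj : ContMDiffAt I (𝓡 n) ∞ (fun z => (f z).proj) y)
    (hU : U ∈ 𝓝 (f y).proj)
    (hf : ∀ α, ContMDiffAt I 𝓘(ℝ, ℝ) ∞ (fun z => hs.coeff α (f z).proj (f z).2) y) :
    ContMDiffAt I (IE n m) ∞ f y := by
  let e := trivializationAt (Fib m) E (f y).proj
  have hye : (f y).proj ∈ e.baseSet := FiberBundle.mem_baseSet_trivializationAt' _
  refine contMDiffAt_totalSpace.2 ⟨hproj, ?_⟩
  refine (ContMDiffAt.sum (t := .univ) fun α _ => (hf α).smul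
    ((contMDiffAt_trivialization_frame hs e hye hU α).comp y hproj)).congr_of_eventuallyEq ?_
  filter_upwards [hproj.continuousAt.eventually
    (inter_mem hU (e.open_baseSet.mem_nhds hye))] with z hz
  change (e (f z)).2 = ∑ α, hs.coeff α (f z).proj (f z).2 • (e ⟨(f z).proj, s α (f z).proj⟩).2
  rw [← trivialization_sum_smul e hz.2, frame_sum_coeff hs hz.1]

end Maps

end Frames

section TrivializationFrame

variable {s : Fin m → ∀ x, E x} {U : Set M} (hs : IsLocalFrameOn (𝓡 n) (Fib m) ∞ s U)
  (e : Trivialization (Fib m) (TotalSpace.proj : TotalSpace (Fib m) E → M))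
  [MemTrivializationAtlas e] {x : M}

/-- The coefficients, in the frame `s`, of the constant sections of the trivialization `e`: the
transition matrix between the two frames. -/
def transition (α a : Fin m) (x : M) : ℝ :=
  hs.coeff α x (e.symm x (EuclideanSpace.single a 1))

lemma coeff_triv_symm_eq_sum (hx : x ∈ e.baseSet) (c : Fib m) (α : Fin m) :
    hs.coeff α x (e.symm x c) = ∑ a, c a * transition hs e α a x := by
  have hc : c = ∑ a, c a • EuclideanSpace.single a (1 : ℝ) := by
    ext b
    simp [Pi.single_apply]
  have hsymm (c : Fib m) : e.symm x c = e.symmₗ ℝ x c := (e.symmₗ_apply (R := ℝ) hx c).symm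
  conv_lhs => rw [hc, hsymm, map_sum, map_sum]
  refine Finset.sum_congr rfl fun a _ => ?_
  rw [map_smul, map_smul, smul_eq_mul, ← hsymm, transition]

variable [ContMDiffVectorBundle ∞ (Fib m) E (𝓡 n)]

lemma eventually_contMDiffAt_triv_symm (hx : x ∈ e.baseSet) (c : Fib m) :
    ∀ᶠ y in 𝓝 x, ContMDiffAt (𝓡 n) (IE n m) ∞
      (fun x => (⟨x, e.symm x c⟩ : TotalSpace (Fib m) E)) y := by
  have hsmooth : ContMDiffOn (𝓡 n) (IE n m) ∞
      (fun x => (⟨x, e.symm x c⟩ : TotalSpace (Fib m) E)) e.baseSet := by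
    refine (e.contMDiffOn_section_iff e.open_baseSet subset_rfl).2 ?_
    exact (contMDiffOn_const (c := c)).congr fun y hy => by rw [e.apply_mk_symm hy]
  exact (e.open_baseSet.eventually_mem hx).mono fun y hy =>
    hsmooth.contMDiffAt (e.open_baseSet.mem_nhds hy)

lemma eventually_contMDiffAt_coeff_triv_symm (hU : U ∈ 𝓝 x) (hx : x ∈ e.baseSet) (c : Fib m)
    (α : Fin m) : ∀ᶠ y in 𝓝 x,
      ContMDiffAt (𝓡 n) 𝓘(ℝ, ℝ) ∞ (fun x => hs.coeff α x (e.symm x c)) y := by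
  filter_upwards [eventually_contMDiffAt_triv_symm (n := n) e hx c, eventually_mem_nhds_iff.2 hU]
    with y hy hyU using contMDiffAt_frame_coeff hs hy hyU α

lemma mdifferentiableAt_transition (hU : U ∈ 𝓝 x) (hx : x ∈ e.baseSet) (α a : Fin m) :
    MDifferentiableAt (𝓡 n) 𝓘(ℝ, ℝ) (transition hs e α a) x :=
  (eventually_contMDiffAt_coeff_triv_symm hs e hU hx _ α).self_of_nhds.mdifferentiableAt (by simp)

lemma mvfderiv_coeff_triv_symm (hU : U ∈ 𝓝 x) (hx : x ∈ e.baseSet) (c : Fib m) (α : Fin m)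
    (v : TangentSpace (𝓡 n) x) :
    mvfderiv (𝓡 n) (fun x => hs.coeff α x (e.symm x c)) x v =
      ∑ a, c a * mvfderiv (𝓡 n) (transition hs e α a) x v := by
  have hsum : (fun x => hs.coeff α x (e.symm x c)) =ᶠ[𝓝 x]
      fun x => ∑ a, c a * transition hs e α a x :=
    (e.open_baseSet.eventually_mem hx).mono fun y hy => coeff_triv_symm_eq_sum hs e hy c α
  have hdiff (a : Fin m) := mdifferentiableAt_transition hs e hU hx α a
  rw [mvfderiv_congr_of_eventuallyEq hsum,
    mvfderiv_finset_sum_apply (f := fun a x => c a * transition hs e α a x) _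
      fun a => mdifferentiableAt_const.mul (hdiff a)]
  refine Finset.sum_congr rfl fun a _ => ?_
  rw [mvfderiv_mul_apply mdifferentiableAt_const (hdiff a), mvfderiv_const_apply, zero_mul,
    add_zero]

lemma mvfderiv_frame_coeff_eq_sum {w : TotalSpace (Fib m) E}
    {r : ∀ w' : TotalSpace (Fib m) E, E w'.proj} (hU : U ∈ 𝓝 w.proj) (hw : w.proj ∈ e.baseSet)
    (hr : MDifferentiableAt (IE n m) 𝓘(ℝ, Fib m)
      (fun w' => (e (⟨w'.proj, r w'⟩ : TotalSpace (Fib m) E)).2) w)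
    (v : TangentSpace (IE n m) w) (α : Fin m) :
    mvfderiv (IE n m) (fun w' => hs.coeff α w'.proj (r w')) w v =
      ∑ a, ((e (⟨w.proj, r w⟩ : TotalSpace (Fib m) E)).2 a *
          mvfderiv (𝓡 n) (transition hs e α a) w.proj (tangentProj n w v)
        + mvfderiv (IE n m) (fun w' => (e (⟨w'.proj, r w'⟩ : TotalSpace (Fib m) E)).2) w v a *
          transition hs e α a w.proj) := by
  set G : TotalSpace (Fib m) E → Fib m :=
    fun w' => (e (⟨w'.proj, r w'⟩ : TotalSpace (Fib m) E)).2
  have hG (a : Fin m) : MDifferentiableAt (IE n m) 𝓘(ℝ, ℝ) (fun w' => G w' a) w :=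
    (EuclideanSpace.proj (𝕜 := ℝ) a).differentiableAt.mdifferentiableAt.comp w hr
  have hκ (a : Fin m) := mdifferentiableAt_transition hs e hU hw α a
  have hκ_proj (a : Fin m) : MDifferentiableAt (IE n m) 𝓘(ℝ, ℝ)
      (fun w' : TotalSpace (Fib m) E => transition hs e α a w'.proj) w :=
    MDifferentiableAt.comp w (hκ a) (mdifferentiableAt_proj w)
  have hsum : (fun w' => hs.coeff α w'.proj (r w')) =ᶠ[𝓝 w]
      fun w' => ∑ a, G w' a * transition hs e α a w'.proj := by
    filter_upwards [eventually_proj_nhds (e.open_baseSet.eventually_mem hw)] with w' hw'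
    rw [← coeff_triv_symm_eq_sum hs e hw' (G w') α, e.symm_apply_apply_mk hw']
  rw [mvfderiv_congr_of_eventuallyEq hsum,
    mvfderiv_finset_sum_apply (f := fun a w' => G w' a * transition hs e α a w'.proj) _
      fun a => (hG a).mul (hκ_proj a)]
  refine Finset.sum_congr rfl fun a _ => ?_
  have hGv : mvfderiv (IE n m) (fun w' => G w' a) w v = mvfderiv (IE n m) G w v a :=
    mvfderiv_clm_comp (EuclideanSpace.proj (𝕜 := ℝ) a) hr v
  rw [mvfderiv_mul_apply (hG a) (hκ_proj a), mvfderiv_comp_proj (hκ a), hGv]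

end TrivializationFrame

section FrameDerivative

variable [ContMDiffVectorBundle ∞ (Fib m) E (𝓡 n)]
  {s : Fin m → ∀ x, E x} {U : Set M} (hs : IsLocalFrameOn (𝓡 n) (Fib m) ∞ s U)

lemma coeff_symm_mvfderiv_triv {w : TotalSpace (Fib m) E}
    {r : ∀ w' : TotalSpace (Fib m) E, E w'.proj} (hU : U ∈ 𝓝 w.proj)
    (hr : ContMDiffAt (IE n m) (IE n m) ∞
      (fun w' => (⟨w'.proj, r w'⟩ : TotalSpace (Fib m) E)) w)
    (v : TangentSpace (IE n m) w) (α : Fin m) :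
    hs.coeff α w.proj ((trivializationAt (Fib m) E w.proj).symm w.proj (mvfderiv (IE n m)
      (fun w' => (trivializationAt (Fib m) E w.proj
        (⟨w'.proj, r w'⟩ : TotalSpace (Fib m) E)).2) w v)) =
      mvfderiv (IE n m) (fun w' => hs.coeff α w'.proj (r w')) w v -
        mvfderiv (𝓡 n) (fun x => hs.coeff α x ((trivializationAt (Fib m) E w.proj).symm x
          (trivializationAt (Fib m) E w.proj (⟨w.proj, r w⟩ : TotalSpace (Fib m) E)).2))
          w.proj (tangentProj n w v) := by
  have hw : w.proj ∈ (trivializationAt (Fib m) E w.proj).baseSet :=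
    FiberBundle.mem_baseSet_trivializationAt' _
  rw [coeff_triv_symm_eq_sum hs _ hw, mvfderiv_coeff_triv_symm hs _ hU hw,
    mvfderiv_frame_coeff_eq_sum hs _ hU hw
      ((contMDiffAt_totalSpace.1 hr).2.mdifferentiableAt (by simp)),
    Finset.sum_add_distrib, add_sub_cancel_left]

lemma exists_frame (x : M) : ∃ (s : Fin m → ∀ x, E x) (U : Set M), U ∈ 𝓝 x ∧
    IsLocalFrameOn (𝓡 n) (Fib m) ∞ s U :=
  let e := trivializationAt (Fib m) E x
  ⟨_, _, e.open_baseSet.mem_nhds (FiberBundle.mem_baseSet_trivializationAt' x),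
    e.isLocalFrameOn_localFrame_baseSet (𝓡 n) ∞ (EuclideanSpace.basisFun (Fin m) ℝ).toBasis⟩

end FrameDerivative

section TotalSpace

variable {s : Fin m → ∀ x, E x} {U : Set M} (hs : IsLocalFrameOn (𝓡 n) (Fib m) ∞ s U)
  {w : TotalSpace (Fib m) E}

variable [ContMDiffVectorBundle ∞ (Fib m) E (𝓡 n)]

lemma smoothFunAt_fibCoord (hU : U ∈ 𝓝 w.proj) (α : Fin m) :
    SmoothFunAt n (fibCoord hs α) w :=
  contMDiffAt_frame_coeff hs (f := id) contMDiffAt_id hU α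

lemma mdifferentiableAt_fibCoord (hU : U ∈ 𝓝 w.proj) (α : Fin m) :
    MDifferentiableAt (IE n m) 𝓘(ℝ, ℝ) (fibCoord hs α) w :=
  (smoothFunAt_fibCoord hs hU α).mdifferentiableAt (by simp)

-- The charts of the total space come from trivializations, so they are affine along the fibres.
lemma exists_affine_coordinate (hU : U ∈ 𝓝 w.proj)
    (l : (EuclideanSpace ℝ (Fin n) × Fib m) →L[ℝ] ℝ) :
    ∃ (f₀ : M → ℝ) (f : Fin m → M → ℝ), ContMDiffAt (𝓡 n) 𝓘(ℝ, ℝ) ∞ f₀ w.proj ∧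
      (∀ α, ContMDiffAt (𝓡 n) 𝓘(ℝ, ℝ) ∞ (f α) w.proj) ∧
      ∀ᶠ w' in 𝓝 w, l (extChartAt (IE n m) w w') =
        f₀ w'.proj + ∑ α, fibCoord hs α w' * f α w'.proj := by
  let e := trivializationAt (Fib m) E w.proj
  have he : w.proj ∈ e.baseSet := FiberBundle.mem_baseSet_trivializationAt' _
  let l₁ : EuclideanSpace ℝ (Fin n) →L[ℝ] ℝ := l.comp (ContinuousLinearMap.inl ℝ _ _)
  let l₂ : Fib m →L[ℝ] ℝ := l.comp (ContinuousLinearMap.inr ℝ _ _)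
  have hl (p q) : l (p, q) = l₁ p + l₂ q := by simp [l₁, l₂, ← map_add]
  refine ⟨fun x => l₁ (extChartAt (𝓡 n) w.proj x),
    fun α x => l₂ (e (⟨x, s α x⟩ : TotalSpace (Fib m) E)).2,
    l₁.contDiff.contMDiff.contMDiffAt.comp _ contMDiffAt_extChartAt,
    fun α => l₂.contDiff.contMDiff.contMDiffAt.comp _
      (contMDiffAt_trivialization_frame hs e he hU α), ?_⟩
  filter_upwards [eventually_proj_nhds (inter_mem hU (e.open_baseSet.mem_nhds he))] with w' hw'
  have hfib : (e w').2 =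
      ∑ α, fibCoord hs α w' • (e (⟨w'.proj, s α w'.proj⟩ : TotalSpace (Fib m) E)).2 := by
    rw [← trivialization_sum_smul e hw'.2]
    simp only [fibCoord, frame_sum_coeff hs hw'.1]
  rw [extChartAt_totalSpace_eq w hw'.2, hl, hfib, map_sum]
  simp only [map_smul, smul_eq_mul]

section Affine

variable {f₀ : M → ℝ} {f : Fin m → M → ℝ}

lemma mvfderiv_affine (hU : U ∈ 𝓝 w.proj) (h₀ : MDifferentiableAt (𝓡 n) 𝓘(ℝ, ℝ) f₀ w.proj)
    (hf : ∀ α, MDifferentiableAt (𝓡 n) 𝓘(ℝ, ℝ) (f α) w.proj) (v : TangentSpace (IE n m) w) :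
    mvfderiv (IE n m) (fun w => f₀ w.proj + ∑ α, fibCoord hs α w * f α w.proj) w v =
      mvfderiv (𝓡 n) f₀ w.proj (tangentProj n w v) +
        ∑ α, (fibCoord hs α w * mvfderiv (𝓡 n) (f α) w.proj (tangentProj n w v)
          + mvfderiv (IE n m) (fibCoord hs α) w v * f α w.proj) := by
  have hcomp {g : M → ℝ} (hg : MDifferentiableAt (𝓡 n) 𝓘(ℝ, ℝ) g w.proj) :
      MDifferentiableAt (IE n m) 𝓘(ℝ, ℝ) (fun w : TotalSpace (Fib m) E => g w.proj) w :=
    MDifferentiableAt.comp w hg (mdifferentiableAt_proj w)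
  have hmul (α : Fin m) : MDifferentiableAt (IE n m) 𝓘(ℝ, ℝ)
      (fun w => fibCoord hs α w * f α w.proj) w :=
    (mdifferentiableAt_fibCoord hs hU α).mul (hcomp (hf α))
  rw [mvfderiv_add_apply (hcomp h₀) (mdifferentiableAt_finset_sum _ hmul),
    mvfderiv_finset_sum_apply _ hmul, mvfderiv_comp_proj h₀]
  congr 1
  refine Finset.sum_congr rfl fun α _ => ?_
  rw [mvfderiv_mul_apply (mdifferentiableAt_fibCoord hs hU α) (hcomp (hf α)),
    mvfderiv_comp_proj (hf α)]

variable [IsManifold (𝓡 n) ∞ M]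

lemma tangent_totalSpace_ext (hU : U ∈ 𝓝 w.proj) {v v' : TangentSpace (IE n m) w}
    (hproj : tangentProj n w v = tangentProj n w v')
    (hcoord : ∀ α,
      mvfderiv (IE n m) (fibCoord hs α) w v = mvfderiv (IE n m) (fibCoord hs α) w v') :
    v = v' := by
  refine tangent_ext_of_mvfderiv fun l => ?_
  obtain ⟨f₀, f, h₀, hf, hl⟩ := exists_affine_coordinate hs hU l
  rw [mvfderiv_congr_of_eventuallyEq hl, mvfderiv_congr_of_eventuallyEq hl,
    mvfderiv_affine hs hU (h₀.mdifferentiableAt (by simp))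
      fun α => (hf α).mdifferentiableAt (by simp),
    mvfderiv_affine hs hU (h₀.mdifferentiableAt (by simp))
      fun α => (hf α).mdifferentiableAt (by simp), hproj]
  simp only [hcoord]

lemma contMDiffAt_vectorField_totalSpace (hU : U ∈ 𝓝 w.proj)
    {Y : ∀ w : TotalSpace (Fib m) E, TangentSpace (IE n m) w}
    (hproj : ContMDiffAt (IE n m) (𝓡 n).tangent ∞
      (fun w => (⟨w.proj, tangentProj n w (Y w)⟩ : TangentBundle (𝓡 n) M)) w)
    (hcoord : ∀ α, SmoothFunAt n (fun w => mvfderiv (IE n m) (fibCoord hs α) w (Y w)) w) :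
    ContMDiffAt (IE n m) (IE n m).tangent ∞
      (fun w => (⟨w, Y w⟩ : TangentBundle (IE n m) (TotalSpace (Fib m) E))) w := by
  refine contMDiffAt_vectorField_of_mvfderiv fun l => ?_
  obtain ⟨f₀, f, h₀, hf, hl⟩ := exists_affine_coordinate hs hU l
  have hsmooth : SmoothFunAt n (fun w => mvfderiv (𝓡 n) f₀ w.proj (tangentProj n w (Y w)) +
        ∑ α, (fibCoord hs α w * mvfderiv (𝓡 n) (f α) w.proj (tangentProj n w (Y w))
          + mvfderiv (IE n m) (fibCoord hs α) w (Y w) * f α w.proj)) w :=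
    (contMDiffAt_mvfderiv_comp_apply h₀ hproj).add <| ContMDiffAt.sum fun α _ =>
      ((smoothFunAt_fibCoord hs hU α).mul (contMDiffAt_mvfderiv_comp_apply (hf α) hproj)).add
        ((hcoord α).mul ((hf α).comp w (contMDiffAt_proj E)))
  refine hsmooth.congr_of_eventuallyEq ?_
  filter_upwards [hl.eventually_nhds, eventually_proj_nhds (eventually_mem_nhds_iff.2 hU),
    eventually_proj_nhds (eventually_mdifferentiableAt_of_contMDiffAt h₀),
    eventually_proj_nhds
      (eventually_all.2 fun α => eventually_mdifferentiableAt_of_contMDiffAt (hf α))]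
    with w' hl' hU' h₀' hf'
  rw [mvfderiv_congr_of_eventuallyEq hl', mvfderiv_affine hs hU' h₀' hf']

end Affine

end TotalSpace

section Lines

lemma contMDiff_fiberLine (w : TotalSpace (Fib m) E) (a : E w.proj) :
    ContMDiff 𝓘(ℝ, ℝ) (IE n m) ∞ (fiberLine w a) := by
  intro t₀
  refine contMDiffAt_totalSpace.2 ⟨contMDiffAt_const, ?_⟩
  let e := trivializationAt (Fib m) E (fiberLine w a t₀).proj
  have he : w.proj ∈ e.baseSet := FiberBundle.mem_baseSet_trivializationAt' _
  have haffine (t : ℝ) : (e (fiberLine w a t)).2 =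
      e.continuousLinearMapAt ℝ w.proj w.2 + t • e.continuousLinearMapAt ℝ w.proj a := by
    rw [← map_smul, ← map_add, e.continuousLinearMapAt_apply_of_mem (R := ℝ) he]
    rfl
  change ContMDiffAt 𝓘(ℝ, ℝ) 𝓘(ℝ, Fib m) ∞ (fun t => (e (fiberLine w a t)).2) t₀
  simp only [haffine]
  exact contMDiffAt_const.add (contMDiffAt_id.smul contMDiffAt_const)

omit [∀ x, TopologicalSpace (E x)] [FiberBundle (Fib m) E] [VectorBundle ℝ (Fib m) E]
  [TopologicalSpace M] [TopologicalSpace (TotalSpace (Fib m) E)] in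
lemma fiberLine_zero (w : TotalSpace (Fib m) E) (a : E w.proj) : fiberLine w a 0 = w := by
  simp [fiberLine]

lemma mvfderiv_vlift {f : TotalSpace (Fib m) E → ℝ} {w : TotalSpace (Fib m) E}
    (hf : MDifferentiableAt (IE n m) 𝓘(ℝ, ℝ) f w) (a : E w.proj) :
    mvfderiv (IE n m) f w (vlift n w a) = deriv (fun t => f (fiberLine w a t)) 0 := by
  have hline : MDifferentiableAt 𝓘(ℝ, ℝ) (IE n m) (fiberLine w a) 0 :=
    (contMDiff_fiberLine w a).contMDiffAt.mdifferentiableAt (by simp)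
  have hchain := mfderiv_comp_apply_of_eq (0 : ℝ) hf hline (fiberLine_zero w a) (1 : ℝ)
  rw [mfderiv_eq_fderiv] at hchain
  exact hchain.symm

end Lines

section FiberDerivative

variable {s : Fin m → ∀ x, E x} {U : Set M} (hs : IsLocalFrameOn (𝓡 n) (Fib m) ∞ s U)
  {w : TotalSpace (Fib m) E}

variable [ContMDiffVectorBundle ∞ (Fib m) E (𝓡 n)]

lemma mvfderiv_fibCoord_vlift (hU : U ∈ 𝓝 w.proj) (a : E w.proj) (α : Fin m) :
    mvfderiv (IE n m) (fibCoord hs α) w (vlift n w a) = hs.coeff α w.proj a := by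
  have hline : (fun t => fibCoord hs α (fiberLine w a t)) =
      fun t : ℝ => hs.coeff α w.proj w.2 + t * hs.coeff α w.proj a := by
    ext t
    change hs.coeff α w.proj (w.2 + t • a) = _
    rw [map_add, map_smul, smul_eq_mul]
  rw [mvfderiv_vlift (mdifferentiableAt_fibCoord hs hU α), hline]
  simp

variable [IsManifold (𝓡 n) ∞ M]

include hs in
lemma contMDiffAt_vlift_frame (hU : U ∈ 𝓝 w.proj) (β : Fin m) :
    ContMDiffAt (IE n m) (IE n m).tangent ∞
      (fun w => (⟨w, vlift n w (s β w.proj)⟩ :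
        TangentBundle (IE n m) (TotalSpace (Fib m) E))) w := by
  refine contMDiffAt_vectorField_totalSpace hs hU ?_ fun α => ?_
  · have hproj (w : TotalSpace (Fib m) E) : tangentProj n w (vlift n w (s β w.proj)) = 0 :=
      mfderiv_proj_vlift w _
    simp only [hproj]
    exact (contMDiff_zeroSection ℝ (TangentSpace (𝓡 n) : M → Type _)).contMDiffAt.comp w
      (contMDiffAt_proj E)
  · refine (contMDiffAt_const (c := if α = β then (1 : ℝ) else 0)).congr_of_eventuallyEq ?_
    filter_upwards [eventually_proj_nhds (eventually_mem_nhds_iff.2 hU)] with w' hw'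
    rw [mvfderiv_fibCoord_vlift hs hw', frame_coeff_self hs (mem_of_mem_nhds hw')]

lemma vlift_eq_sum (hU : U ∈ 𝓝 w.proj) (a : E w.proj) :
    vlift n w a = ∑ α, hs.coeff α w.proj a • vlift n w (s α w.proj) := by
  have hproj (b : E w.proj) : tangentProj n w (vlift n w b) = 0 := mfderiv_proj_vlift w b
  refine tangent_totalSpace_ext hs hU ?_ fun α => ?_
  · simp [hproj]
  · simp [mvfderiv_fibCoord_vlift hs hU, frame_coeff_self hs (mem_of_mem_nhds hU)]

variable {L : TotalSpace (Fib m) E → ℝ}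

lemma mvfderiv_vlift_eq_sum_dY (hU : U ∈ 𝓝 w.proj) (hL : SmoothFunAt n L w) (a : E w.proj) :
    mvfderiv (IE n m) L w (vlift n w a) = ∑ α, hs.coeff α w.proj a * dY s α L w := by
  have hd := hL.mdifferentiableAt (by simp)
  rw [vlift_eq_sum hs hU, map_sum]
  refine Finset.sum_congr rfl fun α _ => ?_
  rw [map_smul, smul_eq_mul, mvfderiv_vlift hd]
  rfl

include hs in
lemma smoothFunAt_dY (hU : U ∈ 𝓝 w.proj) (hL : SmoothFunNear n L w) (α : Fin m) :
    SmoothFunAt n (dY s α L) w :=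
  (contMDiffAt_mvfderiv_apply hL.self_of_nhds
    (contMDiffAt_vlift_frame hs hU α)).congr_of_eventuallyEq <|
      hL.mono fun _ hw' => (mvfderiv_vlift (hw'.mdifferentiableAt (by simp)) _).symm

include hs in
lemma smoothFunNear_dY (hU : U ∈ 𝓝 w.proj) (hL : SmoothFunNear n L w) (α : Fin m) :
    SmoothFunNear n (dY s α L) w := by
  filter_upwards [eventually_proj_nhds (eventually_mem_nhds_iff.2 hU), hL.eventually_nhds]
    with w' hw' hL' using smoothFunAt_dY hs hw' hL' α

include hs in
lemma smoothFunAt_gMat (hU : U ∈ 𝓝 w.proj) (hL : SmoothFunNear n L w) (α β : Fin m) :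
    SmoothFunAt n (fun w' => gMat s L w' α β) w :=
  smoothFunAt_dY hs hU (smoothFunNear_dY hs hU hL β) α

lemma deriv_fiberLine_eventuallyEq (hU : U ∈ 𝓝 w.proj) (hL : SmoothFunNear n L w)
    (a b : E w.proj) :
    (fun r : ℝ => deriv (fun t : ℝ => L ⟨w.proj, w.2 + r • a + t • b⟩) 0) =ᶠ[𝓝 0]
      fun r => ∑ β, hs.coeff β w.proj b * dY s β L (fiberLine w a r) := by
  have hline : Tendsto (fiberLine w a) (𝓝 0) (𝓝 w) := by
    simpa only [fiberLine_zero] using (contMDiff_fiberLine (n := n) w a).continuous.tendsto 0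
  filter_upwards [hline.eventually hL] with r hr
  exact (mvfderiv_vlift (hr.mdifferentiableAt (by simp)) b).symm.trans
    (mvfderiv_vlift_eq_sum_dY hs (w := fiberLine w a r) hU hr b)

lemma fiberHess_eq_sum_gMat (hU : U ∈ 𝓝 w.proj) (hL : SmoothFunNear n L w) (a b : E w.proj) :
    fiberHess L w a b =
      ∑ α, ∑ β, hs.coeff α w.proj a * hs.coeff β w.proj b * gMat s L w α β := by
  have hdY (β) : SmoothFunAt n (dY s β L) w := smoothFunAt_dY hs hU hL β
  have hterm (β) : SmoothFunAt n (fun w' => hs.coeff β w.proj b * dY s β L w') w :=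
    contMDiffAt_const.mul (hdY β)
  unfold fiberHess
  rw [(deriv_fiberLine_eventuallyEq hs hU hL a b).deriv_eq,
    ← mvfderiv_vlift (f := fun w' => ∑ β, hs.coeff β w.proj b * dY s β L w')
      ((ContMDiffAt.sum fun β _ => hterm β).mdifferentiableAt (by simp)),
    mvfderiv_finset_sum_apply (f := fun β w' => hs.coeff β w.proj b * dY s β L w') _
      fun β => (hterm β).mdifferentiableAt (by simp), Finset.sum_comm]
  refine Finset.sum_congr rfl fun β _ => ?_
  rw [mvfderiv_mul_apply mdifferentiableAt_const ((hdY β).mdifferentiableAt (by simp)),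
    mvfderiv_const_apply, mvfderiv_vlift_eq_sum_dY hs hU (hdY β), zero_mul, add_zero,
    Finset.mul_sum]
  exact Finset.sum_congr rfl fun α _ => by rw [← mul_assoc, mul_comm (hs.coeff β _ b)]; rfl

include hs in
lemma gMat_det_ne_zero (hU : U ∈ 𝓝 w.proj) (hL : SmoothFunNear n L w)
    (hreg : ∀ a : E w.proj, (∀ b, fiberHess L w a b = 0) → a = 0) : (gMat s L w).det ≠ 0 := by
  intro hdet
  obtain ⟨c, hc, hcg⟩ := Matrix.exists_vecMul_eq_zero_iff.2 hdet
  have hkernel : ∑ α, c α • s α w.proj = 0 := by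
    refine hreg _ fun b => ?_
    rw [fiberHess_eq_sum_gMat hs hU hL, Finset.sum_comm]
    refine Finset.sum_eq_zero fun β _ => ?_
    have hcol : ∑ α, c α * gMat s L w α β = 0 := congrFun hcg β
    simp only [frame_coeff_sum hs (mem_of_mem_nhds hU), mul_right_comm _ (hs.coeff β w.proj b)]
    rw [← Finset.sum_mul, hcol, zero_mul]
  refine hc (funext fun α => ?_)
  rw [← frame_coeff_sum hs (mem_of_mem_nhds hU) c α, hkernel, map_zero]
  rfl

end FiberDerivative

variable [IsManifold (𝓡 n) ∞ M] {A : LieAlgebroid n m E}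

section Components

variable {w : TotalSpace (Fib m) E}

lemma anchor_eq_tangentProj (z : A.prolong w) :
    A.anchor w.proj z.1.1 = tangentProj n w z.1.2 := z.2

/-- The differential `d f` of the Lie algebroid `𝒯E` at `w`, as a linear form on `𝒯_w E`; thus
`D ρ f w` is its value at `ρ w`. -/
def differential (f : TotalSpace (Fib m) E → ℝ) (w : TotalSpace (Fib m) E) :
    A.prolong w →ₗ[ℝ] ℝ :=
  (mvfderiv (IE n m) f w).toLinearMap.comp
    ((LinearMap.snd ℝ (E w.proj) (TangentSpace (IE n m) w)).comp (A.prolong w).subtype)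

lemma D_eq_differential (ρ : A.Sec) (f : TotalSpace (Fib m) E → ℝ) (w : TotalSpace (Fib m) E) :
    D ρ f w = differential f w (ρ w) := rfl

lemma differential_congr {f g : TotalSpace (Fib m) E → ℝ} (h : f =ᶠ[𝓝 w] g) (z : A.prolong w) :
    differential f w z = differential g w z :=
  mvfderiv_congr_of_eventuallyEq h _

lemma D_eq_zero_of_eventually_const (ρ : A.Sec) {f : TotalSpace (Fib m) E → ℝ} {c : ℝ}
    (h : ∀ᶠ w' in 𝓝 w, f w' = c) : D ρ f w = 0 :=
  (differential_congr (g := fun _ => c) h _).trans (mvfderiv_const_apply c _)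

section Leibniz

variable {f g : TotalSpace (Fib m) E → ℝ}

lemma differential_sub (hf : SmoothFunAt n f w) (hg : SmoothFunAt n g w) (z : A.prolong w) :
    differential (fun w' => f w' - g w') w z = differential f w z - differential g w z :=
  mvfderiv_sub_apply (hf.mdifferentiableAt (by simp)) (hg.mdifferentiableAt (by simp)) _

lemma differential_add (hf : SmoothFunAt n f w) (hg : SmoothFunAt n g w) (z : A.prolong w) :
    differential (fun w' => f w' + g w') w z = differential f w z + differential g w z :=
  mvfderiv_add_apply (hf.mdifferentiableAt (by simp)) (hg.mdifferentiableAt (by simp)) _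

lemma differential_mul (hf : SmoothFunAt n f w) (hg : SmoothFunAt n g w) (z : A.prolong w) :
    differential (fun w' => f w' * g w') w z =
      f w * differential g w z + differential f w z * g w :=
  mvfderiv_mul_apply (hf.mdifferentiableAt (by simp)) (hg.mdifferentiableAt (by simp)) _

lemma differential_sum_mul {ι : Type*} [Fintype ι] {f g : ι → TotalSpace (Fib m) E → ℝ}
    (hf : ∀ i, SmoothFunAt n (f i) w) (hg : ∀ i, SmoothFunAt n (g i) w) (z : A.prolong w) :
    differential (fun w' => ∑ i, f i w' * g i w') w z =
      ∑ i, (f i w * differential (g i) w z + differential (f i) w z * g i w) :=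
  (mvfderiv_finset_sum_apply (f := fun i w' => f i w' * g i w') Finset.univ
    (fun i => ((hf i).mul (hg i)).mdifferentiableAt (by simp)) _).trans
    (Finset.sum_congr rfl fun i _ => differential_mul (hf i) (hg i) z)

end Leibniz

variable {s : Fin m → ∀ x, E x} {U : Set M} (hs : IsLocalFrameOn (𝓡 n) (Fib m) ∞ s U)

/-- The component of `z ∈ 𝒯_w E` along `𝒳_α`. -/
def dualX (α : Fin m) (w : TotalSpace (Fib m) E) : A.prolong w →ₗ[ℝ] ℝ :=
  (hs.coeff α w.proj).comp
    ((LinearMap.fst ℝ (E w.proj) (TangentSpace (IE n m) w)).comp (A.prolong w).subtype)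

/-- The component of `z ∈ 𝒯_w E` along `𝒱_α`. -/
def dualV (α : Fin m) (w : TotalSpace (Fib m) E) : A.prolong w →ₗ[ℝ] ℝ :=
  differential (fibCoord hs α) w

lemma dualX_apply (α : Fin m) (z : A.prolong w) :
    dualX hs α w z = hs.coeff α w.proj z.1.1 := rfl

lemma IsVertical.dualX_eq_zero {z : A.prolong w} (hz : IsVertical z) (α : Fin m) :
    dualX hs α w z = 0 := by
  rw [dualX_apply, hz, map_zero]

lemma isVertical_of_dualX (hU : U ∈ 𝓝 w.proj) {z : A.prolong w} (h : ∀ α, dualX hs α w z = 0) :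
    IsVertical z :=
  frame_ext hs (mem_of_mem_nhds hU) fun α => (h α).trans (map_zero _).symm

lemma dualX_eq_fibCoord {z : A.prolong w} (hz : z.1.1 = w.2) (α : Fin m) :
    dualX hs α w z = fibCoord hs α w := by
  rw [dualX_apply, hz]
  rfl

variable [ContMDiffVectorBundle ∞ (Fib m) E (𝓡 n)]

lemma prolong_ext (hU : U ∈ 𝓝 w.proj) {z z' : A.prolong w}
    (hX : ∀ α, dualX hs α w z = dualX hs α w z') (hV : ∀ α, dualV hs α w z = dualV hs α w z') :
    z = z' := by
  have hfst : z.1.1 = z'.1.1 := frame_ext hs (mem_of_mem_nhds hU) hX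
  have hproj : tangentProj n w z.1.2 = tangentProj n w z'.1.2 := by
    rw [← anchor_eq_tangentProj, ← anchor_eq_tangentProj, hfst]
  exact Subtype.ext (Prod.ext hfst (tangent_totalSpace_ext hs hU hproj hV))

lemma dualX_vert (w : TotalSpace (Fib m) E) (a : E w.proj) (α : Fin m) :
    dualX hs α w (A.vert w a) = 0 :=
  map_zero (hs.coeff α w.proj)

lemma dualV_vert (hU : U ∈ 𝓝 w.proj) (a : E w.proj) (α : Fin m) :
    dualV hs α w (A.vert w a) = hs.coeff α w.proj a :=
  mvfderiv_fibCoord_vlift hs hU a α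

variable (A s) in
/-- The local section `𝒱_α = (0, ∂/∂y^α)`. -/
def frameV (α : Fin m) : A.Sec := fun w => A.vert w (s α w.proj)

lemma dualX_frameV (w : TotalSpace (Fib m) E) (α β : Fin m) :
    dualX hs α w (frameV A s β w) = 0 :=
  dualX_vert hs w _ α

lemma dualV_frameV (hU : U ∈ 𝓝 w.proj) (α β : Fin m) :
    dualV hs α w (frameV A s β w) = if α = β then 1 else 0 :=
  (dualV_vert hs hU _ α).trans (frame_coeff_self hs (mem_of_mem_nhds hU) α β)

lemma D_frameV (α : Fin m) {f : TotalSpace (Fib m) E → ℝ}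
    (hf : MDifferentiableAt (IE n m) 𝓘(ℝ, ℝ) f w) : D (frameV A s α) f w = dY s α f w :=
  mvfderiv_vlift hf _

omit [IsManifold (𝓡 n) ∞ M] in
lemma mdifferentiableAt_constSec (w : TotalSpace (Fib m) E) {x : M} (hU : U ∈ 𝓝 x) :
    MDifferentiableAt (𝓡 n) (IE n m) (constSec hs w) x := by
  have hsmooth : ContMDiffAt (𝓡 n) (IE n m) ∞ (constSec hs w) x := by
    refine contMDiffAt_of_frame_coeff hs contMDiffAt_id hU fun α =>
      (contMDiffAt_const (c := fibCoord hs α w)).congr_of_eventuallyEq ?_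
    filter_upwards [hU] with y hy using fibCoord_constSec hs w hy α
  exact hsmooth.mdifferentiableAt (by simp)

lemma mem_prolong_frameX (hU : U ∈ 𝓝 w.proj) (α : Fin m) :
    ((s α w.proj, mfderiv (𝓡 n) (IE n m) (constSec hs w) w.proj
      (A.anchor w.proj (s α w.proj))) : E w.proj × TangentSpace (IE n m) w) ∈ A.prolong w := by
  change A.anchor w.proj (s α w.proj) = _
  have hchain := mfderiv_comp_apply_of_eq w.proj (mdifferentiableAt_proj (n := n) w)
    (mdifferentiableAt_constSec hs w hU) (constSec_self hs (mem_of_mem_nhds hU))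
    (A.anchor w.proj (s α w.proj))
  have hsection : (TotalSpace.proj : TotalSpace (Fib m) E → M) ∘ constSec hs w = id := rfl
  rw [hsection, mfderiv_id] at hchain
  exact hchain

lemma frameX_val (hU : U ∈ 𝓝 w.proj) (α : Fin m) :
    (frameX A hs α w).1 = (s α w.proj, mfderiv (𝓡 n) (IE n m) (constSec hs w) w.proj
      (A.anchor w.proj (s α w.proj))) := by
  unfold frameX
  rw [dif_pos (mem_prolong_frameX hs hU α)]
  rfl

lemma D_frameX (hU : U ∈ 𝓝 w.proj) (α : Fin m) {f : TotalSpace (Fib m) E → ℝ}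
    (hf : MDifferentiableAt (IE n m) 𝓘(ℝ, ℝ) f w) : D (frameX A hs α) f w = dX hs A α f w := by
  have hchain := mvfderiv_comp_apply_of_eq w.proj hf (mdifferentiableAt_constSec hs w hU)
    (constSec_self hs (mem_of_mem_nhds hU)) (A.anchor w.proj (s α w.proj))
  unfold D dX
  rw [frameX_val hs hU]
  exact hchain.symm

lemma dualX_frameX (hU : U ∈ 𝓝 w.proj) (α β : Fin m) :
    dualX hs α w (frameX A hs β w) = if α = β then 1 else 0 := by
  rw [dualX_apply, frameX_val hs hU]
  exact frame_coeff_self hs (mem_of_mem_nhds hU) α β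

lemma dualV_frameX (hU : U ∈ 𝓝 w.proj) (α β : Fin m) :
    dualV hs α w (frameX A hs β w) = 0 := by
  have hconst : fibCoord hs α ∘ constSec hs w =ᶠ[𝓝 w.proj] fun _ => fibCoord hs α w := by
    filter_upwards [hU] with y hy using fibCoord_constSec hs w hy α
  refine (D_frameX (A := A) hs hU β (mdifferentiableAt_fibCoord hs hU α)).trans ?_
  exact (mvfderiv_congr_of_eventuallyEq hconst _).trans (mvfderiv_const_apply _ _)

lemma eq_sum_frame (hU : U ∈ 𝓝 w.proj) (z : A.prolong w) :
    z = ∑ α, dualX hs α w z • frameX A hs α w + ∑ α, dualV hs α w z • frameV A s α w := by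
  refine prolong_ext hs hU (fun β => ?_) fun β => ?_
  · simp [map_sum, dualX_frameX hs hU, dualX_frameV]
  · simp [map_sum, dualV_frameX hs hU, dualV_frameV hs hU]

lemma differential_eq_sum (hU : U ∈ 𝓝 w.proj) (f : TotalSpace (Fib m) E → ℝ)
    (z : A.prolong w) :
    differential f w z = ∑ α, dualX hs α w z * D (frameX A hs α) f w
      + ∑ α, dualV hs α w z * D (frameV A s α) f w := by
  conv_lhs => rw [eq_sum_frame hs hU z]
  simp [map_sum, D_eq_differential]

end Components

section SmoothAt

variable [ContMDiffVectorBundle ∞ (Fib m) E (𝓡 n)]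

/-- Smoothness of a section of `𝒯E` at a point: the pointwise form of `SmoothOn`. -/
def SmoothAt (ρ : A.Sec) (w : TotalSpace (Fib m) E) : Prop :=
  ContMDiffAt (IE n m) (IE n m) ∞
      (fun w => (⟨w.proj, (ρ w).1.1⟩ : TotalSpace (Fib m) E)) w ∧
    ContMDiffAt (IE n m) (IE n m).tangent ∞
      (fun w => (⟨w, (ρ w).1.2⟩ : TangentBundle (IE n m) (TotalSpace (Fib m) E))) w

variable {ρ ρ' : A.Sec} {w : TotalSpace (Fib m) E} {W : Set (TotalSpace (Fib m) E)}

lemma SmoothOn.smoothAt (h : SmoothOn ρ W) (hW : W ∈ 𝓝 w) : SmoothAt ρ w :=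
  ⟨h.1.contMDiffAt hW, h.2.contMDiffAt hW⟩

lemma smoothOn_of_smoothAt (h : ∀ w ∈ W, SmoothAt ρ w) : SmoothOn ρ W :=
  ⟨fun w hw => (h w hw).1.contMDiffWithinAt, fun w hw => (h w hw).2.contMDiffWithinAt⟩

lemma SmoothAt.congr (h : SmoothAt ρ w) (h' : ∀ᶠ w' in 𝓝 w, ρ' w' = ρ w') : SmoothAt ρ' w :=
  ⟨h.1.congr_of_eventuallyEq (h'.mono fun _ hy => by simp only [hy]),
    h.2.congr_of_eventuallyEq (h'.mono fun _ hy => by simp only [hy])⟩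

lemma SmoothAt.D {f : TotalSpace (Fib m) E → ℝ} (h : SmoothAt ρ w) (hf : SmoothFunAt n f w) :
    SmoothFunAt n (D ρ f) w :=
  contMDiffAt_mvfderiv_apply hf h.2

variable {s : Fin m → ∀ x, E x} {U : Set M} (hs : IsLocalFrameOn (𝓡 n) (Fib m) ∞ s U)

lemma SmoothAt.dualX (h : SmoothAt ρ w) (hU : U ∈ 𝓝 w.proj) (α : Fin m) :
    SmoothFunAt n (fun w => dualX hs α w (ρ w)) w :=
  contMDiffAt_frame_coeff hs h.1 hU α

lemma SmoothAt.dualV (h : SmoothAt ρ w) (hU : U ∈ 𝓝 w.proj) (α : Fin m) :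
    SmoothFunAt n (fun w => dualV hs α w (ρ w)) w :=
  h.D (smoothFunAt_fibCoord hs hU α)

lemma smoothAt_of_components (hU : U ∈ 𝓝 w.proj)
    (hX : ∀ α, SmoothFunAt n (fun w => LieAlgebroid.dualX hs α w (ρ w)) w)
    (hV : ∀ α, SmoothFunAt n (fun w => LieAlgebroid.dualV hs α w (ρ w)) w) : SmoothAt ρ w := by
  have hfst : ContMDiffAt (IE n m) (IE n m) ∞
      (fun w => (⟨w.proj, (ρ w).1.1⟩ : TotalSpace (Fib m) E)) w :=
    contMDiffAt_of_frame_coeff hs (contMDiffAt_proj E) hU hX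
  refine ⟨hfst, contMDiffAt_vectorField_totalSpace hs hU ?_ hV⟩
  simp only [← anchor_eq_tangentProj]
  exact A.anchor_smooth.contMDiffAt.comp w hfst

lemma smoothAt_frameX (hU : U ∈ 𝓝 w.proj) (β : Fin m) : SmoothAt (frameX A hs β) w :=
  have hU' := eventually_proj_nhds (eventually_mem_nhds_iff.2 hU)
  smoothAt_of_components hs hU
    (fun α => contMDiffAt_const.congr_of_eventuallyEq
      (hU'.mono fun _ hw' => dualX_frameX hs hw' α β))
    (fun α => contMDiffAt_const.congr_of_eventuallyEq
      (hU'.mono fun _ hw' => dualV_frameX hs hw' α β))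

include hs in
lemma smoothAt_frameV (hU : U ∈ 𝓝 w.proj) (β : Fin m) : SmoothAt (frameV A s β) w :=
  have hU' := eventually_proj_nhds (eventually_mem_nhds_iff.2 hU)
  smoothAt_of_components hs hU
    (fun α => contMDiffAt_const.congr_of_eventuallyEq
      (Eventually.of_forall fun w' => dualX_frameV hs w' α β))
    (fun α => contMDiffAt_const.congr_of_eventuallyEq
      (hU'.mono fun _ hw' => dualV_frameV hs hw' α β))

end SmoothAt

section FrameDuals

variable {w : TotalSpace (Fib m) E} {s : Fin m → ∀ x, E x} {U : Set M}
  (hs : IsLocalFrameOn (𝓡 n) (Fib m) ∞ s U) (ρ : A.Sec)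

variable [ContMDiffVectorBundle ∞ (Fib m) E (𝓡 n)]

lemma D_dualX_frameX (hU : U ∈ 𝓝 w.proj) (α β : Fin m) :
    D ρ (fun w' => dualX hs α w' (frameX A hs β w')) w = 0 :=
  D_eq_zero_of_eventually_const ρ <| (eventually_proj_nhds (eventually_mem_nhds_iff.2 hU)).mono
    fun _ hw' => dualX_frameX hs hw' α β

lemma D_dualV_frameX (hU : U ∈ 𝓝 w.proj) (α β : Fin m) :
    D ρ (fun w' => dualV hs α w' (frameX A hs β w')) w = 0 :=
  D_eq_zero_of_eventually_const ρ <| (eventually_proj_nhds (eventually_mem_nhds_iff.2 hU)).mono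
    fun _ hw' => dualV_frameX hs hw' α β

lemma D_dualX_frameV (α β : Fin m) : D ρ (fun w' => dualX hs α w' (frameV A s β w')) w = 0 :=
  D_eq_zero_of_eventually_const ρ <| Eventually.of_forall fun w' => dualX_frameV hs w' α β

lemma D_dualV_frameV (hU : U ∈ 𝓝 w.proj) (α β : Fin m) :
    D ρ (fun w' => dualV hs α w' (frameV A s β w')) w = 0 :=
  D_eq_zero_of_eventually_const ρ <| (eventually_proj_nhds (eventually_mem_nhds_iff.2 hU)).mono
    fun _ hw' => dualV_frameV hs hw' α β

end FrameDuals

section StructureFunctions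

variable {s : Fin m → ∀ x, E x} {U : Set M} (hs : IsLocalFrameOn (𝓡 n) (Fib m) ∞ s U) {x : M}

lemma mvfderiv_anchor_eq_sum {x : M} (hx : x ∈ U) (f : M → ℝ) (u : E x) :
    mvfderiv (𝓡 n) f x (A.anchor x u) =
      ∑ α, hs.coeff α x u * mvfderiv (𝓡 n) f x (A.anchor x (s α x)) := by
  conv_lhs => rw [← frame_sum_coeff hs hx u]
  simp only [map_sum, map_smul, smul_eq_mul]

include hs in
lemma contMDiffAt_anchor_frame (hU : U ∈ 𝓝 x) (α : Fin m) :
    ContMDiffAt (𝓡 n) (𝓡 n).tangent ∞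
      (fun x => (⟨x, A.anchor x (s α x)⟩ : TangentBundle (𝓡 n) M)) x :=
  A.anchor_smooth.contMDiffAt.comp x ((hs.contMDiffOn α).contMDiffAt hU)

variable [T2Space M]

include hs in
lemma hasSmoothGerm_frame (hU : U ∈ 𝓝 x) (α : Fin m) : HasSmoothGerm n m (s α) x :=
  hasSmoothGerm_of_eventually_contMDiffAt <|
    (eventually_mem_nhds_iff.2 hU).mono fun _ hy => (hs.contMDiffOn α).contMDiffAt hy

lemma structFun_skew (hU : U ∈ 𝓝 x) (γ α β : Fin m) :
    structFun hs A γ α β x = -structFun hs A γ β α x := by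
  unfold structFun
  rw [A.localBracket_skew (hasSmoothGerm_frame hs hU α) (hasSmoothGerm_frame hs hU β), map_neg]

-- The anchor is a homomorphism: `[σ(s_α), σ(s_β)] = L^γ_{αβ} σ(s_γ)` as derivations.
lemma sum_structFun_mul_mvfderiv_anchor (hU : U ∈ 𝓝 x) {f : M → ℝ}
    (hf : ContMDiffAt (𝓡 n) 𝓘(ℝ, ℝ) ∞ f x) (α β : Fin m) :
    ∑ γ, structFun hs A γ α β x * mvfderiv (𝓡 n) f x (A.anchor x (s γ x)) =
      mvfderiv (𝓡 n) (fun y => mvfderiv (𝓡 n) f y (A.anchor y (s β y))) x (A.anchor x (s α x))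
      - mvfderiv (𝓡 n) (fun y => mvfderiv (𝓡 n) f y (A.anchor y (s α y))) x
          (A.anchor x (s β x)) := by
  rw [← mvfderiv_mlieBracket hf (contMDiffAt_anchor_frame hs hU α)
    (contMDiffAt_anchor_frame hs hU β), ← A.anchor_localBracket (hasSmoothGerm_frame hs hU α)
    (hasSmoothGerm_frame hs hU β), mvfderiv_anchor_eq_sum hs (mem_of_mem_nhds hU)]
  rfl

end StructureFunctions

variable [ContMDiffVectorBundle ∞ (Fib m) E (𝓡 n)]

section Lagrangian

variable {s : Fin m → ∀ x, E x} {U : Set M} (hs : IsLocalFrameOn (𝓡 n) (Fib m) ∞ s U)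
  {L : TotalSpace (Fib m) E → ℝ} {w : TotalSpace (Fib m) E} {ρ ν : A.Sec}

lemma dY_eventuallyEq_D (A : LieAlgebroid n m E) (hL : SmoothFunNear n L w) (α : Fin m) :
    dY s α L =ᶠ[𝓝 w] D (frameV A s α) L :=
  hL.mono fun _ h => (D_frameV α (h.mdifferentiableAt (by simp))).symm

include hs in
lemma gMat_eq_D (A : LieAlgebroid n m E) (hU : U ∈ 𝓝 w.proj) (hL : SmoothFunNear n L w)
    (α β : Fin m) : gMat s L w α β = D (frameV A s α) (dY s β L) w :=
  (D_frameV α ((smoothFunAt_dY hs hU hL β).mdifferentiableAt (by simp))).symm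

lemma D_frameV_comp_proj {f : M → ℝ} (hf : MDifferentiableAt (𝓡 n) 𝓘(ℝ, ℝ) f w.proj)
    (α : Fin m) : D (frameV A s α) (fun w' => f w'.proj) w = 0 := by
  refine (mvfderiv_comp_proj hf (frameV A s α w).1.2).trans ?_
  have hproj : tangentProj n w (frameV A s α w).1.2 = 0 := mfderiv_proj_vlift w _
  rw [hproj, map_zero]

lemma dualX_J (ρ : A.Sec) (w : TotalSpace (Fib m) E) (α : Fin m) : dualX hs α w (J ρ w) = 0 :=
  dualX_vert hs w _ α

lemma dualV_J (hU : U ∈ 𝓝 w.proj) (ρ : A.Sec) (α : Fin m) :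
    dualV hs α w (J ρ w) = dualX hs α w (ρ w) :=
  dualV_vert hs hU _ α

include hs in
lemma SmoothAt.J (h : SmoothAt ρ w) (hU : U ∈ 𝓝 w.proj) : SmoothAt (J ρ) w :=
  smoothAt_of_components hs hU
    (fun α => contMDiffAt_const.congr_of_eventuallyEq
      (Eventually.of_forall fun w' => dualX_J hs ρ w' α))
    (fun α => (h.dualX hs hU α).congr_of_eventuallyEq <|
      (eventually_proj_nhds (eventually_mem_nhds_iff.2 hU)).mono fun _ hw' => dualV_J hs hw' ρ α)

lemma theta_eq_sum (hU : U ∈ 𝓝 w.proj) (hL : SmoothFunAt n L w) (ρ : A.Sec) :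
    theta L ρ w = ∑ α, dualX hs α w (ρ w) * dY s α L w :=
  mvfderiv_vlift_eq_sum_dY hs hU hL _

lemma energy_eq_sum (hU : U ∈ 𝓝 w.proj) (hL : SmoothFunAt n L w) :
    A.energy L w = ∑ α, fibCoord hs α w * dY s α L w - L w :=
  congrArg (· - L w) (mvfderiv_vlift_eq_sum_dY hs hU hL _)

lemma D_theta (hU : U ∈ 𝓝 w.proj) (hL : SmoothFunNear n L w) (ρ : A.Sec) (hν : SmoothAt ν w) :
    D ρ (theta L ν) w = ∑ α, (dualX hs α w (ν w) * D ρ (dY s α L) w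
      + D ρ (fun w' => dualX hs α w' (ν w')) w * dY s α L w) := by
  have htheta : theta L ν =ᶠ[𝓝 w] fun w' => ∑ α, dualX hs α w' (ν w') * dY s α L w' := by
    filter_upwards [hL, eventually_proj_nhds (eventually_mem_nhds_iff.2 hU)] with w' hL' hU'
      using theta_eq_sum hs hU' hL' ν
  rw [D_eq_differential, differential_congr htheta]
  exact differential_sum_mul (f := fun α w' => dualX hs α w' (ν w'))
    (fun α => hν.dualX hs hU α) (fun α => smoothFunAt_dY hs hU hL α) _

-- The terms `dy^α(ν) ∂L/∂y^α` from the product rule cancel against those of `dL(ν)`.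
lemma D_energy (hU : U ∈ 𝓝 w.proj) (hL : SmoothFunNear n L w) (ν : A.Sec) :
    D ν (A.energy L) w = ∑ α, fibCoord hs α w * D ν (dY s α L) w
      - ∑ β, dualX hs β w (ν w) * D (frameX A hs β) L w := by
  have henergy : A.energy L =ᶠ[𝓝 w] fun w' => (∑ α, fibCoord hs α w' * dY s α L w') - L w' := by
    filter_upwards [hL, eventually_proj_nhds (eventually_mem_nhds_iff.2 hU)] with w' hL' hU'
      using energy_eq_sum hs hU' hL'
  have hy (α) := smoothFunAt_fibCoord hs hU α
  have hdY (α) := smoothFunAt_dY hs hU hL α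
  have hsum : SmoothFunAt n (fun w' => ∑ α, fibCoord hs α w' * dY s α L w') w :=
    ContMDiffAt.sum fun α _ => (hy α).mul (hdY α)
  rw [D_eq_differential, differential_congr henergy, differential_sub hsum hL.self_of_nhds,
    differential_sum_mul hy hdY, differential_eq_sum hs hU L]
  simp only [(dY_eventuallyEq_D A hL _).eq_of_nhds, Finset.sum_add_distrib, D_eq_differential,
    dualV]
  ring

end Lagrangian

section Components

variable {s : Fin m → ∀ x, E x} {U : Set M} (hs : IsLocalFrameOn (𝓡 n) (Fib m) ∞ s U)
  {w : TotalSpace (Fib m) E}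

lemma differential_of_isVertical (hU : U ∈ 𝓝 w.proj) (f : TotalSpace (Fib m) E → ℝ)
    {z : A.prolong w} (hz : IsVertical z) :
    differential f w z = ∑ α, dualV hs α w z * D (frameV A s α) f w := by
  rw [differential_eq_sum hs hU]
  simp only [hz.dualX_eq_zero hs, zero_mul, Finset.sum_const_zero, zero_add]

/-- The section `a^α 𝒳_α + b^α 𝒱_α` with given component functions. -/
def frameSum (a b : Fin m → TotalSpace (Fib m) E → ℝ) : A.Sec := fun w =>
  ∑ α, a α w • frameX A hs α w + ∑ α, b α w • frameV A s α w

variable (a b : Fin m → TotalSpace (Fib m) E → ℝ)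

lemma dualX_frameSum (hU : U ∈ 𝓝 w.proj) (α : Fin m) :
    dualX hs α w (frameSum (A := A) hs a b w) = a α w := by
  simp [frameSum, map_sum, dualX_frameX hs hU, dualX_frameV]

lemma dualV_frameSum (hU : U ∈ 𝓝 w.proj) (α : Fin m) :
    dualV hs α w (frameSum (A := A) hs a b w) = b α w := by
  simp [frameSum, map_sum, dualV_frameX hs hU, dualV_frameV hs hU]

lemma isVertical_frameSum (b : Fin m → TotalSpace (Fib m) E → ℝ) (w : TotalSpace (Fib m) E) :
    IsVertical (frameSum (A := A) hs 0 b w) := by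
  have hframe (α : Fin m) :
      ((frameV A s α w).1 : E w.proj × TangentSpace (IE n m) w).1 = 0 := rfl
  simp [IsVertical, frameSum, hframe, Prod.fst_sum]

variable {a b}

lemma smoothAt_frameSum (hU : U ∈ 𝓝 w.proj) (ha : ∀ α, SmoothFunAt n (a α) w)
    (hb : ∀ α, SmoothFunAt n (b α) w) : SmoothAt (frameSum (A := A) hs a b) w := by
  have hnear := eventually_proj_nhds (eventually_mem_nhds_iff.2 hU)
  exact smoothAt_of_components hs hU
    (fun α => (ha α).congr_of_eventuallyEq <| hnear.mono fun _ h => dualX_frameSum hs a b h α)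
    (fun α => (hb α).congr_of_eventuallyEq <| hnear.mono fun _ h => dualV_frameSum hs a b h α)

lemma smoothAt_frameSum_cutoff {χ : M → ℝ} (hχ : ContMDiff (𝓡 n) 𝓘(ℝ, ℝ) ∞ χ)
    (hsupp : tsupport χ ⊆ interior U) (a b : Fin m → ℝ) (w : TotalSpace (Fib m) E) :
    SmoothAt (frameSum (A := A) hs (fun α w => χ w.proj * a α) fun α w => χ w.proj * b α) w := by
  have hχw := smoothFunAt_comp_proj (w := w) hχ.contMDiffAt
  by_cases hw : w.proj ∈ interior U
  · exact smoothAt_frameSum hs (mem_interior_iff_mem_nhds.1 hw)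
      (fun _ => hχw.mul contMDiffAt_const) fun _ => hχw.mul contMDiffAt_const
  · obtain ⟨t, V, hV, ht⟩ := exists_frame (n := n) (m := m) (E := E) w.proj
    have hcompl : ∀ᶠ x in 𝓝 w.proj, x ∈ (tsupport χ)ᶜ :=
      (isClosed_tsupport χ).isOpen_compl.mem_nhds fun h => hw (hsupp h)
    have hzero : SmoothAt (frameSum (A := A) ht 0 0) w :=
      smoothAt_frameSum ht hV (fun _ => contMDiffAt_const) fun _ => contMDiffAt_const
    refine hzero.congr ((eventually_proj_nhds hcompl).mono fun w' hw' => ?_)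
    simp [frameSum, image_eq_zero_of_notMem_tsupport hw']

end Components

section FrameReflection

variable {s : Fin m → ∀ x, E x} {U : Set M} (hs : IsLocalFrameOn (𝓡 n) (Fib m) ∞ s U)
  {w : TotalSpace (Fib m) E} (c : Matrix (Fin m) (Fin m) ℝ)

/-- The endomorphism of `𝒯_w E` with `𝒳_β ↦ 𝒳_β + c^α_β 𝒱_α` and `𝒱_α ↦ -𝒱_α`: the local form of a
nonlinear connection. -/
def frameReflection (w : TotalSpace (Fib m) E) : A.prolong w →ₗ[ℝ] A.prolong w :=
  ∑ β, (dualX hs β w).smulRight (frameX A hs β w + ∑ α, c α β • frameV A s α w)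
    - ∑ α, (dualV hs α w).smulRight (frameV A s α w)

lemma dualX_frameReflection (hU : U ∈ 𝓝 w.proj) (z : A.prolong w) (α : Fin m) :
    dualX hs α w (frameReflection hs c w z) = dualX hs α w z := by
  simp [frameReflection, map_sum, dualX_frameX hs hU, dualX_frameV]

lemma dualV_frameReflection (hU : U ∈ 𝓝 w.proj) (z : A.prolong w) (α : Fin m) :
    dualV hs α w (frameReflection hs c w z) =
      ∑ β, dualX hs β w z * c α β - dualV hs α w z := by
  simp [frameReflection, map_sum, dualV_frameX hs hU, dualV_frameV hs hU]

lemma frameReflection_frameReflection (hU : U ∈ 𝓝 w.proj) (z : A.prolong w) :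
    frameReflection hs c w (frameReflection hs c w z) = z := by
  refine prolong_ext hs hU (fun α => ?_) fun α => ?_
  · simp only [dualX_frameReflection hs c hU]
  · simp only [dualX_frameReflection hs c hU, dualV_frameReflection hs c hU, sub_sub_cancel]

lemma add_frameReflection_eq_zero_iff (hU : U ∈ 𝓝 w.proj) (z : A.prolong w) :
    z + frameReflection hs c w z = 0 ↔ IsVertical z := by
  refine ⟨fun h => isVertical_of_dualX hs hU fun α => ?_, fun h => ?_⟩
  · have hdual := congrArg (dualX hs α w) h
    rw [map_add, dualX_frameReflection hs c hU, map_zero] at hdual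
    linarith
  · refine prolong_ext hs hU (fun α => ?_) fun α => ?_ <;>
      simp [dualX_frameReflection hs c hU, dualV_frameReflection hs c hU, h.dualX_eq_zero hs]

end FrameReflection

namespace NonlinearConnection

variable {s : Fin m → ∀ x, E x} {U : Set M} (hs : IsLocalFrameOn (𝓡 n) (Fib m) ∞ s U)
  {W : Set (TotalSpace (Fib m) E)} (N : A.NonlinearConnection W) {w : TotalSpace (Fib m) E}

lemma toFun_of_isVertical (hw : w ∈ W) {z : A.prolong w} (hz : IsVertical z) :
    N.toFun w z = -z :=
  (neg_eq_of_add_eq_zero_right ((N.ker w hw z).2 hz)).symm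

lemma dualX_toFun (hw : w ∈ W) (z : A.prolong w) (α : Fin m) :
    dualX hs α w (N.toFun w z) = dualX hs α w z := by
  have hvert : IsVertical (N.toFun w z - z) := by
    refine (N.ker w hw _).1 ?_
    rw [map_sub, N.sq w hw]
    abel
  exact sub_eq_zero.1 ((map_sub _ _ _).symm.trans (hvert.dualX_eq_zero hs α))

lemma dualV_toFun_frameX (hU : U ∈ 𝓝 w.proj) (α β : Fin m) :
    dualV hs α w (N.toFun w (frameX A hs β w)) = -2 * N.coeff hs α β w := by
  have hcoeff : N.coeff hs α β w = -dualV hs α w ((1 / 2 : ℝ) • (frameX A hs β w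
    + N.toFun w (frameX A hs β w))) := rfl
  rw [hcoeff, map_smul, map_add, dualV_frameX hs hU, smul_eq_mul]
  ring

lemma dualV_toFun (hU : U ∈ 𝓝 w.proj) (hw : w ∈ W) (z : A.prolong w) (α : Fin m) :
    dualV hs α w (N.toFun w z) =
      -dualV hs α w z - 2 * ∑ β, dualX hs β w z * N.coeff hs α β w := by
  have hframeV (β : Fin m) : N.toFun w (frameV A s β w) = -frameV A s β w :=
    N.toFun_of_isVertical hw rfl
  conv_lhs => rw [eq_sum_frame hs hU z]
  simp only [map_add, map_sum, map_smul, hframeV, N.dualV_toFun_frameX hs hU, map_neg,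
    dualV_frameV hs hU, smul_eq_mul, mul_neg, mul_ite, mul_one, mul_zero,
    Finset.sum_neg_distrib, Finset.sum_ite_eq, Finset.mem_univ, if_true]
  rw [Finset.mul_sum, add_comm, sub_eq_add_neg, ← Finset.sum_neg_distrib]
  exact congrArg _ (Finset.sum_congr rfl fun β _ => by ring)

lemma dualX_h (hw : w ∈ W) (ρ : A.Sec) (α : Fin m) :
    dualX hs α w (N.h ρ w) = dualX hs α w (ρ w) := by
  unfold NonlinearConnection.h
  rw [map_smul, map_add, N.dualX_toFun hs hw, smul_eq_mul]
  ring

lemma dualV_h (hU : U ∈ 𝓝 w.proj) (hw : w ∈ W) (ρ : A.Sec) (α : Fin m) :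
    dualV hs α w (N.h ρ w) = -∑ β, dualX hs β w (ρ w) * N.coeff hs α β w := by
  unfold NonlinearConnection.h
  rw [map_smul, map_add, N.dualV_toFun hs hU hw, smul_eq_mul]
  ring

lemma isVertical_v (hw : w ∈ W) (ρ : A.Sec) : IsVertical (N.v ρ w) := by
  refine (N.ker w hw _).1 ?_
  unfold NonlinearConnection.v
  rw [map_smul, map_sub, N.sq w hw, ← smul_add, sub_add_sub_cancel, sub_self, smul_zero]

lemma dualV_v (hU : U ∈ 𝓝 w.proj) (hw : w ∈ W) (ρ : A.Sec) (α : Fin m) :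
    dualV hs α w (N.v ρ w) =
      dualV hs α w (ρ w) + ∑ β, dualX hs β w (ρ w) * N.coeff hs α β w := by
  unfold NonlinearConnection.v
  rw [map_smul, map_sub, N.dualV_toFun hs hU hw, smul_eq_mul]
  ring

lemma smoothOn_h (hW : IsOpen W) {ρ : A.Sec} (hρ : SmoothOn ρ W) : SmoothOn (N.h ρ) W := by
  refine smoothOn_of_smoothAt fun w hw => ?_
  obtain ⟨s, U, hU, hs⟩ := exists_frame (n := n) (m := m) (E := E) w.proj
  have hρw := hρ.smoothAt (hW.mem_nhds hw)
  have hNρ := (N.smooth ρ hρ).smoothAt (hW.mem_nhds hw)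
  refine smoothAt_of_components hs hU (fun α => ?_) fun α => ?_
  · simp only [NonlinearConnection.h, map_smul, map_add, smul_eq_mul]
    exact contMDiffAt_const.mul ((hρw.dualX hs hU α).add (hNρ.dualX hs hU α))
  · simp only [NonlinearConnection.h, map_smul, map_add, smul_eq_mul]
    exact contMDiffAt_const.mul ((hρw.dualV hs hU α).add (hNρ.dualV hs hU α))

lemma h_of_isVertical (hw : w ∈ W) {ρ : A.Sec} (hρ : IsVertical (ρ w)) : N.h ρ w = 0 := by
  unfold NonlinearConnection.h
  rw [N.toFun_of_isVertical hw hρ, add_neg_cancel, smul_zero]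

lemma v_of_isVertical (hw : w ∈ W) {ρ : A.Sec} (hρ : IsVertical (ρ w)) : N.v ρ w = ρ w := by
  unfold NonlinearConnection.v
  rw [N.toFun_of_isVertical hw hρ, sub_neg_eq_add, ← two_smul ℝ (ρ w), smul_smul]
  norm_num

lemma toFun_eq_of_coeff_eq {N' : A.NonlinearConnection W} (hU : U ∈ 𝓝 w.proj) (hw : w ∈ W)
    (h : ∀ α β, N'.coeff hs α β w = N.coeff hs α β w) : N'.toFun w = N.toFun w := by
  ext1 z
  refine prolong_ext hs hU (fun α => ?_) fun α => ?_
  · rw [N'.dualX_toFun hs hw, N.dualX_toFun hs hw]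
  · simp only [N'.dualV_toFun hs hU hw, N.dualV_toFun hs hU hw, h]

end NonlinearConnection

section FiberPart

variable {s : Fin m → ∀ x, E x} {U : Set M} (hs : IsLocalFrameOn (𝓡 n) (Fib m) ∞ s U)
  {w : TotalSpace (Fib m) E}

lemma coeff_fiberPart (hU : U ∈ 𝓝 w.proj) {z : A.prolong w} (hz : IsVertical z) (α : Fin m) :
    hs.coeff α w.proj (fiberPart n w z.1.2) = dualV hs α w z := by
  have hproj : tangentProj n w z.1.2 = 0 := by rw [← anchor_eq_tangentProj, hz, map_zero]
  have hderiv := coeff_symm_mvfderiv_triv hs hU (r := fun w' => w'.2) contMDiffAt_id z.1.2 α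
  rwa [hproj, map_zero, sub_zero] at hderiv

end FiberPart

variable [T2Space M]

section StructureFunctions

variable {s : Fin m → ∀ x, E x} {U : Set M} (hs : IsLocalFrameOn (𝓡 n) (Fib m) ∞ s U) {x : M}

lemma contMDiffAt_structFun (hU : U ∈ 𝓝 x) (γ α β : Fin m) :
    ContMDiffAt (𝓡 n) 𝓘(ℝ, ℝ) ∞ (structFun hs A γ α β) x :=
  contMDiffAt_frame_coeff hs (A.contMDiffAt_localBracket (hasSmoothGerm_frame hs hU α)
    (hasSmoothGerm_frame hs hU β)) hU γ

lemma coeff_localBracket_triv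
    (e : Trivialization (Fib m) (TotalSpace.proj : TotalSpace (Fib m) E → M))
    [MemTrivializationAtlas e] (hU : U ∈ 𝓝 x) (hx : x ∈ e.baseSet) (c d : Fib m) (γ : Fin m) :
    hs.coeff γ x (A.localBracket (fun x => e.symm x c) (fun x => e.symm x d) x) =
      mvfderiv (𝓡 n) (fun x => hs.coeff γ x (e.symm x d)) x (A.anchor x (e.symm x c))
      - mvfderiv (𝓡 n) (fun x => hs.coeff γ x (e.symm x c)) x (A.anchor x (e.symm x d))
      + ∑ α, ∑ β, hs.coeff α x (e.symm x c) * hs.coeff β x (e.symm x d)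
          * structFun hs A γ α β x := by
  have hxU := mem_of_mem_nhds hU
  have hgerm (c : Fib m) : HasSmoothGerm n m (fun x => e.symm x c) x :=
    hasSmoothGerm_of_eventually_contMDiffAt (eventually_contMDiffAt_triv_symm e hx c)
  have hcoeff (c : Fib m) (α : Fin m) :
      HasSmoothFunGerm (𝓡 n) (fun x => hs.coeff α x (e.symm x c)) x :=
    hasSmoothFunGerm_of_eventually_contMDiffAt
      (eventually_contMDiffAt_coeff_triv_symm hs e hU hx c α)
  have hsum (c : Fib m) : ∀ᶠ y in 𝓝 x, e.symm y c = ∑ α, hs.coeff α y (e.symm y c) • s α y :=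
    (eventually_mem_nhds_iff.2 hU).mono fun y hy =>
      (frame_sum_coeff hs (mem_of_mem_nhds hy) _).symm
  have hframe := hasSmoothGerm_frame hs hU
  have hright (α : Fin m) := A.localBracket_sum_smul_right (hframe α) hframe (hcoeff d) (hsum d)
  rw [A.localBracket_sum_smul_left (hgerm d) hframe (hcoeff c) (hgerm c) (hsum c), map_sum,
    mvfderiv_anchor_eq_sum hs hxU _ (e.symm x c)]
  simp only [hright, map_sub, map_smul, map_sum, map_add, smul_eq_mul,
    frame_coeff_self hs hxU]
  simp only [structFun, mul_ite, mul_one, mul_zero, Finset.sum_add_distrib, Finset.sum_sub_distrib,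
    Finset.sum_ite_eq, Finset.mem_univ, if_true, mul_add, Finset.mul_sum]
  simp only [mul_assoc]
  ring

end StructureFunctions

section BracketComponents

variable {w : TotalSpace (Fib m) E} {s : Fin m → ∀ x, E x} {U : Set M}
  (hs : IsLocalFrameOn (𝓡 n) (Fib m) ∞ s U) {ρ ν : A.Sec}

lemma coeff_bracketFst (hU : U ∈ 𝓝 w.proj) (hρ : SmoothAt ρ w) (hν : SmoothAt ν w) (γ : Fin m) :
    hs.coeff γ w.proj (bracketFst ρ ν w) =
      D ρ (fun w' => dualX hs γ w' (ν w')) w - D ν (fun w' => dualX hs γ w' (ρ w')) w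
      + ∑ α, ∑ β, dualX hs α w (ρ w) * dualX hs β w (ν w) * structFun hs A γ α β w.proj := by
  set e := trivializationAt (Fib m) E w.proj
  have hw : w.proj ∈ e.baseSet := FiberBundle.mem_baseSet_trivializationAt' _
  have hderivν := coeff_symm_mvfderiv_triv hs hU (r := fun w' => (ν w').1.1) hν.1 (ρ w).1.2 γ
  have hderivρ := coeff_symm_mvfderiv_triv hs hU (r := fun w' => (ρ w').1.1) hρ.1 (ν w).1.2 γ
  have hsymm_sub (p q : Fib m) : e.symm w.proj (p - q) = e.symm w.proj p - e.symm w.proj q := by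
    simp only [← Trivialization.symmₗ_apply (R := ℝ) _ hw, map_sub]
  have hlocal := coeff_localBracket_triv (A := A) hs e hU hw (trivComp ρ w.proj w)
    (trivComp ν w.proj w) γ
  have hsymm (τ : A.Sec) : e.symm w.proj (trivComp τ w.proj w) = (τ w).1.1 :=
    Trivialization.symm_apply_apply_mk _ hw _
  rw [hsymm, hsymm, anchor_eq_tangentProj, anchor_eq_tangentProj] at hlocal
  unfold bracketFst D
  rw [map_add, hsymm_sub, map_sub, hlocal]
  simp only [dualX_apply]
  unfold trivComp
  linarith

omit [T2Space M] in
lemma D_D_comp_proj (hU : U ∈ 𝓝 w.proj) {f : M → ℝ}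
    (hf : ContMDiffAt (𝓡 n) 𝓘(ℝ, ℝ) ∞ f w.proj) (hν : SmoothAt ν w) :
    D ρ (D ν fun w' => f w'.proj) w =
      ∑ α, ∑ β, dualX hs α w (ρ w) * dualX hs β w (ν w) *
        mvfderiv (𝓡 n) (fun y => mvfderiv (𝓡 n) f y (A.anchor y (s β y))) w.proj
          (A.anchor w.proj (s α w.proj))
      + ∑ β, D ρ (fun w' => dualX hs β w' (ν w')) w *
          mvfderiv (𝓡 n) f w.proj (A.anchor w.proj (s β w.proj)) := by
  set F : Fin m → M → ℝ := fun β y => mvfderiv (𝓡 n) f y (A.anchor y (s β y))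
  have hF (β : Fin m) : ContMDiffAt (𝓡 n) 𝓘(ℝ, ℝ) ∞ (F β) w.proj :=
    contMDiffAt_mvfderiv_apply hf (contMDiffAt_anchor_frame hs hU β)
  have hF' (β : Fin m) := (hF β).mdifferentiableAt (by simp)
  have hF_proj (β : Fin m) := (smoothFunAt_comp_proj (hF β)).mdifferentiableAt (by simp)
  have hdual (β : Fin m) := (hν.dualX hs hU β).mdifferentiableAt (by simp)
  have hpull : D ν (fun w' => f w'.proj) =ᶠ[𝓝 w]
      fun w' => ∑ β, dualX hs β w' (ν w') * F β w'.proj := by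
    filter_upwards [eventually_proj_nhds (eventually_mdifferentiableAt_of_contMDiffAt hf),
      eventually_proj_nhds (eventually_mem_nhds_iff.2 hU)] with w' hw' hw'U
    unfold D
    rw [mvfderiv_comp_proj hw', ← anchor_eq_tangentProj,
      mvfderiv_anchor_eq_sum hs (mem_of_mem_nhds hw'U)]
    rfl
  rw [Finset.sum_comm, ← Finset.sum_add_distrib]
  refine (mvfderiv_congr_of_eventuallyEq hpull _).trans <|
    (mvfderiv_finset_sum_apply (f := fun β w' => dualX hs β w' (ν w') * F β w'.proj) _
      (fun β => (hdual β).mul (hF_proj β)) _).trans (Finset.sum_congr rfl fun β _ => ?_)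
  rw [mvfderiv_mul_apply (hdual β) (hF_proj β), mvfderiv_comp_proj (hF' β),
    ← anchor_eq_tangentProj, mvfderiv_anchor_eq_sum hs (mem_of_mem_nhds hU), Finset.mul_sum]
  refine congrArg₂ _ (Finset.sum_congr rfl fun α _ => ?_) rfl
  rw [← dualX_apply]
  ring

include hs in
lemma mvfderiv_anchor_bracketFst (hU : U ∈ 𝓝 w.proj) (hρ : SmoothAt ρ w) (hν : SmoothAt ν w)
    {f : M → ℝ} (hf : ContMDiffAt (𝓡 n) 𝓘(ℝ, ℝ) ∞ f w.proj) :
    mvfderiv (𝓡 n) f w.proj (A.anchor w.proj (bracketFst ρ ν w)) =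
      D ρ (D ν fun w' => f w'.proj) w - D ν (D ρ fun w' => f w'.proj) w := by
  rw [mvfderiv_anchor_eq_sum hs (mem_of_mem_nhds hU), D_D_comp_proj hs hU hf hν,
    D_D_comp_proj hs hU hf hρ,
    Finset.sum_comm (f := fun α β => dualX hs α w (ν w) * dualX hs β w (ρ w) * _)]
  simp only [coeff_bracketFst hs hU hρ hν, add_mul, sub_mul, Finset.sum_add_distrib,
    Finset.sum_sub_distrib, sum_sum_sum_mul, sum_structFun_mul_mvfderiv_anchor hs hU hf, mul_sub,
    mul_comm (dualX hs _ w (ν w)) (dualX hs _ w (ρ w))]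
  ring

lemma br_val (hρ : SmoothAt ρ w) (hν : SmoothAt ν w) :
    (br ρ ν w).1 = (bracketFst ρ ν w, bracketSnd ρ ν w) := by
  obtain ⟨s, U, hU, hs⟩ := exists_frame (n := n) (m := m) (E := E) w.proj
  have hmem : (bracketFst ρ ν w, bracketSnd ρ ν w) ∈ A.prolong w := by
    change A.anchor w.proj (bracketFst ρ ν w) = tangentProj n w (bracketSnd ρ ν w)
    refine tangent_ext_of_mvfderiv fun l => ?_
    have hf : ContMDiffAt (𝓡 n) 𝓘(ℝ, ℝ) ∞ (fun y => l (extChartAt (𝓡 n) w.proj y)) w.proj :=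
      l.contDiff.contMDiff.contMDiffAt.comp w.proj contMDiffAt_extChartAt
    rw [mvfderiv_anchor_bracketFst hs hU hρ hν hf,
      ← mvfderiv_comp_proj (hf.mdifferentiableAt (by simp))]
    exact (mvfderiv_mlieBracket (smoothFunAt_comp_proj hf) hρ.2 hν.2).symm
  unfold br
  rw [dif_pos hmem]

lemma dualX_br (hU : U ∈ 𝓝 w.proj) (hρ : SmoothAt ρ w) (hν : SmoothAt ν w) (γ : Fin m) :
    dualX hs γ w (br ρ ν w) =
      D ρ (fun w' => dualX hs γ w' (ν w')) w - D ν (fun w' => dualX hs γ w' (ρ w')) w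
      + ∑ α, ∑ β, dualX hs α w (ρ w) * dualX hs β w (ν w) * structFun hs A γ α β w.proj := by
  rw [dualX_apply, br_val hρ hν]
  exact coeff_bracketFst hs hU hρ hν γ

lemma differential_br (hρ : SmoothAt ρ w) (hν : SmoothAt ν w) {f : TotalSpace (Fib m) E → ℝ}
    (hf : SmoothFunAt n f w) :
    differential f w (br ρ ν w) = D ρ (D ν f) w - D ν (D ρ f) w := by
  change mvfderiv (IE n m) f w (br ρ ν w).1.2 = _
  rw [br_val hρ hν]
  exact mvfderiv_mlieBracket hf hρ.2 hν.2

lemma dualV_br (hU : U ∈ 𝓝 w.proj) (hρ : SmoothAt ρ w) (hν : SmoothAt ν w) (γ : Fin m) :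
    dualV hs γ w (br ρ ν w) =
      D ρ (fun w' => dualV hs γ w' (ν w')) w - D ν (fun w' => dualV hs γ w' (ρ w')) w :=
  differential_br hρ hν (smoothFunAt_fibCoord hs hU γ)

end BracketComponents

section FrameBrackets

variable {w : TotalSpace (Fib m) E} {s : Fin m → ∀ x, E x} {U : Set M}
  (hs : IsLocalFrameOn (𝓡 n) (Fib m) ∞ s U)

lemma br_frameX_frameV (hU : U ∈ 𝓝 w.proj) (α β : Fin m) :
    br (frameX A hs α) (frameV A s β) w = 0 := by
  have hX := smoothAt_frameX (A := A) hs hU α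
  have hV := smoothAt_frameV (A := A) hs hU β
  refine prolong_ext hs hU (fun γ => ?_) fun γ => ?_
  · rw [dualX_br hs hU hX hV, D_dualX_frameV, D_dualX_frameX hs _ hU]
    simp [dualX_frameV]
  · simp [dualV_br hs hU hX hV, D_dualV_frameV hs _ hU, D_dualV_frameX hs _ hU]

include hs in
lemma br_frameV_frameV (hU : U ∈ 𝓝 w.proj) (α β : Fin m) :
    br (frameV A s α) (frameV A s β) w = 0 := by
  have hVα := smoothAt_frameV (A := A) hs hU α
  have hVβ := smoothAt_frameV (A := A) hs hU β
  refine prolong_ext hs hU (fun γ => ?_) fun γ => ?_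
  · rw [dualX_br hs hU hVα hVβ, D_dualX_frameV, D_dualX_frameV]
    simp [dualX_frameV]
  · simp [dualV_br hs hU hVα hVβ, D_dualV_frameV hs _ hU]

lemma D_frameX_frameV_comm (hU : U ∈ 𝓝 w.proj) {f : TotalSpace (Fib m) E → ℝ}
    (hf : SmoothFunAt n f w) (α β : Fin m) :
    D (frameX A hs α) (D (frameV A s β) f) w = D (frameV A s β) (D (frameX A hs α) f) w := by
  have h := differential_br (smoothAt_frameX (A := A) hs hU α) (smoothAt_frameV hs hU β) hf
  rw [br_frameX_frameV hs hU, map_zero] at h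
  exact sub_eq_zero.1 h.symm

include hs in
lemma D_frameV_frameV_comm (hU : U ∈ 𝓝 w.proj) {f : TotalSpace (Fib m) E → ℝ}
    (hf : SmoothFunAt n f w) (α β : Fin m) :
    D (frameV A s α) (D (frameV A s β) f) w = D (frameV A s β) (D (frameV A s α) f) w := by
  have h := differential_br (smoothAt_frameV (A := A) hs hU α) (smoothAt_frameV hs hU β) hf
  rw [br_frameV_frameV hs hU, map_zero] at h
  exact sub_eq_zero.1 h.symm

end FrameBrackets

section CartanForm

variable {s : Fin m → ∀ x, E x} {U : Set M} (hs : IsLocalFrameOn (𝓡 n) (Fib m) ∞ s U)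
  {L : TotalSpace (Fib m) E → ℝ} {w : TotalSpace (Fib m) E} {ρ ν : A.Sec}

include hs in
lemma gMat_symm (A : LieAlgebroid n m E) (hU : U ∈ 𝓝 w.proj) (hL : SmoothFunNear n L w)
    (α β : Fin m) : gMat s L w α β = gMat s L w β α := by
  rw [gMat_eq_D hs A hU hL, gMat_eq_D hs A hU hL, D_eq_differential, D_eq_differential,
    differential_congr (dY_eventuallyEq_D A hL β), differential_congr (dY_eventuallyEq_D A hL α)]
  exact D_frameV_frameV_comm hs hU hL.self_of_nhds α β

lemma omega_eq_sum (hU : U ∈ 𝓝 w.proj) (hL : SmoothFunNear n L w) (hρ : SmoothAt ρ w)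
    (hν : SmoothAt ν w) :
    omega L ρ ν w = ∑ β, dualX hs β w (ν w) * differential (dY s β L) w (ρ w)
      - ∑ α, dualX hs α w (ρ w) * differential (dY s α L) w (ν w)
      - ∑ α, ∑ β, dualX hs α w (ρ w) * dualX hs β w (ν w)
        * ∑ γ, structFun hs A γ α β w.proj * dY s γ L w := by
  unfold omega
  rw [D_theta hs hU hL ρ hν, D_theta hs hU hL ν hρ, theta_eq_sum hs hU hL.self_of_nhds,
    ← sum_sum_sum_mul]
  simp only [dualX_br hs hU hρ hν, add_mul, sub_mul, Finset.sum_add_distrib,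
    Finset.sum_sub_distrib, D_eq_differential]
  ring

end CartanForm

lemma exists_section {w : TotalSpace (Fib m) E} (z : A.prolong w) :
    ∃ ν : A.Sec, (∀ w', SmoothAt ν w') ∧ ν w = z ∧ (IsVertical z → ∀ w', IsVertical (ν w')) := by
  obtain ⟨s, U, hU, hs⟩ := exists_frame (n := n) (m := m) (E := E) w.proj
  obtain ⟨χ, hχ, hsupp, hχ1⟩ :=
    exists_contMDiff_tsupport_subset_eventuallyEq_one (I := 𝓡 n) (interior_mem_nhds.2 hU)
  refine ⟨frameSum hs (fun α w' => χ w'.proj * dualX hs α w z)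
    fun α w' => χ w'.proj * dualV hs α w z, smoothAt_frameSum_cutoff hs hχ hsupp _ _, ?_,
    fun hz w' => ?_⟩
  · have hone : χ w.proj = 1 := hχ1.self_of_nhds
    simp only [frameSum, hone, one_mul]
    exact (eq_sum_frame hs hU z).symm
  · have hX : (fun α (w' : TotalSpace (Fib m) E) => χ w'.proj * dualX hs α w z) = 0 :=
      funext₂ fun α w' => by simp only [hz.dualX_eq_zero hs, mul_zero, Pi.zero_apply]
    rw [hX]
    exact isVertical_frameSum hs _ w'

section EulerLagrange

variable {s : Fin m → ∀ x, E x} {U : Set M} (hs : IsLocalFrameOn (𝓡 n) (Fib m) ∞ s U)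
  {W : Set (TotalSpace (Fib m) E)} {L : TotalSpace (Fib m) E → ℝ} {w : TotalSpace (Fib m) E}
  {S ρ ν : A.Sec}

/-- `σ^i_β ∂L/∂x^i + y^α L^γ_{αβ} ∂L/∂y^γ`, the prescribed derivative of `∂L/∂y^β` along the
Euler–Lagrange section. -/
def eulerLagrangeRhs (A : LieAlgebroid n m E) (L : TotalSpace (Fib m) E → ℝ) (β : Fin m)
    (w : TotalSpace (Fib m) E) : ℝ :=
  D (frameX A hs β) L w + ∑ α, fibCoord hs α w * ∑ γ, structFun hs A γ α β w.proj * dY s γ L w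

/-- The Euler–Lagrange equations at `w` for an element `z` of `𝒯_w E`, in a local frame. -/
structure IsLocalEulerLagrange (L : TotalSpace (Fib m) E → ℝ) (w : TotalSpace (Fib m) E)
    (z : A.prolong w) : Prop where
  fst_eq : z.1.1 = w.2
  differential_dY_eq : ∀ β, differential (dY s β L) w z = eulerLagrangeRhs hs A L β w

lemma omega_add_D_energy (hU : U ∈ 𝓝 w.proj) (hL : SmoothFunNear n L w) (hρ : SmoothAt ρ w)
    (hν : SmoothAt ν w) :
    omega L ρ ν w + D ν (A.energy L) w =
      ∑ β, dualX hs β w (ν w) * (differential (dY s β L) w (ρ w) - D (frameX A hs β) L w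
        - ∑ α, dualX hs α w (ρ w) * ∑ γ, structFun hs A γ α β w.proj * dY s γ L w)
      - ∑ α, (dualX hs α w (ρ w) - fibCoord hs α w) * differential (dY s α L) w (ν w) := by
  rw [omega_eq_sum hs hU hL hρ hν, D_energy hs hU hL, Finset.sum_comm (γ := Fin m)]
  simp only [mul_sub, sub_mul, Finset.sum_sub_distrib, Finset.mul_sum, D_eq_differential ν,
    mul_left_comm (dualX hs _ w (ν w)) (dualX hs _ w (ρ w)), mul_assoc]
  ring

lemma isLocalEulerLagrange_of_omega_eq (hU : U ∈ 𝓝 w.proj) (hL : SmoothFunNear n L w)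
    (hreg : ∀ a : E w.proj, (∀ b, fiberHess L w a b = 0) → a = 0) (hS : SmoothAt S w)
    (h : ∀ ν : A.Sec, (∀ w', SmoothAt ν w') → omega L S ν w = -D ν (A.energy L) w) :
    IsLocalEulerLagrange hs L w (S w) := by
  have htest (z : A.prolong w) :
      ∑ β, dualX hs β w z * (differential (dY s β L) w (S w) - D (frameX A hs β) L w
        - ∑ α, dualX hs α w (S w) * ∑ γ, structFun hs A γ α β w.proj * dY s γ L w)
      - ∑ α, (dualX hs α w (S w) - fibCoord hs α w) * differential (dY s α L) w z = 0 := by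
    obtain ⟨ν, hν, rfl, -⟩ := exists_section z
    rw [← omega_add_D_energy hs hU hL hS (hν w), h ν hν, neg_add_cancel]
  have hkernel :
      (gMat s L w).mulVec (fun α => dualX hs α w (S w) - fibCoord hs α w) = 0 := by
    ext δ
    have hδ := htest (frameV A s δ w)
    simp only [dualX_frameV, zero_mul, Finset.sum_const_zero, zero_sub, neg_eq_zero,
      ← D_eq_differential, ← gMat_eq_D hs A hU hL, mul_comm _ (gMat s L w δ _)] at hδ
    exact hδ
  have hsemi (α : Fin m) : dualX hs α w (S w) = fibCoord hs α w :=
    sub_eq_zero.1 <| congrFun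
      (Matrix.eq_zero_of_mulVec_eq_zero (gMat_det_ne_zero hs hU hL hreg) hkernel) α
  refine ⟨frame_ext hs (mem_of_mem_nhds hU) hsemi, fun δ => ?_⟩
  have hδ := htest (frameX A hs δ w)
  simp only [hsemi, dualX_frameX hs hU, sub_self, zero_mul, Finset.sum_const_zero, sub_zero,
    ite_mul, one_mul, Finset.sum_ite_eq', Finset.mem_univ, if_true] at hδ
  unfold eulerLagrangeRhs
  linarith

lemma IsLocalEulerLagrange.omega_eq (h : IsLocalEulerLagrange hs L w (S w)) (hU : U ∈ 𝓝 w.proj)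
    (hL : SmoothFunNear n L w) (hS : SmoothAt S w) (hν : SmoothAt ν w) :
    omega L S ν w = -D ν (A.energy L) w := by
  refine eq_neg_of_add_eq_zero_left ?_
  rw [omega_add_D_energy hs hU hL hS hν]
  simp [h.differential_dY_eq, dualX_eq_fibCoord hs h.fst_eq, eulerLagrangeRhs]

omit [T2Space M] in
lemma IsLocalEulerLagrange.unique {z z' : A.prolong w} (h : IsLocalEulerLagrange hs L w z)
    (h' : IsLocalEulerLagrange hs L w z') (hU : U ∈ 𝓝 w.proj) (hL : SmoothFunNear n L w)
    (hreg : ∀ a : E w.proj, (∀ b, fiberHess L w a b = 0) → a = 0) : z = z' := by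
  have hvert : IsVertical (z - z') := sub_eq_zero.2 (h.fst_eq.trans h'.fst_eq.symm)
  have hkernel : Matrix.vecMul (fun α => dualV hs α w (z - z')) (gMat s L w) = 0 := by
    ext β
    have hβ : differential (dY s β L) w (z - z') = 0 := by
      rw [map_sub, h.differential_dY_eq, h'.differential_dY_eq, sub_self]
    simp only [differential_of_isVertical hs hU _ hvert, ← gMat_eq_D hs A hU hL] at hβ
    exact hβ
  have hdualV := Matrix.eq_zero_of_vecMul_eq_zero (gMat_det_ne_zero hs hU hL hreg) hkernel
  refine sub_eq_zero.1 (prolong_ext hs hU (fun α => ?_) fun α => ?_)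
  · rw [hvert.dualX_eq_zero, map_zero]
  · rw [map_zero]
    exact congrFun hdualV α

lemma IsLocalEulerLagrange.change_frame {z : A.prolong w} (h : IsLocalEulerLagrange hs L w z)
    (hU : U ∈ 𝓝 w.proj) {s' : Fin m → ∀ x, E x} {U' : Set M}
    (hs' : IsLocalFrameOn (𝓡 n) (Fib m) ∞ s' U') (hU' : U' ∈ 𝓝 w.proj)
    (hL : SmoothFunNear n L w) (hreg : ∀ a : E w.proj, (∀ b, fiberHess L w a b = 0) → a = 0) :
    IsLocalEulerLagrange hs' L w z := by
  obtain ⟨S, hS, rfl, -⟩ := exists_section z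
  exact isLocalEulerLagrange_of_omega_eq hs' hU' hL hreg (hS w) fun ν hν =>
    h.omega_eq hs hU hL (hS w) (hν w)

/-- The vertical components of the Euler–Lagrange section, lowered with the metric. -/
def eulerLagrangeForce (A : LieAlgebroid n m E) (L : TotalSpace (Fib m) E → ℝ) (β : Fin m)
    (w : TotalSpace (Fib m) E) : ℝ :=
  eulerLagrangeRhs hs A L β w - ∑ ε, fibCoord hs ε w * D (frameX A hs ε) (dY s β L) w

/-- The solution of the Euler–Lagrange equations in a local frame. -/
def eulerLagrangeSection (A : LieAlgebroid n m E) (L : TotalSpace (Fib m) E → ℝ) : A.Sec :=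
  frameSum hs (fibCoord hs) fun α w =>
    ∑ β, eulerLagrangeForce hs A L β w * (gMat s L w)⁻¹ β α

omit [T2Space M] in
lemma isLocalEulerLagrange_eulerLagrangeSection (hU : U ∈ 𝓝 w.proj) (hL : SmoothFunNear n L w)
    (hreg : ∀ a : E w.proj, (∀ b, fiberHess L w a b = 0) → a = 0) :
    IsLocalEulerLagrange hs L w (eulerLagrangeSection hs A L w) := by
  have hinv : Matrix.vecMul (Matrix.vecMul (fun β => eulerLagrangeForce hs A L β w)
      (gMat s L w)⁻¹) (gMat s L w) = fun β => eulerLagrangeForce hs A L β w := by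
    rw [Matrix.vecMul_vecMul, Matrix.nonsing_inv_mul _
      (gMat_det_ne_zero hs hU hL hreg).isUnit, Matrix.vecMul_one]
  have hdualX (α : Fin m) :
      dualX hs α w (eulerLagrangeSection hs A L w) = fibCoord hs α w :=
    dualX_frameSum hs _ _ hU α
  refine ⟨frame_ext hs (mem_of_mem_nhds hU) hdualX, fun β => ?_⟩
  have hforce : ∑ α, (∑ β, eulerLagrangeForce hs A L β w * (gMat s L w)⁻¹ β α) *
      gMat s L w α β = eulerLagrangeForce hs A L β w := congrFun hinv β
  rw [differential_eq_sum hs hU]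
  simp only [eulerLagrangeSection, dualX_frameSum hs _ _ hU, dualV_frameSum hs _ _ hU,
    ← gMat_eq_D hs A hU hL]
  rw [hforce, eulerLagrangeForce, add_sub_cancel]

lemma smoothFunAt_eulerLagrangeRhs (hU : U ∈ 𝓝 w.proj) (hL : SmoothFunNear n L w) (β : Fin m) :
    SmoothFunAt n (eulerLagrangeRhs hs A L β) w :=
  ((smoothAt_frameX hs hU β).D hL.self_of_nhds).add <| ContMDiffAt.sum fun α _ =>
    (smoothFunAt_fibCoord hs hU α).mul <| ContMDiffAt.sum fun γ _ =>
      (smoothFunAt_comp_proj (contMDiffAt_structFun hs hU γ α β)).mul (smoothFunAt_dY hs hU hL γ)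

lemma smoothAt_eulerLagrangeSection (hU : U ∈ 𝓝 w.proj) (hL : SmoothFunNear n L w)
    (hreg : ∀ a : E w.proj, (∀ b, fiberHess L w a b = 0) → a = 0) :
    SmoothAt (eulerLagrangeSection hs A L) w := by
  have hforce (β : Fin m) : SmoothFunAt n (eulerLagrangeForce hs A L β) w :=
    (smoothFunAt_eulerLagrangeRhs hs hU hL β).sub <| ContMDiffAt.sum fun ε _ =>
      (smoothFunAt_fibCoord hs hU ε).mul ((smoothAt_frameX hs hU ε).D (smoothFunAt_dY hs hU hL β))
  exact smoothAt_frameSum hs hU (smoothFunAt_fibCoord hs hU) fun α =>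
    ContMDiffAt.sum fun β _ => (hforce β).mul <| contMDiffAt_matrix_inv_apply
      (smoothFunAt_gMat hs hU hL) (gMat_det_ne_zero hs hU hL hreg) β α

end EulerLagrange

section Semispray

variable {S ρ : A.Sec} {w : TotalSpace (Fib m) E} {W : Set (TotalSpace (Fib m) E)}

omit [T2Space M] in
lemma isSemispray_iff : IsSemispray S W ↔ ∀ w ∈ W, (S w).1.1 = w.2 := by
  refine forall₂_congr fun w _ => ⟨fun h => ?_, congrArg (A.vert w)⟩
  obtain ⟨s, U, hU, hs⟩ := exists_frame (n := n) (m := m) (E := E) w.proj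
  refine frame_ext hs (mem_of_mem_nhds hU) fun α => ?_
  rw [← dualV_vert hs hU, ← dualV_vert hs hU]
  exact congrArg (dualV hs α w) h

omit [T2Space M] in
lemma IsSemispray.eventually_fst_eq (h : IsSemispray S W) (hW : W ∈ 𝓝 w) :
    ∀ᶠ w' in 𝓝 w, (S w').1.1 = w'.2 :=
  mem_of_superset hW (isSemispray_iff.1 h)

variable {s : Fin m → ∀ x, E x} {U : Set M} (hs : IsLocalFrameOn (𝓡 n) (Fib m) ∞ s U)

lemma dualX_br_semispray (hU : U ∈ 𝓝 w.proj) (hS : SmoothAt S w)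
    (hsemi : ∀ᶠ w' in 𝓝 w, (S w').1.1 = w'.2) (hρ : SmoothAt ρ w) (γ : Fin m) :
    dualX hs γ w (br S ρ w) = D S (fun w' => dualX hs γ w' (ρ w')) w - dualV hs γ w (ρ w)
      + ∑ β, dualX hs β w (ρ w) * ∑ α, fibCoord hs α w * structFun hs A γ α β w.proj := by
  have hcoord : (fun w' => dualX hs γ w' (S w')) =ᶠ[𝓝 w] fibCoord hs γ :=
    hsemi.mono fun w' h => dualX_eq_fibCoord hs h γ
  have hderiv : D ρ (fun w' => dualX hs γ w' (S w')) w = dualV hs γ w (ρ w) :=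
    differential_congr hcoord (ρ w)
  rw [dualX_br hs hU hS hρ, hderiv, Finset.sum_comm]
  simp only [dualX_eq_fibCoord hs hsemi.self_of_nhds, Finset.mul_sum, mul_left_comm, mul_assoc]

lemma D_frameV_D (hU : U ∈ 𝓝 w.proj) (hS : SmoothAt S w)
    (hsemi : ∀ᶠ w' in 𝓝 w, (S w').1.1 = w'.2) {f : TotalSpace (Fib m) E → ℝ}
    (hf : SmoothFunAt n f w) (δ : Fin m) :
    D (frameV A s δ) (D S f) w = D S (D (frameV A s δ) f) w + D (frameX A hs δ) f w
      + ∑ γ, D (frameV A s δ) (fun w' => dualV hs γ w' (S w')) w * D (frameV A s γ) f w := by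
  have hV := smoothAt_frameV (A := A) hs hU δ
  have hdualX (γ : Fin m) :
      dualX hs γ w (br S (frameV A s δ) w) = -if γ = δ then (1 : ℝ) else 0 := by
    rw [dualX_br_semispray hs hU hS hsemi hV, D_dualX_frameV, dualV_frameV hs hU]
    simp [dualX_frameV]
  have hdualV (γ : Fin m) : dualV hs γ w (br S (frameV A s δ) w) =
      -D (frameV A s δ) (fun w' => dualV hs γ w' (S w')) w := by
    rw [dualV_br hs hU hS hV, D_dualV_frameV hs S hU, zero_sub]
  have hbr := differential_br hS hV hf
  rw [differential_eq_sum hs hU] at hbr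
  simp only [hdualX, hdualV, neg_mul, ite_mul, one_mul, zero_mul, Finset.sum_neg_distrib,
    Finset.sum_ite_eq', Finset.mem_univ, if_true] at hbr
  linarith

end Semispray

section InducedConnection

variable {s : Fin m → ∀ x, E x} {U : Set M} (hs : IsLocalFrameOn (𝓡 n) (Fib m) ∞ s U)
  {S ρ : A.Sec} {w : TotalSpace (Fib m) E} {W : Set (TotalSpace (Fib m) E)}

/-- `∂S^γ/∂y^β + y^α L^γ_{αβ}`: the `𝒱_γ`-component of `-[S, J𝒳_β] + J[S, 𝒳_β]` for a
semispray `S`. -/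
def inducedCoeff (S : A.Sec) (γ β : Fin m) (w : TotalSpace (Fib m) E) : ℝ :=
  D (frameV A s β) (fun w' => dualV hs γ w' (S w')) w
    + ∑ α, fibCoord hs α w * structFun hs A γ α β w.proj

lemma smoothFunAt_inducedCoeff (hU : U ∈ 𝓝 w.proj) (hS : SmoothAt S w) (γ β : Fin m) :
    SmoothFunAt n (inducedCoeff hs S γ β) w :=
  ((smoothAt_frameV hs hU β).D (hS.dualV hs hU γ)).add <| ContMDiffAt.sum fun α _ =>
    (smoothFunAt_fibCoord hs hU α).mul
      (smoothFunAt_comp_proj (contMDiffAt_structFun hs hU γ α β))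

lemma dualV_br_J (hU : U ∈ 𝓝 w.proj) (hS : SmoothAt S w) (hρ : SmoothAt ρ w) (γ : Fin m) :
    dualV hs γ w (br S (J ρ) w) = D S (fun w' => dualX hs γ w' (ρ w')) w
      - ∑ β, dualX hs β w (ρ w) * D (frameV A s β) (fun w' => dualV hs γ w' (S w')) w := by
  have hcoord : (fun w' => dualV hs γ w' (J ρ w')) =ᶠ[𝓝 w] fun w' => dualX hs γ w' (ρ w') :=
    (eventually_proj_nhds (eventually_mem_nhds_iff.2 hU)).mono fun w' h => dualV_J hs h ρ γ
  have hvert : IsVertical (J ρ w) := rfl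
  rw [dualV_br hs hU hS (hρ.J hs hU), D_eq_differential S, differential_congr hcoord,
    D_eq_differential (J ρ), differential_of_isVertical hs hU _ hvert]
  simp only [dualV_J hs hU]
  rfl

lemma neg_br_J_add_J_br (hU : U ∈ 𝓝 w.proj) (hS : SmoothAt S w)
    (hsemi : ∀ᶠ w' in 𝓝 w, (S w').1.1 = w'.2) (hρ : SmoothAt ρ w) :
    -br S (J ρ) w + J (br S ρ) w =
      frameReflection hs (Matrix.of fun γ β => inducedCoeff hs S γ β w) w (ρ w) := by
  refine prolong_ext hs hU (fun γ => ?_) fun γ => ?_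
  · have hconst : D S (fun w' => dualX hs γ w' (J ρ w')) w = 0 :=
      D_eq_zero_of_eventually_const S (.of_forall fun w' => dualX_J hs ρ w' γ)
    rw [dualX_frameReflection hs _ hU, map_add, map_neg,
      dualX_br_semispray hs hU hS hsemi (hρ.J hs hU), dualV_J hs hU, hconst]
    simp [dualX_J]
  · rw [dualV_frameReflection hs _ hU, map_add, map_neg, dualV_br_J hs hU hS hρ, dualV_J hs hU,
      dualX_br_semispray hs hU hS hsemi hρ]
    simp only [Matrix.of_apply, inducedCoeff, mul_add, Finset.sum_add_distrib]
    ring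

omit [T2Space M] in
lemma smoothAt_frameReflection (hU : U ∈ 𝓝 w.proj)
    {c : TotalSpace (Fib m) E → Matrix (Fin m) (Fin m) ℝ}
    (hc : ∀ α β, SmoothFunAt n (fun w' => c w' α β) w) (hρ : SmoothAt ρ w) :
    SmoothAt (fun w' => frameReflection hs (c w') w' (ρ w')) w := by
  have hev := eventually_proj_nhds (eventually_mem_nhds_iff.2 hU)
  refine smoothAt_of_components hs hU (fun α => ?_) fun α => ?_
  · exact (hρ.dualX hs hU α).congr_of_eventuallyEq <|
      hev.mono fun w' h => dualX_frameReflection hs _ h _ α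
  · refine ContMDiffAt.congr_of_eventuallyEq ?_ <|
      hev.mono fun w' h => dualV_frameReflection hs _ h _ α
    exact (ContMDiffAt.sum fun β _ => (hρ.dualX hs hU β).mul (hc α β)).sub (hρ.dualV hs hU α)

lemma exists_isInducedBy (hW : IsOpen W) (hS : SmoothOn S W) (hsemi : IsSemispray S W) :
    ∃ N : A.NonlinearConnection W, N.IsInducedBy S := by
  choose s U hU hs using exists_frame (n := n) (m := m) (E := E)
  let N (w : TotalSpace (Fib m) E) : A.prolong w →ₗ[ℝ] A.prolong w := frameReflection (hs w.proj)
    (Matrix.of fun γ β => inducedCoeff (hs w.proj) S γ β w) w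
  have hinduced (w₀ : TotalSpace (Fib m) E) {w : TotalSpace (Fib m) E} (hw : w ∈ W)
      (hU₀ : U w₀.proj ∈ 𝓝 w.proj) {ρ : A.Sec} (hρ : SmoothOn ρ W) :
      -br S (J ρ) w + J (br S ρ) w = frameReflection (hs w₀.proj)
        (Matrix.of fun γ β => inducedCoeff (hs w₀.proj) S γ β w) w (ρ w) :=
    neg_br_J_add_J_br _ hU₀ (hS.smoothAt (hW.mem_nhds hw))
      (hsemi.eventually_fst_eq (hW.mem_nhds hw)) (hρ.smoothAt (hW.mem_nhds hw))
  have hN {ρ : A.Sec} (hρ : SmoothOn ρ W) {w : TotalSpace (Fib m) E} (hw : w ∈ W) :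
      N w (ρ w) = -br S (J ρ) w + J (br S ρ) w := (hinduced w hw (hU _) hρ).symm
  have hsmooth (ρ : A.Sec) (hρ : SmoothOn ρ W) : SmoothOn (fun w => N w (ρ w)) W := by
    refine smoothOn_of_smoothAt fun w hw => ?_
    refine (smoothAt_frameReflection (hs w.proj) (hU _)
      (fun γ β => smoothFunAt_inducedCoeff (hs w.proj) (hU _)
        (hS.smoothAt (hW.mem_nhds hw)) γ β) (hρ.smoothAt (hW.mem_nhds hw))).congr ?_
    filter_upwards [hW.mem_nhds hw,
      eventually_proj_nhds (eventually_mem_nhds_iff.2 (hU w.proj))] with w' hw' hU'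
    exact (hN hρ hw').trans (hinduced w hw' hU' hρ)
  exact ⟨{ toFun := N
           sq := fun w _ => frameReflection_frameReflection _ _ (hU _)
           ker := fun w _ => add_frameReflection_eq_zero_iff _ _ (hU _)
           smooth := hsmooth }, fun ρ hρ w hw => hN hρ hw⟩

lemma NonlinearConnection.IsInducedBy.coeff_eq {N : A.NonlinearConnection W}
    (hN : N.IsInducedBy S) (hU : U ∈ 𝓝 w.proj) (hW : IsOpen W) (hS : SmoothOn S W)
    (hsemi : IsSemispray S W) (hw : w ∈ W) (α β : Fin m) :
    N.coeff hs α β w = -(1 / 2 : ℝ) * inducedCoeff hs S α β w := by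
  obtain ⟨ρ, hρ, hρw, -⟩ := exists_section (frameX A hs β w)
  have htoFun := hN ρ (smoothOn_of_smoothAt fun w' _ => hρ w') w hw
  rw [neg_br_J_add_J_br hs hU (hS.smoothAt (hW.mem_nhds hw))
    (hsemi.eventually_fst_eq (hW.mem_nhds hw)) (hρ w), hρw] at htoFun
  have hcoeff := N.dualV_toFun_frameX hs hU α β
  rw [htoFun, dualV_frameReflection hs _ hU, dualV_frameX hs hU] at hcoeff
  simp only [dualX_frameX hs hU, Matrix.of_apply, ite_mul, one_mul, zero_mul,
    Finset.sum_ite_eq', Finset.mem_univ, if_true, sub_zero] at hcoeff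
  linarith

end InducedConnection

section EulerLagrangeSection

variable {W : Set (TotalSpace (Fib m) E)} {L : TotalSpace (Fib m) E → ℝ}
  {w : TotalSpace (Fib m) E} {S S' : A.Sec}

lemma exists_isEulerLagrange (A : LieAlgebroid n m E) (hW : IsOpen W)
    (hL : ContMDiffOn (IE n m) 𝓘(ℝ, ℝ) ∞ L W) (hreg : IsRegularOn L W) :
    ∃ S : A.Sec, IsEulerLagrange L S W := by
  choose s U hU hs using exists_frame (n := n) (m := m) (E := E)
  let S : A.Sec := fun w => eulerLagrangeSection (hs w.proj) A L w
  have hlocal {w : TotalSpace (Fib m) E} (hw : w ∈ W) :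
      IsLocalEulerLagrange (hs w.proj) L w (S w) :=
    isLocalEulerLagrange_eulerLagrangeSection _ (hU _) (smoothFunNear_of_contMDiffOn hW hL hw)
      (hreg w hw)
  have hsmooth {w : TotalSpace (Fib m) E} (hw : w ∈ W) : SmoothAt S w := by
    refine (smoothAt_eulerLagrangeSection (A := A) (hs w.proj) (hU _)
      (smoothFunNear_of_contMDiffOn hW hL hw) (hreg w hw)).congr ?_
    filter_upwards [hW.mem_nhds hw,
      eventually_proj_nhds (eventually_mem_nhds_iff.2 (hU w.proj))] with w' hw' hU'
    have hL' := smoothFunNear_of_contMDiffOn hW hL hw'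
    exact ((hlocal hw').change_frame _ (hU _) (hs w.proj) hU' hL' (hreg w' hw')).unique _
      (isLocalEulerLagrange_eulerLagrangeSection _ hU' hL' (hreg w' hw')) hU' hL' (hreg w' hw')
  exact ⟨S, smoothOn_of_smoothAt fun w hw => hsmooth hw, fun ν hν w hw =>
    (hlocal hw).omega_eq _ (hU _) (smoothFunNear_of_contMDiffOn hW hL hw) (hsmooth hw)
      (hν.smoothAt (hW.mem_nhds hw))⟩

lemma IsEulerLagrange.isLocalEulerLagrange (h : IsEulerLagrange L S W) (hW : IsOpen W)
    (hL : ContMDiffOn (IE n m) 𝓘(ℝ, ℝ) ∞ L W) (hreg : IsRegularOn L W)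
    {s : Fin m → ∀ x, E x} {U : Set M} (hs : IsLocalFrameOn (𝓡 n) (Fib m) ∞ s U)
    (hU : U ∈ 𝓝 w.proj) (hw : w ∈ W) : IsLocalEulerLagrange hs L w (S w) :=
  isLocalEulerLagrange_of_omega_eq hs hU (smoothFunNear_of_contMDiffOn hW hL hw) (hreg w hw)
    (h.smooth.smoothAt (hW.mem_nhds hw)) fun ν hν =>
      h.eq ν (smoothOn_of_smoothAt fun w' _ => hν w') w hw

lemma IsEulerLagrange.eventually_isLocalEulerLagrange (h : IsEulerLagrange L S W)
    (hW : IsOpen W) (hL : ContMDiffOn (IE n m) 𝓘(ℝ, ℝ) ∞ L W) (hreg : IsRegularOn L W)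
    {s : Fin m → ∀ x, E x} {U : Set M} (hs : IsLocalFrameOn (𝓡 n) (Fib m) ∞ s U)
    (hU : U ∈ 𝓝 w.proj) (hw : w ∈ W) :
    ∀ᶠ w' in 𝓝 w, IsLocalEulerLagrange hs L w' (S w') := by
  filter_upwards [hW.mem_nhds hw, eventually_proj_nhds (eventually_mem_nhds_iff.2 hU)]
    with w' hw' hU' using h.isLocalEulerLagrange hW hL hreg hs hU' hw'

lemma IsEulerLagrange.unique (h : IsEulerLagrange L S W) (h' : IsEulerLagrange L S' W)
    (hW : IsOpen W) (hL : ContMDiffOn (IE n m) 𝓘(ℝ, ℝ) ∞ L W) (hreg : IsRegularOn L W)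
    (hw : w ∈ W) : S' w = S w := by
  obtain ⟨s, U, hU, hs⟩ := exists_frame (n := n) (m := m) (E := E) w.proj
  exact (h'.isLocalEulerLagrange hW hL hreg hs hU hw).unique hs
    (h.isLocalEulerLagrange hW hL hreg hs hU hw) hU (smoothFunNear_of_contMDiffOn hW hL hw)
    (hreg w hw)

lemma IsEulerLagrange.isSemispray (h : IsEulerLagrange L S W) (hW : IsOpen W)
    (hL : ContMDiffOn (IE n m) 𝓘(ℝ, ℝ) ∞ L W) (hreg : IsRegularOn L W) : IsSemispray S W := by
  refine isSemispray_iff.2 fun w hw => ?_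
  obtain ⟨s, U, hU, hs⟩ := exists_frame (n := n) (m := m) (E := E) w.proj
  exact (h.isLocalEulerLagrange hW hL hreg hs hU hw).fst_eq

end EulerLagrangeSection

section FibreDerivative

variable {s : Fin m → ∀ x, E x} {U : Set M} (hs : IsLocalFrameOn (𝓡 n) (Fib m) ∞ s U)
  {L : TotalSpace (Fib m) E → ℝ} {w : TotalSpace (Fib m) E} {S : A.Sec}

/-- `g_{γα} L^γ_{βε} y^ε`. -/
def structLow (A : LieAlgebroid n m E) (L : TotalSpace (Fib m) E → ℝ) (α β : Fin m)
    (w : TotalSpace (Fib m) E) : ℝ :=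
  ∑ ε, ∑ γ, gMat s L w γ α * structFun hs A γ β ε w.proj * fibCoord hs ε w

omit [ContMDiffVectorBundle ∞ (Fib m) E (𝓡 n)] [T2Space M] in
lemma symPart_eq (S : A.Sec) (α β : Fin m) (w : TotalSpace (Fib m) E) :
    symPart hs L S α β w = D S (fun w' => gMat s L w' α β) w + structLow hs A L β α w
      + structLow hs A L α β w := by
  simp only [symPart, structLow, add_mul, Finset.sum_add_distrib, add_assoc]

lemma sum_gMat_mul_sum_fibCoord (hU : U ∈ 𝓝 w.proj) (hL : SmoothFunNear n L w) (α β : Fin m) :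
    ∑ γ, gMat s L w α γ * ∑ ε, fibCoord hs ε w * structFun hs A γ ε β w.proj =
      -structLow hs A L α β w := by
  simp only [structLow, Finset.mul_sum, ← Finset.sum_neg_distrib]
  rw [Finset.sum_comm]
  refine Finset.sum_congr rfl fun ε _ => Finset.sum_congr rfl fun γ _ => ?_
  rw [structFun_skew hs hU γ ε β, gMat_symm hs A hU hL α γ]
  ring

lemma smoothFunAt_sum_structFun_mul_dY (A : LieAlgebroid n m E) (hU : U ∈ 𝓝 w.proj)
    (hL : SmoothFunNear n L w) (α β : Fin m) :
    SmoothFunAt n (fun w' => ∑ γ, structFun hs A γ α β w'.proj * dY s γ L w') w :=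
  ContMDiffAt.sum fun γ _ =>
    (smoothFunAt_comp_proj (contMDiffAt_structFun hs hU γ α β)).mul (smoothFunAt_dY hs hU hL γ)

lemma D_frameV_sum_structFun_mul_dY (hU : U ∈ 𝓝 w.proj) (hL : SmoothFunNear n L w)
    (δ α β : Fin m) :
    D (frameV A s δ) (fun w' => ∑ γ, structFun hs A γ α β w'.proj * dY s γ L w') w =
      ∑ γ, gMat s L w δ γ * structFun hs A γ α β w.proj := by
  have hstruct (γ : Fin m) := contMDiffAt_structFun (A := A) hs hU γ α β
  rw [D_eq_differential, differential_sum_mul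
    (f := fun γ w' => structFun hs A γ α β w'.proj) (fun γ => smoothFunAt_comp_proj (hstruct γ))
    (smoothFunAt_dY hs hU hL)]
  refine Finset.sum_congr rfl fun γ _ => ?_
  rw [← D_eq_differential, ← D_eq_differential, ← gMat_eq_D hs A hU hL,
    D_frameV_comp_proj ((hstruct γ).mdifferentiableAt (by simp)), zero_mul, add_zero, mul_comm]

lemma D_frameV_eulerLagrangeRhs (hU : U ∈ 𝓝 w.proj) (hL : SmoothFunNear n L w) (δ β : Fin m) :
    D (frameV A s δ) (eulerLagrangeRhs hs A L β) w = D (frameX A hs β) (dY s δ L) w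
      + ∑ γ, structFun hs A γ δ β w.proj * dY s γ L w - structLow hs A L δ β w := by
  have hfib := smoothFunAt_fibCoord (n := n) hs hU
  have hinner (α : Fin m) := smoothFunAt_sum_structFun_mul_dY hs A hU hL α β
  have hX : D (frameV A s δ) (D (frameX A hs β) L) w = D (frameX A hs β) (dY s δ L) w :=
    (D_frameX_frameV_comm hs hU hL.self_of_nhds β δ).symm.trans
      (differential_congr (dY_eventuallyEq_D A hL δ) _).symm
  have hfibCoord (α : Fin m) :
      differential (fibCoord hs α) w (frameV A s δ w) = if α = δ then 1 else 0 :=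
    dualV_frameV hs hU α δ
  have hswap : ∑ α, fibCoord hs α w * ∑ γ, gMat s L w δ γ * structFun hs A γ α β w.proj =
      -structLow hs A L δ β w := by
    rw [← sum_gMat_mul_sum_fibCoord hs hU hL]
    simp only [Finset.mul_sum, mul_left_comm (fibCoord hs _ w)]
    exact Finset.sum_comm
  have hfirst : SmoothFunAt n (D (frameX A hs β) L) w :=
    (smoothAt_frameX hs hU β).D hL.self_of_nhds
  have hsecond : SmoothFunAt n (fun w' => ∑ α, fibCoord hs α w' *
      ∑ γ, structFun hs A γ α β w'.proj * dY s γ L w') w :=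
    ContMDiffAt.sum fun α _ => (hfib α).mul (hinner α)
  have hadd : D (frameV A s δ) (eulerLagrangeRhs hs A L β) w =
      D (frameV A s δ) (D (frameX A hs β) L) w + differential (fun w' => ∑ α, fibCoord hs α w' *
        ∑ γ, structFun hs A γ α β w'.proj * dY s γ L w') w (frameV A s δ w) :=
    differential_add hfirst hsecond (frameV A s δ w)
  rw [hadd, hX, differential_sum_mul hfib hinner]
  simp only [hfibCoord, ← D_eq_differential, D_frameV_sum_structFun_mul_dY hs hU hL,
    Finset.sum_add_distrib, ite_mul, one_mul, zero_mul, Finset.sum_ite_eq', Finset.mem_univ,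
    if_true, hswap]
  ring

-- Differentiate the Euler–Lagrange equations `S(∂L/∂y^β) = …` along the fibres.
lemma D_gMat_add_sum_D_frameV (hU : U ∈ 𝓝 w.proj) (hL : SmoothFunNear n L w) (hS : SmoothAt S w)
    (hEL : ∀ᶠ w' in 𝓝 w, IsLocalEulerLagrange hs L w' (S w')) (δ β : Fin m) :
    D S (fun w' => gMat s L w' δ β) w + D (frameX A hs δ) (dY s β L) w
      + ∑ γ, gMat s L w β γ * D (frameV A s δ) (fun w' => dualV hs γ w' (S w')) w =
    D (frameX A hs β) (dY s δ L) w + ∑ γ, structFun hs A γ δ β w.proj * dY s γ L w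
      - structLow hs A L δ β w := by
  have hRhs : D S (dY s β L) =ᶠ[𝓝 w] eulerLagrangeRhs hs A L β :=
    hEL.mono fun w' h => h.differential_dY_eq β
  have hgMat : D (frameV A s δ) (dY s β L) =ᶠ[𝓝 w] fun w' => gMat s L w' δ β := by
    filter_upwards [eventually_proj_nhds (eventually_mem_nhds_iff.2 hU), hL.eventually_nhds]
      with w' hU' hL' using (gMat_eq_D hs A hU' hL' δ β).symm
  have hgMat_S : D S (D (frameV A s δ) (dY s β L)) w = D S (fun w' => gMat s L w' δ β) w :=
    differential_congr hgMat _
  have hcomm := D_frameV_D hs hU hS (hEL.mono fun w' h => h.fst_eq) (smoothFunAt_dY hs hU hL β) δ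
  rw [D_eq_differential, differential_congr hRhs, ← D_eq_differential,
    D_frameV_eulerLagrangeRhs hs hU hL, hgMat_S] at hcomm
  simp only [← gMat_eq_D hs A hU hL, gMat_symm hs A hU hL _ β, mul_comm _ (gMat s L w β _)]
    at hcomm
  linarith

end FibreDerivative

section LocalParts

variable {s : Fin m → ∀ x, E x} {U : Set M} (hs : IsLocalFrameOn (𝓡 n) (Fib m) ∞ s U)
  {L : TotalSpace (Fib m) E → ℝ} {w : TotalSpace (Fib m) E} {S : A.Sec}

omit [T2Space M] in
lemma metric_eq_sum (hU : U ∈ 𝓝 w.proj) (hL : SmoothFunNear n L w) {ρ ν : A.Sec}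
    (hρ : IsVertical (ρ w)) (hν : IsVertical (ν w)) :
    metric L ρ ν w =
      ∑ α, ∑ β, dualV hs α w (ρ w) * dualV hs β w (ν w) * gMat s L w α β := by
  simp only [metric, fiberHess_eq_sum_gMat hs hU hL, coeff_fiberPart hs hU hρ,
    coeff_fiberPart hs hU hν]

lemma D_gMat_symm (hs : IsLocalFrameOn (𝓡 n) (Fib m) ∞ s U) (hU : U ∈ 𝓝 w.proj)
    (hL : SmoothFunNear n L w) (S : A.Sec) (α β : Fin m) :
    D S (fun w' => gMat s L w' α β) w = D S (fun w' => gMat s L w' β α) w := by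
  refine differential_congr ?_ _
  filter_upwards [eventually_proj_nhds (eventually_mem_nhds_iff.2 hU), hL.eventually_nhds]
    with w' hU' hL' using gMat_symm hs A hU' hL' α β

lemma symPart_symm (hU : U ∈ 𝓝 w.proj) (hL : SmoothFunNear n L w) (S : A.Sec) (α β : Fin m) :
    symPart hs L S α β w = symPart hs L S β α w := by
  rw [symPart_eq, symPart_eq, D_gMat_symm hs hU hL]
  ring

omit [T2Space M] in
lemma skewPart_eq (hU : U ∈ 𝓝 w.proj) (hL : SmoothFunNear n L w) (α β : Fin m) :
    skewPart hs A L α β w = D (frameX A hs β) (dY s α L) w - D (frameX A hs α) (dY s β L) w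
      + ∑ γ, structFun hs A γ α β w.proj * dY s γ L w := by
  have hdY (γ : Fin m) := (smoothFunAt_dY hs hU hL γ).mdifferentiableAt (by simp)
  rw [skewPart, D_frameX hs hU β (hdY α), D_frameX hs hU α (hdY β)]

omit [ContMDiffVectorBundle ∞ (Fib m) E (𝓡 n)] in
lemma skewPart_skew (hU : U ∈ 𝓝 w.proj) (α β : Fin m) :
    skewPart hs A L α β w = -skewPart hs A L β α w := by
  simp only [skewPart, structFun_skew hs hU _ α β, neg_mul, Finset.sum_neg_distrib]
  ring

lemma sum_gMat_mul_inducedCoeff (hU : U ∈ 𝓝 w.proj) (hL : SmoothFunNear n L w)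
    (hS : SmoothAt S w) (hEL : ∀ᶠ w' in 𝓝 w, IsLocalEulerLagrange hs L w' (S w'))
    (α β : Fin m) :
    ∑ γ, gMat s L w α γ * inducedCoeff hs S γ β w =
      -(symPart hs L S α β w + skewPart hs A L α β w) := by
  have hEuler := D_gMat_add_sum_D_frameV hs hU hL hS hEL β α
  have hskew : ∑ γ, structFun hs A γ β α w.proj * dY s γ L w =
      -∑ γ, structFun hs A γ α β w.proj * dY s γ L w := by
    simp only [structFun_skew hs hU _ β α, neg_mul, Finset.sum_neg_distrib]
  simp only [inducedCoeff, mul_add, Finset.sum_add_distrib,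
    sum_gMat_mul_sum_fibCoord hs hU hL]
  rw [D_gMat_symm hs hU hL, hskew] at hEuler
  rw [symPart_eq, skewPart_eq hs hU hL]
  linarith

end LocalParts

namespace NonlinearConnection

variable {s : Fin m → ∀ x, E x} {U : Set M} (hs : IsLocalFrameOn (𝓡 n) (Fib m) ∞ s U)
  {W : Set (TotalSpace (Fib m) E)} (N : A.NonlinearConnection W)
  {L : TotalSpace (Fib m) E → ℝ} {w : TotalSpace (Fib m) E}

lemma differential_dY_h (hU : U ∈ 𝓝 w.proj) (hL : SmoothFunNear n L w) (hw : w ∈ W)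
    (τ : A.Sec) (β : Fin m) :
    differential (dY s β L) w (N.h τ w) =
      ∑ α, dualX hs α w (τ w) * (D (frameX A hs α) (dY s β L) w - N.low hs L β α w) := by
  rw [differential_eq_sum hs hU]
  simp only [N.dualX_h hs hw, N.dualV_h hs hU hw, ← gMat_eq_D hs A hU hL, low, mul_sub,
    Finset.sum_sub_distrib, neg_mul, Finset.sum_neg_distrib, ← sub_eq_add_neg, Finset.sum_mul,
    Finset.mul_sum]
  rw [Finset.sum_comm]
  simp only [gMat_symm hs A hU hL _ β, mul_assoc, mul_comm (N.coeff hs _ _ w)]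

lemma omega_h_h (hU : U ∈ 𝓝 w.proj) (hW : IsOpen W) (hL : SmoothFunNear n L w) (hw : w ∈ W)
    {ρ ν : A.Sec} (hρ : SmoothOn ρ W) (hν : SmoothOn ν W) :
    omega L (N.h ρ) (N.h ν) w = ∑ α, ∑ β, dualX hs α w (ρ w) * dualX hs β w (ν w) *
      (N.low hs L α β w - N.low hs L β α w - skewPart hs A L α β w) := by
  have hhor {τ : A.Sec} (hτ : SmoothOn τ W) := (N.smoothOn_h hW hτ).smoothAt (hW.mem_nhds hw)
  rw [omega_eq_sum hs hU hL (hhor hρ) (hhor hν)]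
  simp only [N.dualX_h hs hw, N.differential_dY_h hs hU hL hw, skewPart_eq hs hU hL,
    Finset.mul_sum]
  rw [Finset.sum_comm]
  simp only [← Finset.sum_sub_distrib]
  refine Finset.sum_congr rfl fun α _ => Finset.sum_congr rfl fun β _ => ?_
  rw [← Finset.mul_sum]
  ring

lemma isSymplectic_iff (hW : IsOpen W) (hL : ContMDiffOn (IE n m) 𝓘(ℝ, ℝ) ∞ L W) :
    N.IsSymplectic L ↔ ∀ (U : Set M) (_ : IsOpen U) (s : Fin m → ∀ x, E x)
      (hs : IsLocalFrameOn (𝓡 n) (Fib m) ∞ s U), ∀ w ∈ W, w.proj ∈ U → ∀ α β : Fin m,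
        (1 / 2 : ℝ) * (N.low hs L α β w - N.low hs L β α w) =
          (1 / 2 : ℝ) * skewPart hs A L α β w := by
  constructor
  · intro h U hU s hs w hw hwU α β
    obtain ⟨ρ, hρ, hρw, -⟩ := exists_section (frameX A hs α w)
    obtain ⟨ν, hν, hνw, -⟩ := exists_section (frameX A hs β w)
    have hρW : SmoothOn ρ W := smoothOn_of_smoothAt fun w' _ => hρ w'
    have hνW : SmoothOn ν W := smoothOn_of_smoothAt fun w' _ => hν w'
    have hU' := hU.mem_nhds hwU
    have hzero := h ρ ν hρW hνW w hw
    rw [N.omega_h_h hs hU' hW (smoothFunNear_of_contMDiffOn hW hL hw) hw hρW hνW, hρw,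
      hνw] at hzero
    simp only [dualX_frameX hs hU', ite_mul, mul_ite, one_mul, mul_one, zero_mul, mul_zero,
      Finset.sum_ite_eq', Finset.mem_univ, if_true] at hzero
    linarith
  · intro h ρ ν hρ hν w hw
    obtain ⟨s, U, hU, hs⟩ := exists_frame (n := n) (m := m) (E := E) w.proj
    have hs' := hs.mono interior_subset
    rw [N.omega_h_h hs' (interior_mem_nhds.2 hU) hW (smoothFunNear_of_contMDiffOn hW hL hw) hw
      hρ hν]
    refine Finset.sum_eq_zero fun α _ => Finset.sum_eq_zero fun β _ => ?_
    have hlow := h _ isOpen_interior s hs' w hw (mem_interior_iff_mem_nhds.2 hU) α β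
    rw [mul_left_cancel₀ (by norm_num) hlow, sub_self, mul_zero]

end NonlinearConnection

section BracketLocality

variable {S ρ ν : A.Sec} {w : TotalSpace (Fib m) E}

lemma br_congr_right (hS : SmoothAt S w) (hν : SmoothAt ν w)
    (h : ∀ᶠ w' in 𝓝 w, ρ w' = ν w') : br S ρ w = br S ν w := by
  obtain ⟨s, U, hU, hs⟩ := exists_frame (n := n) (m := m) (E := E) w.proj
  have hρ : SmoothAt ρ w := hν.congr h
  refine prolong_ext hs hU (fun γ => ?_) fun γ => ?_
  · have hD : D S (fun w' => dualX hs γ w' (ρ w')) w = D S (fun w' => dualX hs γ w' (ν w')) w :=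
      differential_congr (h.mono fun w' hw' => by rw [hw']) _
    rw [dualX_br hs hU hS hρ, dualX_br hs hU hS hν, hD, D_eq_differential ρ, h.self_of_nhds]
    rfl
  · have hD : D S (fun w' => dualV hs γ w' (ρ w')) w = D S (fun w' => dualV hs γ w' (ν w')) w :=
      differential_congr (h.mono fun w' hw' => by rw [hw']) _
    rw [dualV_br hs hU hS hρ, dualV_br hs hU hS hν, hD, D_eq_differential ρ, h.self_of_nhds]
    rfl

lemma br_eq_zero_of_eventuallyEq_zero (hS : SmoothAt S w) (hρ : SmoothAt ρ w)
    (h : ∀ᶠ w' in 𝓝 w, ρ w' = 0) : br S ρ w = 0 := by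
  obtain ⟨s, U, hU, hs⟩ := exists_frame (n := n) (m := m) (E := E) w.proj
  refine prolong_ext hs hU (fun γ => ?_) fun γ => ?_
  · have hD : D S (fun w' => dualX hs γ w' (ρ w')) w = 0 :=
      D_eq_zero_of_eventually_const S (h.mono fun w' hw' => by rw [hw', map_zero])
    rw [dualX_br hs hU hS hρ, hD, D_eq_differential, h.self_of_nhds]
    simp
  · have hD : D S (fun w' => dualV hs γ w' (ρ w')) w = 0 :=
      D_eq_zero_of_eventually_const S (h.mono fun w' hw' => by rw [hw', map_zero])
    rw [dualV_br hs hU hS hρ, hD, D_eq_differential, h.self_of_nhds]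
    simp

end BracketLocality

namespace NonlinearConnection

section Nabla

variable {W : Set (TotalSpace (Fib m) E)} (N : A.NonlinearConnection W)
  {L : TotalSpace (Fib m) E → ℝ} {w : TotalSpace (Fib m) E} {S ρ ν : A.Sec}

lemma nabla_of_isVertical (hW : IsOpen W) (hS : SmoothAt S w) (hρ : SmoothOn ρ W)
    (hvert : ∀ w ∈ W, IsVertical (ρ w)) (hw : w ∈ W) :
    N.nabla S ρ w = N.v (br S ρ) w := by
  have hsmooth {τ : A.Sec} (hτ : SmoothOn τ W) := hτ.smoothAt (hW.mem_nhds hw)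
  have hzero : br S (N.h ρ) w = 0 :=
    br_eq_zero_of_eventuallyEq_zero hS (hsmooth (N.smoothOn_h hW hρ)) <|
      mem_of_superset (hW.mem_nhds hw) fun w' hw' => N.h_of_isVertical hw' (hvert w' hw')
  have hv : ∀ᶠ w' in 𝓝 w, N.v ρ w' = ρ w' :=
    mem_of_superset (hW.mem_nhds hw) fun w' hw' => N.v_of_isVertical hw' (hvert w' hw')
  change (1 / 2 : ℝ) • (br S (N.h ρ) w + N.toFun w (br S (N.h ρ) w)) +
    (1 / 2 : ℝ) • (br S (N.v ρ) w - N.toFun w (br S (N.v ρ) w)) = _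
  rw [hzero, map_zero, add_zero, smul_zero, zero_add, br_congr_right hS (hsmooth hρ) hv]
  rfl

lemma isVertical_nabla (hW : IsOpen W) (hS : SmoothAt S w) (hρ : SmoothOn ρ W)
    (hvert : ∀ w ∈ W, IsVertical (ρ w)) (hw : w ∈ W) : IsVertical (N.nabla S ρ w) := by
  rw [N.nabla_of_isVertical hW hS hρ hvert hw]
  exact N.isVertical_v hw _

variable {s : Fin m → ∀ x, E x} {U : Set M} (hs : IsLocalFrameOn (𝓡 n) (Fib m) ∞ s U)

/-- The coefficient `∂S^γ/∂y^β + N^γ_β` in `∇𝒱_β = -(∂S^γ/∂y^β + N^γ_β) 𝒱_γ`. -/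
def nablaCoeff (S : A.Sec) (γ β : Fin m) (w : TotalSpace (Fib m) E) : ℝ :=
  D (frameV A s β) (fun w' => dualV hs γ w' (S w')) w + N.coeff hs γ β w

lemma dualV_nabla (hU : U ∈ 𝓝 w.proj) (hW : IsOpen W) (hS : SmoothAt S w)
    (hsemi : IsSemispray S W) (hρ : SmoothOn ρ W) (hvert : ∀ w ∈ W, IsVertical (ρ w))
    (hw : w ∈ W) (γ : Fin m) :
    dualV hs γ w (N.nabla S ρ w) = D S (fun w' => dualV hs γ w' (ρ w')) w
      - ∑ β, dualV hs β w (ρ w) * N.nablaCoeff hs S γ β w := by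
  have hWw := hW.mem_nhds hw
  have hρw := hρ.smoothAt hWw
  have hdualX (β : Fin m) : dualX hs β w (br S ρ w) = -dualV hs β w (ρ w) := by
    have hD : D S (fun w' => dualX hs β w' (ρ w')) w = 0 := D_eq_zero_of_eventually_const S <|
      mem_of_superset hWw fun w' hw' => (hvert w' hw').dualX_eq_zero hs β
    rw [dualX_br_semispray hs hU hS (hsemi.eventually_fst_eq hWw) hρw, hD]
    simp [(hvert w hw).dualX_eq_zero hs]
  rw [N.nabla_of_isVertical hW hS hρ hvert hw, N.dualV_v hs hU hw, dualV_br hs hU hS hρw,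
    D_eq_differential ρ, differential_of_isVertical hs hU _ (hvert w hw)]
  simp only [hdualX, nablaCoeff, mul_add, Finset.sum_add_distrib, neg_mul,
    Finset.sum_neg_distrib]
  ring

omit [T2Space M] in
lemma D_metric (hU : U ∈ 𝓝 w.proj) (hW : IsOpen W) (hL : ContMDiffOn (IE n m) 𝓘(ℝ, ℝ) ∞ L W)
    (hρ : SmoothOn ρ W) (hν : SmoothOn ν W) (hρV : ∀ w ∈ W, IsVertical (ρ w))
    (hνV : ∀ w ∈ W, IsVertical (ν w)) (hw : w ∈ W) :
    D S (metric L ρ ν) w = ∑ α, ∑ β,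
      (dualV hs α w (ρ w) * dualV hs β w (ν w) * D S (fun w' => gMat s L w' α β) w
        + dualV hs α w (ρ w) * D S (fun w' => dualV hs β w' (ν w')) w * gMat s L w α β
        + D S (fun w' => dualV hs α w' (ρ w')) w * dualV hs β w (ν w) * gMat s L w α β) := by
  have hWw := hW.mem_nhds hw
  have hLw := smoothFunNear_of_contMDiffOn hW hL hw
  have hρw := (hρ.smoothAt hWw).dualV hs hU
  have hνw := (hν.smoothAt hWw).dualV hs hU
  have hg := smoothFunAt_gMat hs hU hLw
  have hmetric : metric L ρ ν =ᶠ[𝓝 w] fun w' => ∑ α, dualV hs α w' (ρ w') *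
      ∑ β, dualV hs β w' (ν w') * gMat s L w' α β := by
    filter_upwards [hWw, eventually_proj_nhds (eventually_mem_nhds_iff.2 hU)] with w' hw' hU'
    simp only [metric_eq_sum hs hU' (smoothFunNear_of_contMDiffOn hW hL hw') (hρV w' hw')
      (hνV w' hw'), Finset.mul_sum, mul_assoc]
  have hinner (α : Fin m) :
      SmoothFunAt n (fun w' => ∑ β, dualV hs β w' (ν w') * gMat s L w' α β) w :=
    ContMDiffAt.sum fun β _ => (hνw β).mul (hg α β)
  rw [D_eq_differential, differential_congr hmetric,
    differential_sum_mul (f := fun α w' => dualV hs α w' (ρ w')) hρw hinner]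
  refine Finset.sum_congr rfl fun α _ => ?_
  rw [differential_sum_mul (f := fun β w' => dualV hs β w' (ν w'))
    (g := fun β w' => gMat s L w' α β) hνw (hg α), Finset.mul_sum, Finset.mul_sum,
    ← Finset.sum_add_distrib]
  refine Finset.sum_congr rfl fun β _ => ?_
  simp only [D_eq_differential]
  ring

/-- The coefficients of the bilinear form `(ρ, ν) ↦ S(g(ρ, ν)) - g(∇ρ, ν) - g(ρ, ∇ν)` on vertical
sections. -/
def metricDefect (L : TotalSpace (Fib m) E → ℝ) (S : A.Sec) (α β : Fin m)
    (w : TotalSpace (Fib m) E) : ℝ :=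
  D S (fun w' => gMat s L w' α β) w + ∑ γ, gMat s L w γ β * N.nablaCoeff hs S γ α w
    + ∑ γ, gMat s L w α γ * N.nablaCoeff hs S γ β w

lemma D_metric_sub (hU : U ∈ 𝓝 w.proj) (hW : IsOpen W)
    (hL : ContMDiffOn (IE n m) 𝓘(ℝ, ℝ) ∞ L W) (hS : SmoothAt S w) (hsemi : IsSemispray S W)
    (hρ : SmoothOn ρ W) (hν : SmoothOn ν W) (hρV : ∀ w ∈ W, IsVertical (ρ w))
    (hνV : ∀ w ∈ W, IsVertical (ν w)) (hw : w ∈ W) :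
    D S (metric L ρ ν) w - (metric L (N.nabla S ρ) ν w + metric L ρ (N.nabla S ν) w) =
      ∑ α, ∑ β, dualV hs α w (ρ w) * dualV hs β w (ν w) * N.metricDefect hs L S α β w := by
  have hLw := smoothFunNear_of_contMDiffOn hW hL hw
  have hleft : ∑ α, ∑ β, dualV hs α w (ρ w) * dualV hs β w (ν w) *
      ∑ γ, gMat s L w γ β * N.nablaCoeff hs S γ α w =
      ∑ α, ∑ β, (∑ γ, dualV hs γ w (ρ w) * N.nablaCoeff hs S α γ w) * dualV hs β w (ν w) *
        gMat s L w α β := by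
    rw [Finset.sum_comm, Finset.sum_comm (f := fun α β =>
      (∑ γ, dualV hs γ w (ρ w) * N.nablaCoeff hs S α γ w) * dualV hs β w (ν w) * gMat s L w α β)]
    refine Finset.sum_congr rfl fun β _ => ?_
    simp only [Finset.mul_sum, Finset.sum_mul]
    rw [Finset.sum_comm]
    exact Finset.sum_congr rfl fun γ _ => Finset.sum_congr rfl fun α _ => by ring
  have hright : ∑ α, ∑ β, dualV hs α w (ρ w) * dualV hs β w (ν w) *
      ∑ γ, gMat s L w α γ * N.nablaCoeff hs S γ β w =
      ∑ α, ∑ β, dualV hs α w (ρ w) * (∑ γ, dualV hs γ w (ν w) * N.nablaCoeff hs S β γ w) *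
        gMat s L w α β := by
    simp only [Finset.mul_sum, Finset.sum_mul]
    refine Finset.sum_congr rfl fun α _ => Finset.sum_comm.trans ?_
    exact Finset.sum_congr rfl fun γ _ => Finset.sum_congr rfl fun β _ => by ring
  rw [D_metric hs hU hW hL hρ hν hρV hνV hw,
    metric_eq_sum hs hU hLw (N.isVertical_nabla hW hS hρ hρV hw) (hνV w hw),
    metric_eq_sum hs hU hLw (hρV w hw) (N.isVertical_nabla hW hS hν hνV hw)]
  simp only [N.dualV_nabla hs hU hW hS hsemi hρ hρV hw, N.dualV_nabla hs hU hW hS hsemi hν hνV hw,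
    metricDefect]
  simp only [mul_add, Finset.sum_add_distrib, hleft, hright, sub_mul, mul_sub,
    Finset.sum_sub_distrib]
  ring

lemma sum_gMat_mul_nablaCoeff (hU : U ∈ 𝓝 w.proj) (hL : SmoothFunNear n L w) (hS : SmoothAt S w)
    (hEL : ∀ᶠ w' in 𝓝 w, IsLocalEulerLagrange hs L w' (S w')) (α β : Fin m) :
    ∑ γ, gMat s L w α γ * N.nablaCoeff hs S γ β w = N.low hs L α β w
      + structLow hs A L α β w - (symPart hs L S α β w + skewPart hs A L α β w) := by
  have hinduced := sum_gMat_mul_inducedCoeff hs hU hL hS hEL α β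
  simp only [inducedCoeff, mul_add, Finset.sum_add_distrib,
    sum_gMat_mul_sum_fibCoord hs hU hL] at hinduced
  simp only [nablaCoeff, low, mul_add, Finset.sum_add_distrib]
  linarith

lemma metricDefect_eq (hU : U ∈ 𝓝 w.proj) (hL : SmoothFunNear n L w) (hS : SmoothAt S w)
    (hEL : ∀ᶠ w' in 𝓝 w, IsLocalEulerLagrange hs L w' (S w')) (α β : Fin m) :
    N.metricDefect hs L S α β w =
      N.low hs L α β w + N.low hs L β α w - symPart hs L S α β w := by
  have hsym := symPart_eq (A := A) hs (L := L) S α β w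
  have hcol : ∑ γ, gMat s L w γ β * N.nablaCoeff hs S γ α w =
      ∑ γ, gMat s L w β γ * N.nablaCoeff hs S γ α w :=
    Finset.sum_congr rfl fun γ _ => by rw [gMat_symm hs A hU hL γ β]
  rw [metricDefect, hcol, N.sum_gMat_mul_nablaCoeff hs hU hL hS hEL,
    N.sum_gMat_mul_nablaCoeff hs hU hL hS hEL, symPart_symm hs hU hL S β α,
    skewPart_skew hs hU β α]
  linarith

lemma isMetric_iff (hW : IsOpen W) (hL : ContMDiffOn (IE n m) 𝓘(ℝ, ℝ) ∞ L W)
    (hreg : IsRegularOn L W) (hS : IsEulerLagrange L S W) :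
    N.IsMetric L S ↔ ∀ (U : Set M) (_ : IsOpen U) (s : Fin m → ∀ x, E x)
      (hs : IsLocalFrameOn (𝓡 n) (Fib m) ∞ s U), ∀ w ∈ W, w.proj ∈ U → ∀ α β : Fin m,
        (1 / 2 : ℝ) * (N.low hs L α β w + N.low hs L β α w) =
          (1 / 2 : ℝ) * symPart hs L S α β w := by
  have hsemi := hS.isSemispray hW hL hreg
  have hdefect {s : Fin m → ∀ x, E x} {U : Set M} (hs : IsLocalFrameOn (𝓡 n) (Fib m) ∞ s U)
      {w : TotalSpace (Fib m) E} (hU : U ∈ 𝓝 w.proj) (hw : w ∈ W) :=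
    N.metricDefect_eq hs hU (smoothFunNear_of_contMDiffOn hW hL hw)
      (hS.smooth.smoothAt (hW.mem_nhds hw)) (hS.eventually_isLocalEulerLagrange hW hL hreg hs hU hw)
  constructor
  · intro h U hU s hs w hw hwU α β
    obtain ⟨ρ, hρ, hρw, hρV⟩ := exists_section (frameV A s α w)
    obtain ⟨ν, hν, hνw, hνV⟩ := exists_section (frameV A s β w)
    have hρW : SmoothOn ρ W := smoothOn_of_smoothAt fun w' _ => hρ w'
    have hνW : SmoothOn ν W := smoothOn_of_smoothAt fun w' _ => hν w'
    have hU' := hU.mem_nhds hwU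
    have hsum := N.D_metric_sub hs hU' hW hL (hS.smooth.smoothAt (hW.mem_nhds hw)) hsemi hρW hνW
      (fun w' _ => hρV rfl w') (fun w' _ => hνV rfl w') hw
    rw [h ρ ν hρW hνW (fun w' _ => hρV rfl w') (fun w' _ => hνV rfl w') w hw, sub_self, hρw,
      hνw] at hsum
    simp only [dualV_frameV hs hU', ite_mul, mul_ite, one_mul, mul_one, zero_mul, mul_zero,
      Finset.sum_ite_eq', Finset.mem_univ, if_true, hdefect hs hU' hw] at hsum
    linarith
  · intro h ρ ν hρ hν hρV hνV w hw
    obtain ⟨s, U, hU, hs⟩ := exists_frame (n := n) (m := m) (E := E) w.proj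
    have hs' := hs.mono interior_subset
    have hU' := interior_mem_nhds.2 hU
    refine sub_eq_zero.1 ((N.D_metric_sub hs' hU' hW hL (hS.smooth.smoothAt (hW.mem_nhds hw))
      hsemi hρ hν hρV hνV hw).trans ?_)
    refine Finset.sum_eq_zero fun α _ => Finset.sum_eq_zero fun β _ => ?_
    have hlow := h _ isOpen_interior s hs' w hw (mem_interior_iff_mem_nhds.2 hU) α β
    rw [hdefect hs' hU' hw, mul_left_cancel₀ (by norm_num) hlow, sub_self, mul_zero]

end Nabla

section Canonical

variable {W : Set (TotalSpace (Fib m) E)} {N N' : A.NonlinearConnection W}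
  {L : TotalSpace (Fib m) E → ℝ} {w : TotalSpace (Fib m) E} {S : A.Sec}
  {s : Fin m → ∀ x, E x} {U : Set M} (hs : IsLocalFrameOn (𝓡 n) (Fib m) ∞ s U)

lemma IsInducedBy.low_eq (hN : N.IsInducedBy S) (hW : IsOpen W)
    (hL : ContMDiffOn (IE n m) 𝓘(ℝ, ℝ) ∞ L W) (hreg : IsRegularOn L W)
    (hS : IsEulerLagrange L S W) (hU : U ∈ 𝓝 w.proj) (hw : w ∈ W) (α β : Fin m) :
    N.low hs L α β w = (1 / 2 : ℝ) * (symPart hs L S α β w + skewPart hs A L α β w) := by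
  have hinduced := sum_gMat_mul_inducedCoeff hs hU (smoothFunNear_of_contMDiffOn hW hL hw)
    (hS.smooth.smoothAt (hW.mem_nhds hw)) (hS.eventually_isLocalEulerLagrange hW hL hreg hs hU hw)
    α β
  simp only [low, hN.coeff_eq hs hU hW hS.smooth (hS.isSemispray hW hL hreg) hw,
    mul_left_comm (gMat s L w α _), ← Finset.mul_sum, hinduced]
  ring

lemma IsInducedBy.isMetric (hN : N.IsInducedBy S) (hW : IsOpen W)
    (hL : ContMDiffOn (IE n m) 𝓘(ℝ, ℝ) ∞ L W) (hreg : IsRegularOn L W)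
    (hS : IsEulerLagrange L S W) : N.IsMetric L S := by
  refine (N.isMetric_iff hW hL hreg hS).2 fun U hU s hs w hw hwU α β => ?_
  have hU' := hU.mem_nhds hwU
  rw [hN.low_eq hs hW hL hreg hS hU' hw, hN.low_eq hs hW hL hreg hS hU' hw,
    symPart_symm hs hU' (smoothFunNear_of_contMDiffOn hW hL hw) S β α, skewPart_skew hs hU' β α]
  ring

lemma IsInducedBy.isSymplectic (hN : N.IsInducedBy S) (hW : IsOpen W)
    (hL : ContMDiffOn (IE n m) 𝓘(ℝ, ℝ) ∞ L W) (hreg : IsRegularOn L W)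
    (hS : IsEulerLagrange L S W) : N.IsSymplectic L := by
  refine (N.isSymplectic_iff hW hL).2 fun U hU s hs w hw hwU α β => ?_
  have hU' := hU.mem_nhds hwU
  rw [hN.low_eq hs hW hL hreg hS hU' hw, hN.low_eq hs hW hL hreg hS hU' hw,
    symPart_symm hs hU' (smoothFunNear_of_contMDiffOn hW hL hw) S β α, skewPart_skew hs hU' β α]
  ring

variable (N)

omit [T2Space M] in
lemma coeff_eq_sum_low (hU : U ∈ 𝓝 w.proj) (hL : SmoothFunNear n L w)
    (hreg : ∀ a : E w.proj, (∀ b, fiberHess L w a b = 0) → a = 0) (α β : Fin m) :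
    N.coeff hs α β w = ∑ ε, (gMat s L w)⁻¹ α ε * N.low hs L ε β w := by
  have hinv : (gMat s L w)⁻¹.mulVec ((gMat s L w).mulVec fun γ => N.coeff hs γ β w) =
      fun γ => N.coeff hs γ β w := by
    rw [Matrix.mulVec_mulVec, Matrix.nonsing_inv_mul _ (gMat_det_ne_zero hs hU hL hreg).isUnit,
      Matrix.one_mulVec]
  exact (congrFun hinv α).symm

variable {N}

lemma IsInducedBy.coeff_eq_sum_inv_gMat (hN : N.IsInducedBy S) (hW : IsOpen W)
    (hL : ContMDiffOn (IE n m) 𝓘(ℝ, ℝ) ∞ L W) (hreg : IsRegularOn L W)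
    (hS : IsEulerLagrange L S W) (hU : U ∈ 𝓝 w.proj) (hw : w ∈ W) (α β : Fin m) :
    N.coeff hs α β w = (1 / 2 : ℝ) * ∑ ε, (gMat s L w)⁻¹ α ε *
      (D S (fun w' => gMat s L w' ε β) w + dX hs A β (dY s ε L) w - dX hs A ε (dY s β L) w
        - ∑ γ, structFun hs A γ β ε w.proj * dY s γ L w
        + ∑ θ, ∑ γ, (gMat s L w γ ε * structFun hs A γ β θ w.proj
          + gMat s L w γ β * structFun hs A γ ε θ w.proj) * fibCoord hs θ w) := by
  rw [N.coeff_eq_sum_low hs hU (smoothFunNear_of_contMDiffOn hW hL hw) (hreg w hw),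
    Finset.mul_sum]
  refine Finset.sum_congr rfl fun ε _ => ?_
  rw [hN.low_eq hs hW hL hreg hS hU hw, symPart, skewPart]
  simp only [structFun_skew hs hU _ β ε, neg_mul, Finset.sum_neg_distrib,
    add_comm (gMat s L w _ ε * structFun hs A _ β _ w.proj)]
  ring

lemma toFun_eq_of_isMetric_of_isSymplectic (hW : IsOpen W)
    (hL : ContMDiffOn (IE n m) 𝓘(ℝ, ℝ) ∞ L W) (hreg : IsRegularOn L W)
    (hS : IsEulerLagrange L S W) (hg : N.IsMetric L S) (hω : N.IsSymplectic L)
    (hg' : N'.IsMetric L S) (hω' : N'.IsSymplectic L) (hw : w ∈ W) :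
    N'.toFun w = N.toFun w := by
  obtain ⟨s, U, hU, hs⟩ := exists_frame (n := n) (m := m) (E := E) w.proj
  have hs' := hs.mono interior_subset
  have hU' := interior_mem_nhds.2 hU
  have hLw := smoothFunNear_of_contMDiffOn hW hL hw
  have hlow {P : A.NonlinearConnection W} (hP : P.IsMetric L S) (hP' : P.IsSymplectic L)
      (α β : Fin m) : P.low hs' L α β w =
        (1 / 2 : ℝ) * (symPart hs' L S α β w + skewPart hs' A L α β w) := by
    have hwU := mem_interior_iff_mem_nhds.2 hU
    have hsym := (P.isMetric_iff hW hL hreg hS).1 hP _ isOpen_interior s hs' w hw hwU α β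
    have hskew := (P.isSymplectic_iff hW hL).1 hP' _ isOpen_interior s hs' w hw hwU α β
    linarith
  refine N.toFun_eq_of_coeff_eq hs' hU' hw fun α β => ?_
  simp only [N.coeff_eq_sum_low hs' hU' hLw (hreg w hw),
    N'.coeff_eq_sum_low hs' hU' hLw (hreg w hw), hlow hg hω, hlow hg' hω']

end Canonical

end NonlinearConnection

end LieAlgebroid

end

theorem theorem1p4p2 {n m : ℕ} {M : Type*} [TopologicalSpace M] [T2Space M]
    [ChartedSpace (EuclideanSpace ℝ (Fin n)) M] [IsManifold (𝓡 n) ∞ M]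
    {E : M → Type*} [TopologicalSpace (TotalSpace (Fib m) E)]
    [∀ x, AddCommGroup (E x)] [∀ x, Module ℝ (E x)] [∀ x, TopologicalSpace (E x)]
    [FiberBundle (Fib m) E] [VectorBundle ℝ (Fib m) E]
    [ContMDiffVectorBundle ∞ (Fib m) E (𝓡 n)]
    (A : LieAlgebroid n m E)
    (W : Set (TotalSpace (Fib m) E)) (hW : IsOpen W)
    (L : TotalSpace (Fib m) E → ℝ) (hL : ContMDiffOn (IE n m) 𝓘(ℝ, ℝ) ∞ L W)
    (hreg : IsRegularOn L W) :
    -- the Euler–Lagrange section exists, is unique on `W`, and is a semispray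
    ∃ S : A.Sec, LieAlgebroid.IsEulerLagrange L S W ∧
      (∀ S' : A.Sec, LieAlgebroid.IsEulerLagrange L S' W → ∀ w ∈ W, S' w = S w) ∧
      LieAlgebroid.IsSemispray S W ∧
      -- the canonical nonlinear connection, with its local coefficients
      ∃ N : A.NonlinearConnection W, N.IsInducedBy S ∧
        (∀ (U : Set M) (_ : IsOpen U) (s : Fin m → ∀ x, E x)
          (hs : IsLocalFrameOn (𝓡 n) (Fib m) ∞ s U),
          ∀ w ∈ W, w.proj ∈ U → ∀ α β : Fin m,
            N.coeff hs α β w = (1 / 2 : ℝ) * ∑ ε, (LieAlgebroid.gMat s L w)⁻¹ α ε *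
              (LieAlgebroid.D S (fun w' => LieAlgebroid.gMat s L w' ε β) w
                + LieAlgebroid.dX hs A β (LieAlgebroid.dY s ε L) w
                - LieAlgebroid.dX hs A ε (LieAlgebroid.dY s β L) w
                - ∑ γ, LieAlgebroid.structFun hs A γ β ε w.proj * LieAlgebroid.dY s γ L w
                + ∑ θ, ∑ γ,
                  (LieAlgebroid.gMat s L w γ ε * LieAlgebroid.structFun hs A γ β θ w.proj
                    + LieAlgebroid.gMat s L w γ β * LieAlgebroid.structFun hs A γ ε θ w.proj)
                    * LieAlgebroid.fibCoord hs θ w)) ∧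
        -- it is metric and compatible with `ω_L`, and it is the only such connection
        N.IsMetric L S ∧ N.IsSymplectic L ∧
        (∀ N' : A.NonlinearConnection W, N'.IsMetric L S → N'.IsSymplectic L →
          ∀ w ∈ W, N'.toFun w = N.toFun w) ∧
        -- the metric condition amounts to prescribing the symmetric part of `N_{αβ}`,
        -- the symplectic condition to prescribing its skew part
        (∀ N' : A.NonlinearConnection W,
          (N'.IsMetric L S ↔
            ∀ (U : Set M) (_ : IsOpen U) (s : Fin m → ∀ x, E x)
              (hs : IsLocalFrameOn (𝓡 n) (Fib m) ∞ s U),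
              ∀ w ∈ W, w.proj ∈ U → ∀ α β : Fin m,
                (1 / 2 : ℝ) * (N'.low hs L α β w + N'.low hs L β α w) =
                  (1 / 2 : ℝ) * LieAlgebroid.symPart hs L S α β w) ∧
          (N'.IsSymplectic L ↔
            ∀ (U : Set M) (_ : IsOpen U) (s : Fin m → ∀ x, E x)
              (hs : IsLocalFrameOn (𝓡 n) (Fib m) ∞ s U),
              ∀ w ∈ W, w.proj ∈ U → ∀ α β : Fin m,
                (1 / 2 : ℝ) * (N'.low hs L α β w - N'.low hs L β α w) =
                  (1 / 2 : ℝ) * LieAlgebroid.skewPart hs A L α β w)) := by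
  obtain ⟨S, hS⟩ := LieAlgebroid.exists_isEulerLagrange A hW hL hreg
  have hsemi := hS.isSemispray hW hL hreg
  obtain ⟨N, hN⟩ := LieAlgebroid.exists_isInducedBy hW hS.smooth hsemi
  have hmetric := hN.isMetric hW hL hreg hS
  have hsymp := hN.isSymplectic hW hL hreg hS
  refine ⟨S, hS, fun S' hS' w hw => hS.unique hS' hW hL hreg hw, hsemi, N, hN, ?_, hmetric, hsymp,
    ?_, fun N' => ⟨N'.isMetric_iff hW hL hreg hS, N'.isSymplectic_iff hW hL⟩⟩
  · exact fun U hU s hs w hw hwU α β =>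
      hN.coeff_eq_sum_inv_gMat hs hW hL hreg hS (hU.mem_nhds hwU) hw α β
  · exact fun N' hg hω w hw =>
      LieAlgebroid.NonlinearConnection.toFun_eq_of_isMetric_of_isSymplectic hW hL hreg hS
        hmetric hsymp hg hω hw
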